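/- **Setting.** A \emph{Lorentzian pre-length space} $(X,\mathsf d,\ll,\leq,\tau)$ is a proper metric space $(X,\mathsf d)$ with a preorder $\leq$, a transitive relation $\ll$ contained in $\leq$, and a lower semicontinuous $\tau:X\times X\to[0,\infty]$ such that $\tau(x,y)+\tau(y,z)\leq\tau(x,z)$ whenever $x\leq y\leq z$, $\tau(x,y)=0$ if $x\not\leq y$, and $\tau(x,y)>0\Leftrightarrow x\ll y$. A \emph{causal curve} is a locally Lipschitz $\gamma:[0,1]\to X$ with $\gamma_s\leq\gamma_t$ for $s<t$; ${\rm L}_\tau(\gamma)$ is the infimum of $\sum_i\tau(\gamma_{t_i},\gamma_{t_{i+1}})$ over finite partitions of $[0,1]$, and ${\rm L}_{\mathsf d}(\gamma)$ is the metric length. The space is - \emph{locally causally closed} if each point has a neighbourhood $U$ such that $\{x\leq y\}\cap(\bar U\times\bar U)$ is closed; - \emph{$\mathsf d$-compatible} if each point has a neighbourhood $U$ and a constant $C>0$ with ${\rm L}_{\mathsf d}(\gamma)\leq C$ for all causal curves $\gamma$ in $U$; - \emph{$\mathcal K$-globally hyperbolic} if for every compact $C\subset X$ the lengths ${\rm L}_{\mathsf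 d}(\gamma)$ of causal curves $\gamma$ in $C$ are uniformly bounded, and $J^+(C_1)\cap J^-(C_2)$ is compact for all compact $C_1,C_2$, where $J^\pm(C)$ is the causal future/past of $C$; - \emph{geodesic} if any $x\leq y$ are joined by a causal curve $\gamma$ with ${\rm L}_\tau(\gamma)=\tau(x,y)$. Let $\mathfrak m$ be a Borel measure on $X$, finite on bounded sets. For Borel probability measures $\mu,\nu$ let $\Pi_\leq(\mu,\nu)$ be the set of couplings concentrated on $\{x\leq y\}$ and, for $p\in(0,1)$, $\ell_p(\mu,\nu)=\sup_{\pi\in\Pi_\leq(\mu,\nu)}\big(\int\tau^p\,d\pi\big)^{1/p}$ (with value $-\infty$ if $\Pi_\leq(\mu,\nu)=\emptyset$); maximisers are called $\ell_p$-optimal. An \emph{$\ell_p$-geodesic} is a family $(\mu_t)_{t\in[0,1]}$ of Borel probability measures with $\ell_p(\mu_s,\mu_t)=(t-s)\,\ell_p(\mu_0,\mu_1)$ for $0\leq s\leq t\leq1$. Put $\ell^p(x,y)=\tau(x,y)^p$ if $x\leq y$ and $\ell^p(x,y)=-\infty$ otherwise. The pair $(\mu,\nu)$ is \emph{strongly timelike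 $p$-dualisable by $\pi$} if: $\ell_p(\mu,\nu)\in(0,\infty)$; $\pi\in\Pi_\leq(\mu,\nu)$ is $\ell_p$-optimal and concentrated on $\{x\ll y\}$; there are measurable $a,b:X\to\mathbb R$ with $a(x)+b(y)\in L^1(\mu\otimes\nu)$ and $\ell^p(x,y)\leq a(x)+b(y)$ on ${\rm supp}\,\mu\times{\rm supp}\,\nu$; and there is a Borel set $\Gamma\subset\{x\ll y\}\cap({\rm supp}\,\mu\times{\rm supp}\,\nu)$ that is $\ell^p$-cyclically monotone (that is, $\sum_i\ell^p(x_{i+1},y_i)\leq\sum_i\ell^p(x_i,y_i)$ for all finite cyclic families $(x_i,y_i)\in\Gamma$) such that a plan $\pi'\in\Pi_\leq(\mu,\nu)$ is $\ell_p$-optimal if and only if $\pi'(\Gamma)=1$. Let ${\rm Ent}(\mu|\mathfrak m)=\int\rho\log\rho\,d\mathfrak m$ if $\mu=\rho\,\mathfrak m$ and $(\rho\log\rho)_+$ is $\mathfrak m$-integrable, and ${\rm Ent}(\mu|\mathfrak m)=+\infty$ otherwise; let ${\rm Dom}({\rm Ent})$ be the set of Borel probability measures with ${\rm Ent}(\mu|\mathfrak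 m)\in\mathbb R$, and $U_N(\mu|\mathfrak m)=\exp(-{\rm Ent}(\mu|\mathfrak m)/N)$. Let $\sigma^{(t)}_\kappa(\vartheta)=\mathfrak s_\kappa(t\vartheta)/\mathfrak s_\kappa(\vartheta)$ if $\kappa\vartheta^2\neq0$ and $\kappa\vartheta^2<\pi^2$, $\sigma^{(t)}_\kappa(\vartheta)=t$ if $\kappa\vartheta^2=0$, and $\sigma^{(t)}_\kappa(\vartheta)=+\infty$ if $\kappa\vartheta^2\geq\pi^2$, where $\mathfrak s_\kappa(\vartheta)=\sin(\sqrt\kappa\,\vartheta)/\sqrt\kappa$ for $\kappa>0$, $\mathfrak s_0(\vartheta)=\vartheta$, and $\mathfrak s_\kappa(\vartheta)=\sinh(\sqrt{-\kappa}\,\vartheta)/\sqrt{-\kappa}$ for $\kappa<0$. - $\mathsf{wTCD}^e_p(K,N)$: for all compactly supported $\mu_0,\mu_1\in{\rm Dom}({\rm Ent})$ and every $\pi$ by which $(\mu_0,\mu_1)$ is strongly timelike $p$-dualisable, there is an $\ell_p$-geodesic $(\mu_t)_{t\in[0,1]}$ from $\mu_0$ to $\mu_1$ such that $e(t)={\rm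 Ent}(\mu_t|\mathfrak m)$ is (finite and) semi-convex on $[0,1]$ and $e''-\frac1N(e')^2\geq K\int\tau^2\,d\pi$ in the sense of distributions on $(0,1)$. - $\mathsf{TMCP}^e(K,N)$ (with exponent $q\in(0,1)$): for every compactly supported $\mu_0\in{\rm Dom}({\rm Ent})$ and every $x_1\in X$ with $x\ll x_1$ for $\mu_0$-a.e. $x$, there is an $\ell_q$-geodesic $(\mu_t)_{t\in[0,1]}$ from $\mu_0$ to $\mu_1=\delta_{x_1}$ with $$U_N(\mu_t|\mathfrak m)\geq\sigma^{(1-t)}_{K/N}\Big(\big(\textstyle\int\tau(x,x_1)^2\,\mu_0(dx)\big)^{1/2}\Big)\,U_N(\mu_0|\mathfrak m)\qquad\text{for all }t\in[0,1).$$ **Proposition.** Let $p\in(0,1)$, $K\in\mathbb R$, $N\in(0,\infty)$. Let $(X,\mathsf d,\ll,\leq,\tau)$ be a locally causally closed, $\mathsf d$-compatible, $\mathcal K$-globally hyperbolic, geodesic Lorentzian pre-length space whose time separation $\tau$ is finite and continuous, and let $\mathfrak m$ be a Borel measure on $X$ that is finite on bounded sets and satisfies ${\rm supp}\,\mathfrak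 m=X$. If $(X,\mathsf d,\mathfrak m,\ll,\leq,\tau)$ satisfies $\mathsf{wTCD}^e_p(K,N)$, then it satisfies $\mathsf{TMCP}^e(K,N)$, for every choice of the exponent $q\in(0,1)$ in the latter (in particular for $q=p$). -/

import Mathlib

open MeasureTheory Set Topology
open scoped ENNReal ContDiff unitInterval

/-- A Lorentzian pre-length space `(X, d, ≪, ≤, τ)` over a proper metric space `(X, d)`:
`causal` is the preorder `≤`, `chron` is the relation `≪`, and `τ` is the time separation. -/
structure LorentzianPreLengthSpace (X : Type*) [MetricSpace X] [ProperSpace X] where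
  causal : X → X → Prop
  chron : X → X → Prop
  τ : X → X → ℝ≥0∞
  causal_refl : ∀ x, causal x x
  causal_trans : ∀ x y z, causal x y → causal y z → causal x z
  chron_trans : ∀ x y z, chron x y → chron y z → chron x z
  causal_of_chron : ∀ x y, chron x y → causal x y
  lowerSemicontinuous_τ : LowerSemicontinuous (fun z : X × X => τ z.1 z.2)
  reverse_triangle : ∀ x y z, causal x y → causal y z → τ x y + τ y z ≤ τ x z
  τ_eq_zero : ∀ x y, ¬ causal x y → τ x y = 0
  τ_pos_iff : ∀ x y, 0 < τ x y ↔ chron x y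

/-- The relative entropy `Ent(μ|m)`: if `μ = ρ m` and `(ρ log ρ)₊` is `m`-integrable, it is
`∫ ρ log ρ dm = ∫ (ρ log ρ)₊ dm - ∫ (ρ log ρ)₋ dm` (possibly `-∞`), and otherwise `+∞`. -/
noncomputable def relEntropy {X : Type*} [MeasurableSpace X] (μ m : Measure X) : EReal :=
  open Classical in
  let f : X → ℝ := fun x => (μ.rnDeriv m x).toReal * Real.log (μ.rnDeriv m x).toReal
  if μ ≪ m ∧ ∫⁻ x, ENNReal.ofReal (f x) ∂m ≠ ⊤ then
    ((∫⁻ x, ENNReal.ofReal (f x) ∂m : ℝ≥0∞) : EReal)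
      - ((∫⁻ x, ENNReal.ofReal (-f x) ∂m : ℝ≥0∞) : EReal)
  else ⊤

/-- `μ ∈ Dom(Ent(·|m))`: a probability measure with `Ent(μ|m) ∈ ℝ`. -/
def InEntropyDomain {X : Type*} [MeasurableSpace X] (μ m : Measure X) : Prop :=
  IsProbabilityMeasure μ ∧ relEntropy μ m ≠ ⊤ ∧ relEntropy μ m ≠ ⊥

/-- `U_N(μ|m) = exp(-Ent(μ|m)/N)`, with `exp(-∞) = 0` and `exp(+∞) = +∞`. -/
noncomputable def entropyPower {X : Type*} [MeasurableSpace X] (N : ℝ) (μ m : Measure X) : ℝ≥0∞ :=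
  EReal.exp (-(relEntropy μ m) / (N : EReal))

/-- The generalized sine `𝔰_κ`. -/
noncomputable def genSin (κ ϑ : ℝ) : ℝ :=
  if 0 < κ then Real.sin (√κ * ϑ) / √κ
  else if κ = 0 then ϑ
  else Real.sinh (√(-κ) * ϑ) / √(-κ)

/-- The distortion coefficient `σ_κ^{(t)}(ϑ)`, with value `+∞` when `κ ϑ² ≥ π²`. -/
noncomputable def distortion (κ t ϑ : ℝ) : ℝ≥0∞ :=
  if Real.pi ^ 2 ≤ κ * ϑ ^ 2 then ⊤
  else if κ * ϑ ^ 2 = 0 then ENNReal.ofReal t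
  else ENNReal.ofReal (genSin κ (t * ϑ) / genSin κ ϑ)

/-- `e` is semi-convex on `[0,1]`. -/
def IsSemiconvexOnUnit (e : ℝ → ℝ) : Prop :=
  ∃ c : ℝ, ConvexOn ℝ (Icc (0 : ℝ) 1) (fun t => e t + c * t ^ 2)

/-- `e'' - (e')² / N ≥ A` on `(0,1)` in the sense of distributions, i.e. tested against all
nonnegative smooth functions with compact support in `(0,1)`. It is used for semi-convex `e`
only, which is locally Lipschitz on `(0,1)`, so that all the integrals below converge. -/
def DistribIneq (N : ℝ) (A : EReal) (e : ℝ → ℝ) : Prop :=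
  ∀ φ : ℝ → ℝ, ContDiff ℝ ∞ φ → HasCompactSupport φ → tsupport φ ⊆ Ioo (0 : ℝ) 1 →
    (∀ t, 0 ≤ φ t) →
    A * ((∫ t in Ioo (0 : ℝ) 1, φ t : ℝ) : EReal) ≤
      (((∫ t in Ioo (0 : ℝ) 1, e t * iteratedDeriv 2 φ t)
        - (1 / N) * ∫ t in Ioo (0 : ℝ) 1, (deriv e t) ^ 2 * φ t : ℝ) : EReal)

namespace LorentzianPreLengthSpace

section Causality

variable {X : Type*} [MetricSpace X] [ProperSpace X] (L : LorentzianPreLengthSpace X)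

/-- Causal curves `γ : [0,1] → X`. -/
def IsCausalCurve (γ : I → X) : Prop :=
  LocallyLipschitz γ ∧ ∀ s t : I, s < t → L.causal (γ s) (γ t)

/-- The `τ`-length: the infimum of `∑ τ(γ(tᵢ), γ(tᵢ₊₁))` over all partitions
`0 = t₀ < t₁ < … < t_{k+1} = 1`. -/
noncomputable def tauLength (γ : I → X) : ℝ≥0∞ :=
  ⨅ (k : ℕ) (t : Fin (k + 2) → I) (_ : StrictMono t ∧ t 0 = 0 ∧ t (Fin.last (k + 1)) = 1),
    ∑ i : Fin (k + 1), L.τ (γ (t i.castSucc)) (γ (t i.succ))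

/-- The causal future `J⁺(A)`. -/
def causalFuture (A : Set X) : Set X := {y | ∃ x ∈ A, L.causal x y}

/-- The causal past `J⁻(A)`. -/
def causalPast (A : Set X) : Set X := {y | ∃ x ∈ A, L.causal y x}

/-- Every compact set `C` admits a bound on the `d`-length of the causal curves in `C`. -/
def NonTotallyImprisoning : Prop :=
  ∀ C : Set X, IsCompact C → ∃ b : ℝ, 0 < b ∧ ∀ γ : I → X, L.IsCausalCurve γ →
    (∀ t, γ t ∈ C) → eVariationOn γ univ ≤ ENNReal.ofReal b

/-- `𝒦`-global hyperbolicity. -/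
def KGloballyHyperbolic : Prop :=
  L.NonTotallyImprisoning ∧ ∀ C₁ C₂ : Set X, IsCompact C₁ → IsCompact C₂ →
    IsCompact (L.causalFuture C₁ ∩ L.causalPast C₂)

/-- Any two causally related points are joined by a causal curve that realizes `τ`. -/
def IsGeodesicSpace : Prop :=
  ∀ x y : X, L.causal x y →
    ∃ γ : I → X, L.IsCausalCurve γ ∧ γ 0 = x ∧ γ 1 = y ∧ L.tauLength γ = L.τ x y

/-- Every point has a neighbourhood `U` such that `≤` is closed in `closure U × closure U`. -/
def LocallyCausallyClosed : Prop :=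
  ∀ x : X, ∃ U ∈ 𝓝 x, IsClosed {z : X × X | z.1 ∈ closure U ∧ z.2 ∈ closure U ∧ L.causal z.1 z.2}

/-- Every point has a neighbourhood `U` in which the `d`-lengths of causal curves are uniformly
bounded. -/
def DCompatible : Prop :=
  ∀ x : X, ∃ U ∈ 𝓝 x, ∃ b : ℝ, 0 < b ∧ ∀ γ : I → X, L.IsCausalCurve γ →
    (∀ t, γ t ∈ U) → eVariationOn γ univ ≤ ENNReal.ofReal b

/-- `ℓ(x,y)^p`, where `ℓ = τ` on causally related pairs and `ℓ = -∞` elsewhere. -/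
noncomputable def ellPow (p : ℝ) (x y : X) : EReal :=
  open Classical in if L.causal x y then ((L.τ x y ^ p : ℝ≥0∞) : EReal) else ⊥

/-- `ℓ^p`-cyclical monotonicity: `∑ ℓ(x_{i+1}, y_i)^p ≤ ∑ ℓ(x_i, y_i)^p` along every cycle in `Γ`. -/
def CyclicallyMonotone (p : ℝ) (Γ : Set (X × X)) : Prop :=
  ∀ (n : ℕ) (z : Fin n → X × X), (∀ i, z i ∈ Γ) →
    ∑ i, L.ellPow p (z (finRotate n i)).1 (z i).2 ≤ ∑ i, L.ellPow p (z i).1 (z i).2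

end Causality

section Transport

variable {X : Type*} [MetricSpace X] [ProperSpace X] [MeasurableSpace X]
  (L : LorentzianPreLengthSpace X)

/-- The causal transport plans `Π_≤(μ,ν)`. -/
def causalPlans (μ ν : Measure X) : Set (Measure (X × X)) :=
  {π | IsProbabilityMeasure π ∧ π.map Prod.fst = μ ∧ π.map Prod.snd = ν ∧
    ∀ᵐ z ∂π, L.causal z.1 z.2}

/-- The transport cost `∫ τ^p dπ`. -/
noncomputable def cost (p : ℝ) (π : Measure (X × X)) : ℝ≥0∞ :=
  ∫⁻ z, L.τ z.1 z.2 ^ p ∂π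

/-- The `p`-Lorentz-Wasserstein distance; it is `-∞` if there is no causal plan. -/
noncomputable def ell (p : ℝ) (μ ν : Measure X) : EReal :=
  ⨆ π ∈ L.causalPlans μ ν, ((L.cost p π ^ (1 / p) : ℝ≥0∞) : EReal)

/-- The `ℓ_p`-optimal causal plans. -/
def optPlans (p : ℝ) (μ ν : Measure X) : Set (Measure (X × X)) :=
  {π | π ∈ L.causalPlans μ ν ∧ ∀ π' ∈ L.causalPlans μ ν, L.cost p π' ≤ L.cost p π}

/-- `(μ,ν)` is timelike `p`-dualisable by `π`. -/
def DualisableBy (p : ℝ) (μ ν : Measure X) (π : Measure (X × X)) : Prop :=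
  (0 < L.ell p μ ν ∧ L.ell p μ ν < ⊤) ∧
  (π ∈ L.optPlans p μ ν ∧ ∀ᵐ z ∂π, L.chron z.1 z.2) ∧
  ∃ a b : X → ℝ, Measurable a ∧ Measurable b ∧
    Integrable (fun z : X × X => a z.1 + b z.2) (μ.prod ν) ∧
    ∀ x ∈ μ.support, ∀ y ∈ ν.support, L.ellPow p x y ≤ ((a x + b y : ℝ) : EReal)

/-- `(μ,ν)` is strongly timelike `p`-dualisable by `π`. -/
def StronglyDualisableBy (p : ℝ) (μ ν : Measure X) (π : Measure (X × X)) : Prop :=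
  L.DualisableBy p μ ν π ∧
  ∃ Γ : Set (X × X), MeasurableSet Γ ∧ L.CyclicallyMonotone p Γ ∧
    (∀ z ∈ Γ, L.chron z.1 z.2 ∧ z.1 ∈ μ.support ∧ z.2 ∈ ν.support) ∧
    ∀ π' ∈ L.causalPlans μ ν, (π' ∈ L.optPlans p μ ν ↔ π' Γ = 1)

/-- `(μ_t)_{t ∈ [0,1]}` is an `ℓ_p`-geodesic (values of `μ` outside `[0,1]` are irrelevant). -/
def IsEllGeodesic (p : ℝ) (μ : ℝ → Measure X) : Prop :=
  (∀ t ∈ Icc (0 : ℝ) 1, IsProbabilityMeasure (μ t)) ∧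
  ∀ s ∈ Icc (0 : ℝ) 1, ∀ t ∈ Icc (0 : ℝ) 1, s ≤ t →
    L.ell p (μ s) (μ t) = ((t - s : ℝ) : EReal) * L.ell p (μ 0) (μ 1)

/-- The weak timelike curvature-dimension condition `wTCD^e_p(K,N)`. -/
def WTCD (m : Measure X) (p K N : ℝ) : Prop :=
  ∀ (μ₀ μ₁ : Measure X) (π : Measure (X × X)),
    InEntropyDomain μ₀ m → IsCompact μ₀.support →
    InEntropyDomain μ₁ m → IsCompact μ₁.support →
    L.StronglyDualisableBy p μ₀ μ₁ π →
    ∃ μ : ℝ → Measure X, μ 0 = μ₀ ∧ μ 1 = μ₁ ∧ L.IsEllGeodesic p μ ∧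
      (∀ t ∈ Icc (0 : ℝ) 1, InEntropyDomain (μ t) m) ∧
      IsSemiconvexOnUnit (fun t => (relEntropy (μ t) m).toReal) ∧
      DistribIneq N ((K : EReal) * ((∫⁻ z, L.τ z.1 z.2 ^ 2 ∂π : ℝ≥0∞) : EReal))
        (fun t => (relEntropy (μ t) m).toReal)

/-- The timelike measure-contraction property `TMCP^e(K,N)`, formulated with the exponent `p`.
It is meant for spaces with finite continuous `τ`, where the integral below is finite. -/
def TMCP (m : Measure X) (p K N : ℝ) : Prop :=
  ∀ (μ₀ : Measure X) (x₁ : X), InEntropyDomain μ₀ m → IsCompact μ₀.support →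
    (∀ᵐ x ∂μ₀, L.chron x x₁) →
    ∃ μ : ℝ → Measure X, μ 0 = μ₀ ∧ μ 1 = Measure.dirac x₁ ∧ L.IsEllGeodesic p μ ∧
      ∀ t ∈ Ico (0 : ℝ) 1,
        distortion (K / N) (1 - t) (√(∫⁻ x, L.τ x x₁ ^ 2 ∂μ₀).toReal) * entropyPower N μ₀ m
          ≤ entropyPower N (μ t) m

end Transport

end LorentzianPreLengthSpace

/-!
The measure contraction property is obtained by letting the second marginal of the
curvature-dimension condition shrink to a Dirac mass.

Approximation. The measure `μ₀` is conditioned on compact sets `K n ⊆ supp μ₀ ∩ {x ≪ x₁}`, and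
`δ_{x₁}` is replaced by the normalized restriction of `m` to a ball around `x₁` so small that every
point of `K n` chronologically precedes every point of the ball. For such end points all couplings
are causal, so the transport problem is a classical one with a continuous bounded cost, and strong
dualisability follows from Kantorovich duality and complementary slackness
(`exists_coupling_dual`, `exists_optimal_coupling_cyclicallyMonotone`,
`LorentzianPreLengthSpace.exists_stronglyDualisableBy`). The curvature-dimension condition therefore
provides geodesics between the approximating end points.

Comparison. After mollification, `v = exp (-e / N)` satisfies `v'' ≤ -κ v` for all
`κ ≤ K ∫ τ² dπ / N`, and Sturm comparison with the generalized sine bounds `e t` from above in terms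
of `e 0` (`DistribIneq.comparison`). No continuity of `e` at the end points is needed, because a
convex function on `[0,1]` can only jump upwards there.

Limit. All the measures live in one compact causal diamond, hence converge along an ultrafilter for
every `t`. Causality is a closed relation (`LorentzianPreLengthSpace.isClosed_causal`), so causal
plans pass to the limit with convergence of continuous costs
(`LorentzianPreLengthSpace.exists_limit_plan`), and the entropy is lower semicontinuous by its
variational formula (`relEntropy_le_of_tendsto`). The limit has the entropy bound for every
parameter below `K ∫ τ(x, x₁)² dμ₀ / N`; it also shows that this number is less than `π²`, and the
bound at the number itself follows by continuity.

Exponent. The limit family comes with plans that realize at least the `ℓ_p`-distances of a geodesic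
ending in `δ_{x₁}`. The equality case of the reverse Minkowski inequality for
`τ(x, y) + τ(y, x₁) ≤ τ(x, x₁)` turns this into pointwise proportionality, which does not involve
`p`; so the family is an `ℓ_q`-geodesic for every `q ∈ (0,1)`
(`LorentzianPreLengthSpace.isEllGeodesic_of_plans`).
-/

/-! ### Sturm comparison with the generalized sine -/

/-- The derivative of `genSin κ`. -/
noncomputable def genCos (κ ϑ : ℝ) : ℝ :=
  if 0 < κ then Real.cos (√κ * ϑ)
  else if κ = 0 then 1
  else Real.cosh (√(-κ) * ϑ)

lemma genSin_zero_right (κ : ℝ) : genSin κ 0 = 0 := by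
  simp [genSin]

lemma hasDerivAt_genSin (κ ϑ : ℝ) : HasDerivAt (genSin κ) (genCos κ ϑ) ϑ := by
  unfold genCos
  split_ifs with h h0
  · have hs : √κ ≠ 0 := (Real.sqrt_pos.2 h).ne'
    have := (((hasDerivAt_id ϑ).const_mul (√κ)).sin).div_const (√κ)
    have e : genSin κ = fun ϑ => Real.sin (√κ * id ϑ) / √κ := by
      funext x; simp [genSin, h]
    rw [e]
    convert! this using 1
    field_simp
    simp
  · subst h0
    have e : genSin 0 = id := by funext x; simp [genSin]
    rw [e]; exact hasDerivAt_id ϑ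
  · have hk : 0 < -κ := by
      rcases lt_trichotomy κ 0 with h1 | h1 | h1
      · linarith
      · exact absurd h1 h0
      · exact absurd h1 h
    have hs : √(-κ) ≠ 0 := (Real.sqrt_pos.2 hk).ne'
    have := (((hasDerivAt_id ϑ).const_mul (√(-κ))).sinh).div_const (√(-κ))
    have e : genSin κ = fun ϑ => Real.sinh (√(-κ) * id ϑ) / √(-κ) := by
      funext x; simp [genSin, h, h0]
    rw [e]
    convert! this using 1
    field_simp
    simp

lemma hasDerivAt_genCos (κ ϑ : ℝ) : HasDerivAt (genCos κ) (-κ * genSin κ ϑ) ϑ := by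
  unfold genSin
  split_ifs with h h0
  · have hs : √κ ≠ 0 := (Real.sqrt_pos.2 h).ne'
    have := ((hasDerivAt_id ϑ).const_mul (√κ)).cos
    have e : genCos κ = fun ϑ => Real.cos (√κ * id ϑ) := by
      funext x; simp [genCos, h]
    rw [e]
    convert! this using 1
    have := Real.mul_self_sqrt h.le
    field_simp
    simp only [id]
    linear_combination (Real.sin (√κ * ϑ)) * this
  · subst h0
    have e : genCos 0 = fun _ => 1 := by funext x; simp [genCos]
    rw [e]; simpa using hasDerivAt_const ϑ (1 : ℝ)
  · have hk : 0 < -κ := by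
      rcases lt_trichotomy κ 0 with h1 | h1 | h1
      · linarith
      · exact absurd h1 h0
      · exact absurd h1 h
    have hs : √(-κ) ≠ 0 := (Real.sqrt_pos.2 hk).ne'
    have := ((hasDerivAt_id ϑ).const_mul (√(-κ))).cosh
    have e : genCos κ = fun ϑ => Real.cosh (√(-κ) * id ϑ) := by
      funext x; simp [genCos, h, h0]
    rw [e]
    convert! this using 1
    have := Real.mul_self_sqrt hk.le
    field_simp
    simp only [id]
    linear_combination (-Real.sinh (√(-κ) * ϑ)) * this

lemma continuous_genSin (κ : ℝ) : Continuous (genSin κ) :=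
  continuous_iff_continuousAt.2 fun x => (hasDerivAt_genSin κ x).continuousAt

lemma genSin_pos {κ ϑ : ℝ} (h0 : 0 < ϑ) (h : κ * ϑ ^ 2 < Real.pi ^ 2) : 0 < genSin κ ϑ := by
  unfold genSin
  split_ifs with hk hk0
  · have hs : 0 < √κ := Real.sqrt_pos.2 hk
    refine div_pos (Real.sin_pos_of_pos_of_lt_pi (by positivity) ?_) hs
    refine lt_of_pow_lt_pow_left₀ 2 Real.pi_pos.le ?_
    rwa [mul_pow, Real.sq_sqrt hk.le]
  · exact h0
  · have hk' : 0 < -κ := by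
      rcases lt_trichotomy κ 0 with h1 | h1 | h1
      · linarith
      · exact absurd h1 hk0
      · exact absurd h1 hk
    have hs : 0 < √(-κ) := Real.sqrt_pos.2 hk'
    exact div_pos (Real.sinh_pos_iff.2 (by positivity)) hs

lemma genSin_pos_of_mem {κ s : ℝ} (hs : s ∈ Ioc (0 : ℝ) 1) (hκ : κ < Real.pi ^ 2) :
    0 < genSin κ s := by
  refine genSin_pos hs.1 ?_
  have h1 : s ^ 2 ≤ 1 := by nlinarith [hs.1, hs.2]
  have h2 : 0 < Real.pi ^ 2 := by positivity
  rcases le_or_gt κ 0 with h | h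
  · nlinarith [mul_nonneg (neg_nonneg.2 h) (sq_nonneg s)]
  · nlinarith

/-- Sturm comparison: `v / s_κ(b - ·)` is nondecreasing, since its derivative has the sign of the
Wronskian, which is monotone. -/
lemma genSin_comparison {κ a b : ℝ} (hab : a < b) (hκ : κ * (b - a) ^ 2 < Real.pi ^ 2)
    {v v' v'' : ℝ → ℝ} (hv : ∀ t ∈ Icc a b, HasDerivAt v (v' t) t)
    (hv' : ∀ t ∈ Icc a b, HasDerivAt v' (v'' t) t) (hpos : ∀ t ∈ Icc a b, 0 < v t)
    (hle : ∀ t ∈ Icc a b, v'' t ≤ -κ * v t) {t : ℝ} (ht : t ∈ Icc a b) :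
    v a * genSin κ (b - t) ≤ v t * genSin κ (b - a) := by
  have hsin : ∀ s ∈ Ico a b, 0 < genSin κ (b - s) := by
    intro s hs
    refine genSin_pos (by linarith [hs.2]) ?_
    rcases le_or_gt κ 0 with h | h
    · have : κ * (b - s) ^ 2 ≤ 0 := mul_nonpos_of_nonpos_of_nonneg h (sq_nonneg _)
      have : 0 < Real.pi ^ 2 := by positivity
      linarith
    · refine lt_of_le_of_lt ?_ hκ
      have : (b - s) ^ 2 ≤ (b - a) ^ 2 := by
        apply pow_le_pow_left₀ <;> linarith [hs.1, hs.2]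
      gcongr
  have hds : ∀ s, HasDerivAt (fun s => genSin κ (b - s)) (-genCos κ (b - s)) s := by
    intro s
    have := (hasDerivAt_genSin κ (b - s)).comp s ((hasDerivAt_id s).const_sub b)
    simpa using! this
  have hdc : ∀ s, HasDerivAt (fun s => genCos κ (b - s)) (κ * genSin κ (b - s)) s := by
    intro s
    have := (hasDerivAt_genCos κ (b - s)).comp s ((hasDerivAt_id s).const_sub b)
    simpa using! this
  have hW : ∀ s ∈ Icc a b, HasDerivAt
      (fun s => v' s * genSin κ (b - s) + v s * genCos κ (b - s))
      (v'' s * genSin κ (b - s) + κ * v s * genSin κ (b - s)) s := by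
    intro s hs
    have := ((hv' s hs).mul (hds s)).add ((hv s hs).mul (hdc s))
    convert! this using 1
    ring
  have hWanti : AntitoneOn (fun s => v' s * genSin κ (b - s) + v s * genCos κ (b - s))
      (Icc a b) := by
    apply antitoneOn_of_deriv_nonpos (convex_Icc a b)
    · exact fun s hs => (hW s hs).continuousAt.continuousWithinAt
    · intro s hs
      exact (hW s (interior_subset hs)).differentiableAt.differentiableWithinAt
    · intro s hs
      rw [interior_Icc] at hs
      rw [(hW s (Ioo_subset_Icc_self hs)).deriv]
      have h1 := hsin s (Ioo_subset_Ico_self hs)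
      have h2 := hle s (Ioo_subset_Icc_self hs)
      nlinarith
  have hb : b ∈ Icc a b := ⟨hab.le, le_rfl⟩
  have hWpos : ∀ s ∈ Icc a b, 0 ≤ v' s * genSin κ (b - s) + v s * genCos κ (b - s) := by
    intro s hs
    refine le_trans ?_ (hWanti hs hb hs.2)
    have h1 : genCos κ 0 = 1 := by simp [genCos]
    simp only [sub_self, genSin_zero_right, h1]
    linarith [hpos b hb]
  have hmono : MonotoneOn (fun s => v s / genSin κ (b - s)) (Ico a b) := by
    have hq : ∀ s ∈ Ico a b, HasDerivAt (fun s => v s / genSin κ (b - s)) _ s :=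
      fun s hs => (hv s (Ico_subset_Icc_self hs)).div (hds s) (hsin s hs).ne'
    apply monotoneOn_of_deriv_nonneg (convex_Ico a b)
    · exact fun s hs => (hq s hs).continuousAt.continuousWithinAt
    · intro s hs
      exact (hq s (interior_subset hs)).differentiableAt.differentiableWithinAt
    · intro s hs
      have hs' := interior_subset hs
      rw [(hq s hs').deriv]
      refine div_nonneg ?_ (sq_nonneg _)
      have := hWpos s (Ico_subset_Icc_self hs')
      linarith
  rcases eq_or_lt_of_le ht.2 with h | h
  · subst h
    rw [sub_self, genSin_zero_right, mul_zero]
    exact mul_nonneg (hpos t ht).le (hsin a ⟨le_rfl, hab⟩).le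
  · have h1 := hmono ⟨le_rfl, hab⟩ ⟨ht.1, h⟩ ht.1
    have := hsin a ⟨le_rfl, hab⟩
    have := hsin t ⟨ht.1, h⟩
    simp only at h1
    rw [div_le_div_iff₀ (by assumption) (by assumption)] at h1
    exact h1

/-! ### Semi-convex functions with `e'' - (e')² / N ≥ A` -/

lemma IsSemiconvexOnUnit.exists_lipschitzOnWith {e : ℝ → ℝ} (he : IsSemiconvexOnUnit e) {a b : ℝ}
    (ha : 0 < a) (hb : b < 1) : ∃ C, LipschitzOnWith C e (Icc a b) := by
  obtain ⟨c, hc⟩ := he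
  have hsub : Icc a b ⊆ interior (Icc (0 : ℝ) 1) := by
    rw [interior_Icc]; exact fun x hx => ⟨ha.trans_le hx.1, hx.2.trans_lt hb⟩
  obtain ⟨C₁, h₁⟩ := (hc.locallyLipschitzOn_interior.mono hsub).exists_lipschitzOnWith_of_compact
    isCompact_Icc
  have h₂ : ContDiff ℝ 1 (fun t : ℝ => c * t ^ 2) := by fun_prop
  obtain ⟨C₂, h₂⟩ := (h₂.locallyLipschitz.locallyLipschitzOn
    (s := Icc a b)).exists_lipschitzOnWith_of_compact isCompact_Icc
  refine ⟨C₁ + C₂, ?_⟩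
  have := h₁.sub h₂
  convert! this using 1
  funext t
  simp

/-- Testing the distributional inequality with translates of a mollifier `ρ` shows that the
mollification satisfies it pointwise; the nonlinear term is handled by `(e')² ≥ 2ce' - c²`. -/
lemma DistribIneq.le_mollification {N A : ℝ} (hN : 0 < N) {e : ℝ → ℝ} (h : DistribIneq N A e)
    {a b a' b' : ℝ} (ha' : 0 < a') (ha : a' < a) (hab : a < b) (hb : b < b') (hb' : b' < 1)
    {C : NNReal} (hlip : LipschitzOnWith C e (Icc a' b')) {ρ : ℝ → ℝ} (hρ : ContDiff ℝ ∞ ρ)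
    (hρ0 : ∀ t, 0 ≤ ρ t) (hρ1 : ∫ t, ρ t = 1) {t : ℝ}
    (hsupp : ∀ s, ρ (t - s) ≠ 0 → s ∈ Icc a b) :
    A + (∫ s, deriv ρ (t - s) * (Icc a b).indicator e s) ^ 2 / N
      ≤ ∫ s, deriv (deriv ρ) (t - s) * (Icc a b).indicator e s := by
  set ψ : ℝ → ℝ := fun s => ρ (t - s) with hψ
  have hψd : ContDiff ℝ ∞ ψ := hρ.comp (contDiff_const.sub contDiff_id)
  have hts : tsupport ψ ⊆ Icc a b := closure_minimal (fun s hs => hsupp s hs) isClosed_Icc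
  have hcs : HasCompactSupport ψ := HasCompactSupport.of_support_subset_isCompact
    isCompact_Icc (fun s hs => hsupp s hs)
  have hdψ : ∀ s, deriv ψ s = - deriv ρ (t - s) := fun s => by
    simp [hψ, deriv_comp_const_sub]
  have hddψ : ∀ s, iteratedDeriv 2 ψ s = deriv (deriv ρ) (t - s) := by
    intro s
    have h1 : deriv ψ = fun s => - deriv ρ (t - s) := funext hdψ
    rw [iteratedDeriv_succ, iteratedDeriv_one, h1]
    have := deriv_comp_const_sub (f := deriv ρ) (a := t) (x := s)
    simp [this]
  have hsub01 : Icc a b ⊆ Ioo (0 : ℝ) 1 := fun x hx =>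
    ⟨by linarith [hx.1], by linarith [hx.2]⟩
  have hsub' : Icc a b ⊆ Icc a' b' := Icc_subset_Icc ha.le hb.le
  have hmain := h ψ hψd hcs (hts.trans hsub01) (fun s => hρ0 _)
  have hz : ∀ s, s ∉ Icc a b → ψ s = 0 := fun s hs => by
    by_contra hne; exact hs (hsupp s hne)
  have hz1 : ∀ s, s ∉ Icc a b → deriv ψ s = 0 := fun s hs => by
    by_contra hne; exact hs (hts (support_deriv_subset hne))
  have hz2 : ∀ s, s ∉ Icc a b → iteratedDeriv 2 ψ s = 0 := fun s hs => by
    by_contra hne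
    rw [iteratedDeriv_succ, iteratedDeriv_one] at hne
    exact hs (hts ((tsupport_deriv_subset) (support_deriv_subset hne)))
  have I0 : ∫ s in Ioo (0 : ℝ) 1, ψ s = 1 := by
    rw [setIntegral_eq_integral_of_forall_compl_eq_zero (fun s hs => hz s fun h => hs (hsub01 h))]
    rw [← hρ1]
    exact integral_sub_left_eq_self ρ volume t
  have I2 : ∫ s in Ioo (0 : ℝ) 1, e s * iteratedDeriv 2 ψ s
      = ∫ s, deriv (deriv ρ) (t - s) * (Icc a b).indicator e s := by
    rw [setIntegral_eq_integral_of_forall_compl_eq_zero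
      (fun s hs => by rw [hz2 s fun h => hs (hsub01 h), mul_zero])]
    congr 1
    funext s
    by_cases hs : s ∈ Icc a b
    · rw [indicator_of_mem hs, hddψ, mul_comm]
    · rw [indicator_of_notMem hs, hz2 s hs]; simp
  set c := ∫ s, deriv ρ (t - s) * (Icc a b).indicator e s with hc
  have hbd : ∀ s ∈ Icc a b, ‖deriv e s‖ ≤ C := fun s hs =>
    norm_deriv_le_of_lipschitzOn (Icc_mem_nhds (ha.trans_le hs.1) (hs.2.trans_lt hb)) hlip
  have hψint : IntegrableOn ψ (Ioo 0 1) :=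
    (hψd.continuous.integrable_of_hasCompactSupport hcs).integrableOn
  have hint1 : IntegrableOn (fun s => deriv e s * ψ s) (Ioo 0 1) := by
    refine Integrable.mono' (hψint.const_mul C)
      (((measurable_deriv e).mul hψd.continuous.measurable).aestronglyMeasurable) ?_
    refine Filter.Eventually.of_forall fun s => ?_
    by_cases hs : s ∈ Icc a b
    · rw [norm_mul, Real.norm_of_nonneg (hρ0 (t - s))]
      exact mul_le_mul_of_nonneg_right (hbd s hs) (hρ0 _)
    · simp [hz s hs]
  have hint2 : IntegrableOn (fun s => (deriv e s) ^ 2 * ψ s) (Ioo 0 1) := by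
    refine Integrable.mono' (hψint.const_mul ((C : ℝ) ^ 2))
      ((((measurable_deriv e).pow_const 2).mul hψd.continuous.measurable).aestronglyMeasurable) ?_
    refine Filter.Eventually.of_forall fun s => ?_
    by_cases hs : s ∈ Icc a b
    · rw [norm_mul, Real.norm_of_nonneg (hρ0 (t - s)), norm_pow]
      exact mul_le_mul_of_nonneg_right (pow_le_pow_left₀ (norm_nonneg _) (hbd s hs) 2) (hρ0 _)
    · simp [hz s hs]
  have I1 : ∫ s in Ioo (0 : ℝ) 1, deriv e s * ψ s = c := by
    have hea : AbsolutelyContinuousOnInterval e a' b' := by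
      apply LipschitzOnWith.absolutelyContinuousOnInterval (K := C)
      rwa [uIcc_of_le (by linarith)]
    have hψa : AbsolutelyContinuousOnInterval ψ a' b' :=
      ((hψd.of_le (by simp)).contDiffOn).absolutelyContinuousOnInterval
    have hp := hea.integral_mul_deriv_eq_deriv_mul hψa
    rw [hz a' (fun h => by linarith [h.1]), hz b' (fun h => by linarith [h.2])] at hp
    rw [intervalIntegral.integral_of_le (by linarith),
      intervalIntegral.integral_of_le (by linarith)] at hp
    have hsubc : Icc a b ⊆ Ioc a' b' := fun x hx => ⟨by linarith [hx.1], by linarith [hx.2]⟩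
    rw [setIntegral_eq_integral_of_forall_compl_eq_zero
      (fun s hs => by rw [hz1 s fun h => hs (hsubc h), mul_zero]),
      setIntegral_eq_integral_of_forall_compl_eq_zero
      (fun s hs => by rw [hz s fun h => hs (hsubc h), mul_zero])] at hp
    rw [setIntegral_eq_integral_of_forall_compl_eq_zero
      (fun s hs => by rw [hz s fun h => hs (hsub01 h), mul_zero])]
    have : ∫ s, e s * deriv ψ s = - c := by
      rw [hc, ← integral_neg]
      congr 1
      funext s
      by_cases hs : s ∈ Icc a b
      · rw [indicator_of_mem hs, hdψ]; ring
      · have h0 := hz1 s hs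
        rw [indicator_of_notMem hs, h0]; simp
    linarith
  have I3 : c ^ 2 ≤ ∫ s in Ioo (0 : ℝ) 1, (deriv e s) ^ 2 * ψ s := by
    have : ∫ s in Ioo (0 : ℝ) 1, (2 * c * (deriv e s * ψ s) - c ^ 2 * ψ s) = c ^ 2 := by
      rw [integral_sub (hint1.const_mul _) (hψint.const_mul _), integral_const_mul,
        integral_const_mul, I1, I0]
      ring
    rw [← this]
    refine integral_mono ((hint1.const_mul _).sub (hψint.const_mul _)) hint2 fun s => ?_
    have := mul_nonneg (sq_nonneg (deriv e s - c)) (hρ0 (t - s))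
    simp only [hψ]
    nlinarith
  rw [I0, I2] at hmain
  have hmain' : A * 1 ≤ (∫ s, deriv (deriv ρ) (t - s) * (Icc a b).indicator e s)
      - 1 / N * ∫ s in Ioo (0 : ℝ) 1, (deriv e s) ^ 2 * ψ s := by
    exact_mod_cast hmain
  have : c ^ 2 / N ≤ 1 / N * ∫ s in Ioo (0 : ℝ) 1, (deriv e s) ^ 2 * ψ s := by
    rw [div_eq_mul_one_div, mul_comm]
    gcongr
  linarith

/-- The interior comparison estimate, obtained from `genSin_comparison` for `exp (-e_ε / N)`, where
`e_ε` are mollifications of `e`. -/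
lemma DistribIneq.comparison_Ioo {N A κ : ℝ} (hN : 0 < N) {e : ℝ → ℝ} (h : DistribIneq N A e)
    (he : IsSemiconvexOnUnit e) (hκA : κ ≤ A / N) (hκ : κ < Real.pi ^ 2) {a b t : ℝ} (ha : 0 < a)
    (hab : a < b) (hb : b < 1) (ht : t ∈ Icc a b) :
    Real.exp (-e a / N) * genSin κ (b - t) ≤ Real.exp (-e t / N) * genSin κ (b - a) := by
  obtain ⟨C, hC⟩ := he.exists_lipschitzOnWith (a := a / 4) (b := (b + 3) / 4) (by linarith)
    (by linarith)
  set a₁ := a / 2 with ha₁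
  set b₁ := (b + 1) / 2 with hb₁
  set g : ℝ → ℝ := (Icc a₁ b₁).indicator e with hg
  have hcont : ContinuousOn e (Icc a₁ b₁) := hC.continuousOn.mono
    (Icc_subset_Icc (by linarith) (by linarith))
  have hgint : Integrable g :=
    (hcont.integrableOn_compact isCompact_Icc).integrable_indicator measurableSet_Icc
  have hgloc : LocallyIntegrable g := hgint.locallyIntegrable
  set r : ℝ := min a₁ (b₁ - b) with hr
  have hr0 : 0 < r := lt_min (by linarith) (by linarith)
  let φ : ℕ → ContDiffBump (0 : ℝ) := fun n =>
    ⟨r / (2 * (n + 2)), r / (n + 2), by positivity, by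
      apply div_lt_div_of_pos_left hr0 (by positivity); nlinarith [(n.cast_nonneg : (0:ℝ) ≤ n)]⟩
  have hφr : ∀ n, (φ n).rOut ≤ r := fun n => by
    refine div_le_self hr0.le ?_
    linarith [(n.cast_nonneg : (0:ℝ) ≤ n)]
  have hφlim : Filter.Tendsto (fun n => (φ n).rOut) Filter.atTop (𝓝 0) := by
    have h1 : Filter.Tendsto (fun n : ℕ => (n : ℝ) + 2) Filter.atTop Filter.atTop :=
      Filter.tendsto_atTop_add_const_right _ _ tendsto_natCast_atTop_atTop
    exact (tendsto_const_nhds (x := r)).div_atTop h1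
  let ρ : ℕ → ℝ → ℝ := fun n => (φ n).normed volume
  let L := ContinuousLinearMap.lsmul ℝ ℝ (E := ℝ)
  let E0 : ℕ → ℝ → ℝ := fun n => convolution (ρ n) g L volume
  let E1 : ℕ → ℝ → ℝ := fun n => convolution (deriv (ρ n)) g L volume
  let E2 : ℕ → ℝ → ℝ := fun n => convolution (deriv (deriv (ρ n))) g L volume
  have hρd : ∀ n, ContDiff ℝ ∞ (ρ n) := fun n => (φ n).contDiff_normed
  have hρc : ∀ n, HasCompactSupport (ρ n) := fun n => (φ n).hasCompactSupport_normed
  have hE0 : ∀ n x, HasDerivAt (E0 n) (E1 n x) x := fun n x =>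
    (hρc n).hasDerivAt_convolution_left L ((hρd n).of_le (by simp)) hgloc x
  have hρd' : ∀ n, ContDiff ℝ 1 (deriv (ρ n)) := fun n =>
    (contDiff_infty_iff_deriv.1 (hρd n)).2.of_le (by simp)
  have hE1 : ∀ n x, HasDerivAt (E1 n) (E2 n x) x := fun n x =>
    (hρc n).deriv.hasDerivAt_convolution_left L (hρd' n) hgloc x
  have hineq : ∀ n, ∀ x ∈ Icc a b, A + (E1 n x) ^ 2 / N ≤ E2 n x := by
    intro n x hx
    have := h.le_mollification hN (a := a₁) (b := b₁) (a' := a / 4) (b' := (b + 3) / 4)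
      (by linarith) (by linarith) (by linarith) (by linarith) (by linarith) hC (hρd n)
      (fun s => (φ n).nonneg_normed s) (φ n).integral_normed (t := x) (by
        intro s hs
        have hs' : x - s ∈ Function.support ((φ n).normed volume) := hs
        rw [(φ n).support_normed_eq, mem_ball_zero_iff, Real.norm_eq_abs, abs_lt] at hs'
        have h1 := hφr n
        have h2 : r ≤ a₁ := min_le_left _ _
        have h3 : r ≤ b₁ - b := min_le_right _ _
        exact ⟨by linarith [hx.1], by linarith [hx.2]⟩)
    simp only [E1, E2, L, convolution_lsmul_swap, smul_eq_mul]
    exact this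
  have hlim : ∀ x ∈ Icc a b, Filter.Tendsto (fun n => E0 n x) Filter.atTop (𝓝 (e x)) := by
    intro x hx
    have hnh : Icc a₁ b₁ ∈ 𝓝 x := Icc_mem_nhds (by linarith [hx.1]) (by linarith [hx.2])
    refine ContDiffBump.convolution_tendsto_right (g := fun _ => g) hφlim
      (Filter.Eventually.of_forall fun _ => hgint.aestronglyMeasurable) ?_ tendsto_const_nhds
    have hga : Filter.Tendsto g (𝓝 x) (𝓝 (e x)) := by
      have h1 : Filter.Tendsto e (𝓝 x) (𝓝 (e x)) := hcont.continuousAt hnh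
      refine h1.congr' ?_
      filter_upwards [hnh] with y hy
      rw [hg, indicator_of_mem hy]
    exact hga.comp Filter.tendsto_snd
  have hstep : ∀ n, Real.exp (-E0 n a / N) * genSin κ (b - t)
      ≤ Real.exp (-E0 n t / N) * genSin κ (b - a) := by
    intro n
    have hv : ∀ s, HasDerivAt (fun s => Real.exp (-E0 n s / N))
        (Real.exp (-E0 n s / N) * (-E1 n s / N)) s := fun s =>
      ((hE0 n s).neg.div_const N).exp
    have hv' : ∀ s, HasDerivAt (fun s => Real.exp (-E0 n s / N) * (-E1 n s / N))
        (Real.exp (-E0 n s / N) * (-E1 n s / N) * (-E1 n s / N)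
          + Real.exp (-E0 n s / N) * (-E2 n s / N)) s := fun s =>
      (hv s).mul ((hE1 n s).neg.div_const N)
    refine genSin_comparison (v := fun s => Real.exp (-E0 n s / N)) hab ?_ (fun s _ => hv s)
      (fun s _ => hv' s) (fun s _ => Real.exp_pos _) (fun s hs => ?_) ht
    · rcases le_or_gt κ 0 with hk | hk
      · have : κ * (b - a) ^ 2 ≤ 0 := mul_nonpos_of_nonpos_of_nonneg hk (sq_nonneg _)
        have : 0 < Real.pi ^ 2 := by positivity
        linarith
      · refine lt_of_le_of_lt ?_ hκ
        have : (b - a) ^ 2 ≤ 1 := by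
          apply pow_le_one₀ <;> linarith
        nlinarith
    · have h1 := hineq n s hs
      have h2 : κ + (E1 n s) ^ 2 / N ^ 2 ≤ E2 n s / N := by
        calc κ + (E1 n s) ^ 2 / N ^ 2 ≤ A / N + (E1 n s) ^ 2 / N ^ 2 := by linarith
          _ = (A + (E1 n s) ^ 2 / N) / N := by field_simp
          _ ≤ E2 n s / N := by gcongr
      have h3 := Real.exp_pos (-E0 n s / N)
      have h4 : Real.exp (-E0 n s / N) * (-E1 n s / N) * (-E1 n s / N)
          + Real.exp (-E0 n s / N) * (-E2 n s / N)
          = Real.exp (-E0 n s / N) * ((E1 n s) ^ 2 / N ^ 2 - E2 n s / N) := by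
        field_simp
        ring
      rw [h4, mul_comm (-κ)]
      exact mul_le_mul_of_nonneg_left (by linarith) h3.le
  have hexp : ∀ x ∈ Icc a b, Filter.Tendsto (fun n => Real.exp (-E0 n x / N)) Filter.atTop
      (𝓝 (Real.exp (-e x / N))) := fun x hx =>
    (Real.continuous_exp.tendsto _).comp ((hlim x hx).neg.div_const N)
  exact le_of_tendsto_of_tendsto' ((hexp a ⟨le_rfl, hab.le⟩).mul_const _)
    ((hexp t ht).mul_const _) hstep

/-- The comparison estimate on `[0,1]`. No continuity of `e` is needed at the left end point, since a
convex function can only jump upwards there. -/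
lemma DistribIneq.comparison {N A κ : ℝ} (hN : 0 < N) {e : ℝ → ℝ} (h : DistribIneq N A e)
    (he : IsSemiconvexOnUnit e) (hκA : κ ≤ A / N) (hκ : κ < Real.pi ^ 2) {t : ℝ}
    (ht : t ∈ Ioo (0 : ℝ) 1) :
    Real.exp (-e 0 / N) * genSin κ (1 - t) ≤ Real.exp (-e t / N) * genSin κ 1 := by
  have hb : ∀ a ∈ Ioo 0 t,
      Real.exp (-e a / N) * genSin κ (1 - t) ≤ Real.exp (-e t / N) * genSin κ (1 - a) := by
    intro a ha
    have hc := continuous_genSin κ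
    have l1 : Filter.Tendsto (fun b => Real.exp (-e a / N) * genSin κ (b - t)) (𝓝[<] 1)
        (𝓝 (Real.exp (-e a / N) * genSin κ (1 - t))) :=
      ((by fun_prop : Continuous fun b => Real.exp (-e a / N) * genSin κ (b - t)).tendsto
        1).mono_left nhdsWithin_le_nhds
    have l2 : Filter.Tendsto (fun b => Real.exp (-e t / N) * genSin κ (b - a)) (𝓝[<] 1)
        (𝓝 (Real.exp (-e t / N) * genSin κ (1 - a))) :=
      ((by fun_prop : Continuous fun b => Real.exp (-e t / N) * genSin κ (b - a)).tendsto
        1).mono_left nhdsWithin_le_nhds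
    refine le_of_tendsto_of_tendsto l1 l2 ?_
    filter_upwards [Ioo_mem_nhdsLT ht.2] with b hb
    exact h.comparison_Ioo hN he hκA hκ ha.1 (ha.2.trans hb.1) hb.2 ⟨ha.2.le, hb.1.le⟩
  obtain ⟨c, hconv⟩ := he
  have hea : ∀ a ∈ Ioo 0 t, e a ≤ (1 - a) * e 0 + a * (e 1 + c) - c * a ^ 2 := by
    intro a ha
    have := hconv.2 (left_mem_Icc.2 zero_le_one) (right_mem_Icc.2 zero_le_one)
      (by linarith [ha.2, ht.2] : 0 ≤ 1 - a) ha.1.le (by ring)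
    simp only [smul_eq_mul] at this
    norm_num at this
    linarith
  have hs : 0 ≤ genSin κ (1 - t) :=
    (genSin_pos_of_mem ⟨by linarith [ht.2], by linarith [ht.1]⟩ hκ).le
  have hc := continuous_genSin κ
  have l1 : Filter.Tendsto (fun a => Real.exp (-((1 - a) * e 0 + a * (e 1 + c) - c * a ^ 2) / N)
      * genSin κ (1 - t)) (𝓝[>] 0) (𝓝 (Real.exp (-e 0 / N) * genSin κ (1 - t))) := by
    have := ((by fun_prop : Continuous fun a => Real.exp (-((1 - a) * e 0 + a * (e 1 + c)
      - c * a ^ 2) / N) * genSin κ (1 - t)).tendsto 0).mono_left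
        (nhdsWithin_le_nhds (s := Ioi (0 : ℝ)))
    simpa using this
  have l2 : Filter.Tendsto (fun a => Real.exp (-e t / N) * genSin κ (1 - a)) (𝓝[>] 0)
      (𝓝 (Real.exp (-e t / N) * genSin κ 1)) := by
    have := ((by fun_prop : Continuous fun a => Real.exp (-e t / N)
      * genSin κ (1 - a)).tendsto 0).mono_left (nhdsWithin_le_nhds (s := Ioi (0 : ℝ)))
    simpa using this
  refine le_of_tendsto_of_tendsto l1 l2 ?_
  filter_upwards [Ioo_mem_nhdsGT ht.1] with a ha
  refine le_trans (mul_le_mul_of_nonneg_right ?_ hs) (hb a ha)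
  apply Real.exp_le_exp.2
  gcongr
  exact hea a ha

/-! ### Relative entropy -/

section Entropy

variable {X : Type*} [MeasurableSpace X] {μ m : Measure X}

lemma relEntropy_of_integrable_llr [IsProbabilityMeasure μ] [SigmaFinite m] (hac : μ ≪ m)
    (hint : Integrable (llr μ m) μ) : relEntropy μ m = ((∫ x, llr μ m x ∂μ : ℝ) : EReal) := by
  have hi := (integrable_rnDeriv_mul_log_iff hac).2 hint
  have h1 := hi.lintegral_lt_top.ne
  have h2 := hi.neg.lintegral_lt_top.ne
  rw [relEntropy, if_pos ⟨hac, h1⟩, ← integral_rnDeriv_mul_log hac,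
    integral_eq_lintegral_pos_part_sub_lintegral_neg_part hi, EReal.coe_sub,
    EReal.coe_ennreal_toReal h1]
  congr 1
  exact (EReal.coe_ennreal_toReal h2).symm

lemma inEntropyDomain_of_integrable_llr [IsProbabilityMeasure μ] [SigmaFinite m] (hac : μ ≪ m)
    (hint : Integrable (llr μ m) μ) : InEntropyDomain μ m := by
  refine ⟨inferInstance, ?_, ?_⟩ <;> rw [relEntropy_of_integrable_llr hac hint]
  · exact EReal.coe_ne_top _
  · exact EReal.coe_ne_bot _

lemma InEntropyDomain.absolutelyContinuous (h : InEntropyDomain μ m) : μ ≪ m := by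
  by_contra hac
  refine h.2.1 ?_
  rw [relEntropy, if_neg (fun h => hac h.1)]

lemma InEntropyDomain.integrable_llr [SigmaFinite m] (h : InEntropyDomain μ m) :
    Integrable (llr μ m) μ := by
  have := h.1
  have hac := h.absolutelyContinuous
  rw [← integrable_rnDeriv_mul_log_iff hac]
  have hpos : ∫⁻ x, ENNReal.ofReal ((μ.rnDeriv m x).toReal * Real.log (μ.rnDeriv m x).toReal) ∂m
      ≠ ⊤ := by
    intro hp
    refine h.2.1 ?_
    rw [relEntropy, if_neg (fun h => h.2 hp)]
  have hneg : ∫⁻ x, ENNReal.ofReal (-((μ.rnDeriv m x).toReal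
      * Real.log (μ.rnDeriv m x).toReal)) ∂m ≠ ⊤ := by
    intro hn
    refine h.2.2 ?_
    rw [relEntropy, if_pos ⟨hac, hpos⟩, hn, EReal.coe_ennreal_top, EReal.sub_top]
  have hmeas : Measurable fun x => (μ.rnDeriv m x).toReal * Real.log (μ.rnDeriv m x).toReal :=
    (μ.measurable_rnDeriv m).ennreal_toReal.mul (μ.measurable_rnDeriv m).ennreal_toReal.log
  refine ⟨hmeas.aestronglyMeasurable, ?_⟩
  rw [hasFiniteIntegral_iff_norm]
  have : ∀ x, ENNReal.ofReal ‖(μ.rnDeriv m x).toReal * Real.log (μ.rnDeriv m x).toReal‖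
      ≤ ENNReal.ofReal ((μ.rnDeriv m x).toReal * Real.log (μ.rnDeriv m x).toReal)
        + ENNReal.ofReal (-((μ.rnDeriv m x).toReal * Real.log (μ.rnDeriv m x).toReal)) := by
    intro x
    rw [Real.norm_eq_abs]
    rcases abs_cases ((μ.rnDeriv m x).toReal * Real.log (μ.rnDeriv m x).toReal) with h | h
    · rw [h.1]; exact le_self_add
    · rw [h.1]; exact le_add_self
  refine (lintegral_mono this).trans_lt ?_
  rw [lintegral_add_left hmeas.ennreal_ofReal]
  exact ENNReal.add_lt_top.2 ⟨hpos.lt_top, hneg.lt_top⟩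

lemma rnDeriv_ae_eq_zero_of_measure_compl [SigmaFinite m] [SigmaFinite μ] {C : Set X}
    (hC : MeasurableSet C) (hμC : μ Cᶜ = 0) : ∀ᵐ x ∂m, x ∉ C → μ.rnDeriv m x = 0 := by
  have h := Measure.setLIntegral_rnDeriv_le (μ := μ) (ν := m) Cᶜ
  rw [hμC, nonpos_iff_eq_zero, setLIntegral_eq_zero_iff hC.compl (μ.measurable_rnDeriv m)] at h
  exact h

/-- The entropy of a probability measure on a set of finite `m`-measure is not `-∞`, because
`-r log r ≤ 1`. -/
lemma lintegral_neg_rnDeriv_mul_log_lt_top [SigmaFinite m] [SigmaFinite μ] {C : Set X}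
    (hC : MeasurableSet C) (hμC : μ Cᶜ = 0) (hmC : m C ≠ ⊤) :
    ∫⁻ x, ENNReal.ofReal (-((μ.rnDeriv m x).toReal * Real.log (μ.rnDeriv m x).toReal)) ∂m
      < ⊤ := by
  have hle : ∀ᵐ x ∂m, ENNReal.ofReal (-((μ.rnDeriv m x).toReal
      * Real.log (μ.rnDeriv m x).toReal)) ≤ C.indicator 1 x := by
    filter_upwards [rnDeriv_ae_eq_zero_of_measure_compl hC hμC] with x hx
    by_cases hxC : x ∈ C
    · rw [indicator_of_mem hxC, Pi.one_apply, ENNReal.ofReal_le_one]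
      have h0 : 0 ≤ (μ.rnDeriv m x).toReal := ENNReal.toReal_nonneg
      rcases eq_or_lt_of_le h0 with h | h
      · rw [← h]; simp
      · have := Real.self_sub_one_le_mul_log h0
        linarith
    · simp [hx hxC]
  refine (lintegral_mono_ae hle).trans_lt ?_
  rw [lintegral_indicator_one hC]
  exact hmC.lt_top

lemma relEntropy_ne_bot [SigmaFinite m] [SigmaFinite μ] {C : Set X} (hC : MeasurableSet C)
    (hμC : μ Cᶜ = 0) (hmC : m C ≠ ⊤) : relEntropy μ m ≠ ⊥ := by
  have h := (lintegral_neg_rnDeriv_mul_log_lt_top hC hμC hmC).ne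
  rw [relEntropy]
  split_ifs
  · rw [← EReal.coe_ennreal_toReal h]
    intro hb
    rw [sub_eq_add_neg, EReal.add_eq_bot_iff, ← EReal.coe_neg] at hb
    rcases hb with hb | hb
    · exact EReal.coe_ennreal_ne_bot _ hb
    · exact EReal.coe_ne_bot _ hb
  · exact top_ne_bot

/-- The easy half of the variational formula for the entropy, from Young's inequality
`r g - r log r ≤ exp (g - 1)`. -/
lemma integral_le_integral_llr_add [IsProbabilityMeasure μ] [SigmaFinite m] (hac : μ ≪ m)
    (hint : Integrable (llr μ m) μ) {C : Set X} (hC : MeasurableSet C) (hμC : μ Cᶜ = 0)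
    {g : X → ℝ} (hg : Integrable g μ) (hexp : IntegrableOn (fun x => Real.exp (g x - 1)) C m) :
    ∫ x, g x ∂μ ≤ ∫ x, llr μ m x ∂μ + ∫ x in C, Real.exp (g x - 1) ∂m := by
  have h1 : ∫ x, (g x - llr μ m x) ∂μ ≤ ∫ x in C, Real.exp (g x - 1) ∂m := by
    rw [← integral_rnDeriv_smul hac, ← integral_indicator hC]
    refine integral_mono_ae ((integrable_rnDeriv_smul_iff hac).2 (hg.sub hint))
      ((integrable_indicator_iff hC).2 hexp) ?_
    filter_upwards [rnDeriv_ae_eq_zero_of_measure_compl hC hμC] with x hx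
    by_cases hxC : x ∈ C
    · simp only [indicator_of_mem hxC, smul_eq_mul, llr]
      have h0 : 0 ≤ (μ.rnDeriv m x).toReal := ENNReal.toReal_nonneg
      rcases eq_or_lt_of_le h0 with h | h
      · rw [← h]; simp; positivity
      · set r := (μ.rnDeriv m x).toReal
        have := Real.add_one_le_exp (g x - 1 - Real.log r)
        rw [Real.exp_sub, Real.exp_log h, le_div_iff₀ h] at this
        linarith
    · simp [hx hxC, hxC]
  rw [integral_sub hg hint] at h1
  linarith

/-- The other half of the variational formula: the test functions are indicators (for absolute
continuity) and truncations of `1 + log ρ`. -/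
lemma integrable_llr_of_variational [IsProbabilityMeasure μ] [SigmaFinite m] {C : Set X}
    (hC : MeasurableSet C) (hμC : μ Cᶜ = 0) (hmC : m C ≠ ⊤) {E : ℝ}
    (hV : ∀ g : X → ℝ, Measurable g → (∃ B, ∀ x, |g x| ≤ B) →
      ∫ x, g x ∂μ ≤ E + ∫ x in C, Real.exp (g x - 1) ∂m) :
    μ ≪ m ∧ Integrable (llr μ m) μ ∧ ∫ x, llr μ m x ∂μ ≤ E := by
  have : IsFiniteMeasure (m.restrict C) := ⟨by simpa using hmC.lt_top⟩
  have hac : μ ≪ m := by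
    refine Measure.AbsolutelyContinuous.mk fun A hA hmA => ?_
    have hk : ∀ k : ℕ, k * μ.real A ≤ E + Real.exp (-1) * m.real C := by
      intro k
      have := hV (A.indicator fun _ => (k : ℝ)) (measurable_const.indicator hA)
        ⟨k, fun x => by by_cases hx : x ∈ A <;> simp [hx]⟩
      rw [integral_indicator_const _ hA, smul_eq_mul, mul_comm] at this
      refine this.trans (le_of_eq ?_)
      congr 1
      have h2 : ∀ᵐ x ∂(m.restrict C), Real.exp (A.indicator (fun _ => (k : ℝ)) x - 1)
          = Real.exp (-1) := by
        have h0 : ∀ᵐ x ∂m, x ∉ A := measure_eq_zero_iff_ae_notMem.1 hmA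
        filter_upwards [ae_restrict_of_ae h0] with x hx
        simp [hx]
      rw [integral_congr_ae h2]
      simp [mul_comm]
    by_contra hne
    have hpos : 0 < μ.real A := by
      rw [measureReal_def]; exact ENNReal.toReal_pos hne (measure_ne_top _ _)
    obtain ⟨k, hk'⟩ := exists_nat_gt ((E + Real.exp (-1) * m.real C) / μ.real A)
    rw [div_lt_iff₀ hpos] at hk'
    linarith [hk k]
  have hm := measurable_llr μ m
  have hcb : ∀ (k : ℕ) (x : X), |max (-(k : ℝ)) (min (llr μ m x) k)| ≤ k := by
    intro k x
    have := (k.cast_nonneg : (0:ℝ) ≤ k)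
    rw [abs_le]
    exact ⟨le_max_left _ _, max_le (by linarith) (min_le_right _ _)⟩
  have hcm : ∀ k : ℕ, Measurable fun x => max (-(k : ℝ)) (min (llr μ m x) k) := fun k =>
    measurable_const.max (hm.min measurable_const)
  have hci : ∀ k : ℕ, Integrable (fun x => max (-(k : ℝ)) (min (llr μ m x) k)) μ := fun k =>
    Integrable.of_bound (hcm k).aestronglyMeasurable k (Filter.Eventually.of_forall (hcb k))
  have hS : MeasurableSet {x | 0 < (μ.rnDeriv m x).toReal} :=
    measurableSet_lt measurable_const (μ.measurable_rnDeriv m).ennreal_toReal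
  have hbound : ∀ k : ℕ, ∫ x, max (-(k : ℝ)) (min (llr μ m x) k) ∂μ
      ≤ E + Real.exp (-k) * m.real C := by
    intro k
    classical
    set g : X → ℝ := fun x => if 0 < (μ.rnDeriv m x).toReal then
      1 + max (-(k : ℝ)) (min (llr μ m x) k) else -k with hg
    have hgm : Measurable g := Measurable.ite hS (measurable_const.add (hcm k)) measurable_const
    have hgb : ∀ x, |g x| ≤ 1 + k := by
      intro x
      simp only [hg]
      split_ifs
      · refine (abs_add_le _ _).trans ?_
        rw [abs_one]
        gcongr
        exact hcb k x
      · rw [abs_neg, Nat.abs_cast]; linarith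
    have h1 := hV g hgm ⟨_, hgb⟩
    have h2 : ∫ x, g x ∂μ = 1 + ∫ x, max (-(k : ℝ)) (min (llr μ m x) k) ∂μ := by
      have : ∀ᵐ x ∂μ, g x = 1 + max (-(k : ℝ)) (min (llr μ m x) k) := by
        filter_upwards [Measure.rnDeriv_pos hac, hac.ae_le (Measure.rnDeriv_lt_top μ m)]
          with x hx hx'
        rw [hg]
        exact if_pos (ENNReal.toReal_pos hx.ne' hx'.ne)
      rw [integral_congr_ae this, integral_add (integrable_const _) (hci k)]
      simp
    have h3 : ∫ x in C, Real.exp (g x - 1) ∂m ≤ 1 + Real.exp (-k) * m.real C := by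
      have hri : Integrable (fun x => (μ.rnDeriv m x).toReal) m := Measure.integrable_toReal_rnDeriv
      calc ∫ x in C, Real.exp (g x - 1) ∂m
          ≤ ∫ x in C, ((μ.rnDeriv m x).toReal + Real.exp (-k)) ∂m := by
            refine integral_mono ?_ (hri.integrableOn.add (integrable_const _)) ?_
            · refine Integrable.of_bound
                (Real.measurable_exp.comp (hgm.sub_const 1)).aestronglyMeasurable
                (Real.exp (1 + k)) (Filter.Eventually.of_forall fun x => ?_)
              rw [Real.norm_of_nonneg (Real.exp_pos _).le]
              apply Real.exp_le_exp.2
              linarith [le_abs_self (g x), hgb x]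
            · intro x
              simp only [hg]
              split_ifs with hx
              · have : (1 + max (-(k : ℝ)) (min (llr μ m x) k) - 1)
                    = max (-(k : ℝ)) (min (llr μ m x) k) := by ring
                rw [this]
                rcases max_cases (-(k : ℝ)) (min (llr μ m x) k) with h | h
                · rw [h.1]; linarith
                · rw [h.1]
                  have : Real.exp (min (llr μ m x) k) ≤ (μ.rnDeriv m x).toReal := by
                    calc _ ≤ Real.exp (llr μ m x) := Real.exp_le_exp.2 (min_le_left _ _)
                      _ = _ := by rw [llr, Real.exp_log hx]
                  linarith [Real.exp_pos (-(k : ℝ))]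
              · have h1 : Real.exp (-(k : ℝ) - 1) ≤ Real.exp (-k) :=
                  Real.exp_le_exp.2 (by linarith)
                have : 0 ≤ (μ.rnDeriv m x).toReal := ENNReal.toReal_nonneg
                linarith
        _ = ∫ x in C, (μ.rnDeriv m x).toReal ∂m + Real.exp (-k) * m.real C := by
            rw [integral_add hri.integrableOn (integrable_const _)]
            simp [mul_comm]
        _ ≤ 1 + Real.exp (-k) * m.real C := by
            rw [Measure.setIntegral_toReal_rnDeriv hac]
            gcongr
            exact measureReal_le_one
    linarith
  -- the negative part of `log ρ` is integrable since `C` has finite measure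
  have hnegi : Integrable (fun x => max (-llr μ m x) 0) μ := by
    rw [← integrable_rnDeriv_smul_iff hac]
    have hmeas : Measurable fun x => (μ.rnDeriv m x).toReal • max (-llr μ m x) 0 :=
      (μ.measurable_rnDeriv m).ennreal_toReal.smul (hm.neg.max measurable_const)
    refine ⟨hmeas.aestronglyMeasurable, ?_⟩
    rw [hasFiniteIntegral_iff_norm]
    refine lt_of_le_of_lt (lintegral_mono fun x => ?_)
      (lintegral_neg_rnDeriv_mul_log_lt_top hC hμC hmC)
    have h0 : 0 ≤ (μ.rnDeriv m x).toReal := ENNReal.toReal_nonneg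
    rw [norm_smul, Real.norm_of_nonneg h0, Real.norm_of_nonneg (le_max_right _ _),
      mul_max_of_nonneg _ _ h0, mul_zero, llr, mul_neg]
    rcases max_cases (-((μ.rnDeriv m x).toReal * Real.log (μ.rnDeriv m x).toReal)) 0 with h | h
    · rw [h.1]
    · rw [h.1]; simp
  set N₀ := ∫ x, max (-llr μ m x) 0 ∂μ
  set B₀ := E + m.real C + N₀
  have hposb : ∀ k : ℕ, ∫ x, max 0 (min (llr μ m x) k) ∂μ ≤ B₀ := by
    intro k
    have hle : ∀ x, max 0 (min (llr μ m x) k)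
        ≤ max (-(k : ℝ)) (min (llr μ m x) k) + max (-llr μ m x) 0 := by
      intro x
      have := (k.cast_nonneg : (0:ℝ) ≤ k)
      rcases le_total (llr μ m x) k with h | h <;> rcases le_total 0 (llr μ m x) with h' | h' <;>
        grind
    have h1 : ∫ x, max 0 (min (llr μ m x) k) ∂μ
        ≤ ∫ x, (max (-(k : ℝ)) (min (llr μ m x) k) + max (-llr μ m x) 0) ∂μ := by
      refine integral_mono ?_ ((hci k).add hnegi) hle
      refine Integrable.of_bound (measurable_const.max (hm.min
        measurable_const)).aestronglyMeasurable k (Filter.Eventually.of_forall fun x => ?_)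
      rw [Real.norm_of_nonneg (le_max_left _ _)]
      exact max_le k.cast_nonneg (min_le_right _ _)
    rw [integral_add (hci k) hnegi] at h1
    have h2 : Real.exp (-k) * m.real C ≤ m.real C :=
      mul_le_of_le_one_left measureReal_nonneg (Real.exp_le_one_iff.2 (by simp))
    linarith [hbound k]
  have hposi : Integrable (fun x => max 0 (llr μ m x)) μ := by
    refine ⟨(measurable_const.max hm).aestronglyMeasurable, ?_⟩
    rw [hasFiniteIntegral_iff_norm]
    have hsup : ∀ x, ENNReal.ofReal ‖max 0 (llr μ m x)‖
        = ⨆ k : ℕ, ENNReal.ofReal (max 0 (min (llr μ m x) k)) := by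
      intro x
      rw [Real.norm_of_nonneg (le_max_left _ _)]
      apply le_antisymm
      · obtain ⟨k, hk⟩ := exists_nat_ge (llr μ m x)
        refine le_iSup_of_le k ?_
        rw [min_eq_left hk]
      · refine iSup_le fun k => ENNReal.ofReal_le_ofReal ?_
        exact max_le_max le_rfl (min_le_left _ _)
    simp_rw [hsup]
    rw [lintegral_iSup]
    · refine lt_of_le_of_lt (iSup_le fun k => ?_) (ENNReal.ofReal_lt_top (r := B₀))
      rw [← ofReal_integral_eq_lintegral_ofReal]
      · exact ENNReal.ofReal_le_ofReal (hposb k)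
      · refine Integrable.of_bound (measurable_const.max (hm.min
          measurable_const)).aestronglyMeasurable k (Filter.Eventually.of_forall fun x => ?_)
        rw [Real.norm_of_nonneg (le_max_left _ _)]
        exact max_le k.cast_nonneg (min_le_right _ _)
      · exact Filter.Eventually.of_forall fun x => le_max_left _ _
    · exact fun k => (measurable_const.max (hm.min measurable_const)).ennreal_ofReal
    · intro j k hjk x
      refine ENNReal.ofReal_le_ofReal (max_le_max le_rfl (min_le_min le_rfl ?_))
      exact_mod_cast hjk
  have hllr : Integrable (llr μ m) μ := by
    have := hposi.sub hnegi
    refine this.congr (Filter.Eventually.of_forall fun x => ?_)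
    simp only [Pi.sub_apply]
    rcases le_total 0 (llr μ m x) with h | h
    · rw [max_eq_right h, max_eq_right (by linarith)]; ring
    · rw [max_eq_left h, max_eq_left (by linarith)]; ring
  refine ⟨hac, hllr, ?_⟩
  have hlim : Filter.Tendsto (fun k : ℕ => ∫ x, max (-(k : ℝ)) (min (llr μ m x) k) ∂μ)
      Filter.atTop (𝓝 (∫ x, llr μ m x ∂μ)) := by
    refine tendsto_integral_of_dominated_convergence (fun x => |llr μ m x|)
      (fun k => (hcm k).aestronglyMeasurable) hllr.abs (fun k => ?_) ?_
    · refine Filter.Eventually.of_forall fun x => ?_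
      have := (k.cast_nonneg : (0:ℝ) ≤ k)
      rw [Real.norm_eq_abs]
      rcases le_total (llr μ m x) k with h | h <;> rcases le_total (-(k:ℝ)) (llr μ m x) with h' | h'
      · rw [min_eq_left h, max_eq_right h']
      · rw [min_eq_left h, max_eq_left h', abs_of_nonpos (by linarith), abs_of_nonpos (by linarith)]
        linarith
      · rw [min_eq_right h, max_eq_right (by linarith), abs_of_nonneg this, abs_of_nonneg]
        · exact h
        · linarith
      · rw [min_eq_right h, max_eq_right (by linarith), abs_of_nonneg this]
        exact h.trans (le_abs_self _)
    · refine Filter.Eventually.of_forall fun x => ?_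
      obtain ⟨n, hn⟩ := exists_nat_ge |llr μ m x|
      refine tendsto_const_nhds.congr' ?_
      filter_upwards [Filter.eventually_ge_atTop n] with k hk
      have hk' : (n : ℝ) ≤ k := by exact_mod_cast hk
      have := abs_le.1 (hn.trans hk')
      rw [min_eq_left this.2, max_eq_right this.1]
  have hlim2 : Filter.Tendsto (fun k : ℕ => E + Real.exp (-k) * m.real C) Filter.atTop
      (𝓝 (E + 0 * m.real C)) := by
    refine Filter.Tendsto.const_add E (Filter.Tendsto.mul_const _ ?_)
    exact Real.tendsto_exp_neg_atTop_nhds_zero.comp tendsto_natCast_atTop_atTop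
  simpa using le_of_tendsto_of_tendsto' hlim hlim2 hbound

end Entropy

section EntropyLimits

variable {X : Type*} [MetricSpace X] [MeasurableSpace X] [BorelSpace X] {m : Measure X}

/-- A closed set carrying all members of a weakly convergent family carries the limit. -/
lemma measure_compl_eq_zero_of_tendsto {ι : Type*} {l : Filter ι} [l.NeBot]
    {ν : ι → ProbabilityMeasure X} {μ : ProbabilityMeasure X} (hlim : Filter.Tendsto ν l (𝓝 μ))
    {C : Set X} (hC : IsClosed C) (hν : ∀ i, (ν i : Measure X) Cᶜ = 0) :
    (μ : Measure X) Cᶜ = 0 := by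
  have := ProbabilityMeasure.le_liminf_measure_open_of_tendsto hlim hC.isOpen_compl
  simpa [hν] using this

/-- Lower semicontinuity of the entropy along weakly convergent measures on a common set of
finite `m`-measure. -/
lemma relEntropy_le_of_tendsto [SigmaFinite m] {ι : Type*} {l : Filter ι} [l.NeBot]
    {ν : ι → ProbabilityMeasure X} {μ : ProbabilityMeasure X} (hlim : Filter.Tendsto ν l (𝓝 μ))
    {C : Set X} (hC : IsClosed C) (hmC : m C ≠ ⊤) (hνC : ∀ i, (ν i : Measure X) Cᶜ = 0)
    (hν : ∀ i, InEntropyDomain (ν i : Measure X) m) {E : ℝ}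
    (hE : ∀ᶠ i in l, (relEntropy (ν i : Measure X) m).toReal ≤ E) :
    relEntropy (μ : Measure X) m ≤ E := by
  have hμC := measure_compl_eq_zero_of_tendsto hlim hC hνC
  have : IsFiniteMeasure (m.restrict C) := ⟨by simpa using hmC.lt_top⟩
  have hexpi : ∀ {g : X → ℝ}, Measurable g → ∀ {B : ℝ}, (∀ x, |g x| ≤ B) →
      IntegrableOn (fun x => Real.exp (g x - 1)) C m := by
    intro g hg B hB
    refine Integrable.of_bound (Real.measurable_exp.comp (hg.sub_const 1)).aestronglyMeasurable
      (Real.exp B) (Filter.Eventually.of_forall fun x => ?_)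
    rw [Real.norm_of_nonneg (Real.exp_pos _).le]
    apply Real.exp_le_exp.2
    linarith [le_abs_self (g x), hB x]
  have hcont : ∀ g : BoundedContinuousFunction X ℝ,
      ∫ x, g x ∂(μ : Measure X) ≤ E + ∫ x in C, Real.exp (g x - 1) ∂m := by
    intro g
    have hg := (ProbabilityMeasure.tendsto_iff_forall_integral_tendsto.1 hlim) g
    refine le_of_tendsto hg ?_
    filter_upwards [hE] with i hi
    have h1 := integral_le_integral_llr_add (hν i).absolutelyContinuous (hν i).integrable_llr
      hC.measurableSet (hνC i) (g.integrable _)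
      (hexpi g.continuous.measurable g.norm_coe_le_norm)
    rw [relEntropy_of_integrable_llr (hν i).absolutelyContinuous (hν i).integrable_llr,
      EReal.toReal_coe] at hi
    linarith
  have hV : ∀ g : X → ℝ, Measurable g → (∃ B, ∀ x, |g x| ≤ B) →
      ∫ x, g x ∂(μ : Measure X) ≤ E + ∫ x in C, Real.exp (g x - 1) ∂m := by
    rintro g hg ⟨B, hB⟩
    obtain ⟨x₀⟩ := nonempty_of_isProbabilityMeasure (μ : Measure X)
    have hB0 : 0 ≤ B := (abs_nonneg _).trans (hB x₀)
    refine le_of_forall_pos_le_add fun ε hε => ?_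
    set δ : ℝ := ε / (1 + Real.exp B) with hδ
    have hδ0 : 0 < δ := by positivity
    set η : Measure X := (μ : Measure X) + m.restrict C with hη
    have hgη : Integrable g η := Integrable.of_bound hg.aestronglyMeasurable B
      (Filter.Eventually.of_forall hB)
    obtain ⟨f, hf, hfi⟩ := hgη.exists_boundedContinuous_integral_sub_le hδ0
    -- clamping the continuous approximation to `[-B, B]` keeps it close to `g`
    let f' : BoundedContinuousFunction X ℝ := BoundedContinuousFunction.ofNormedAddCommGroup
      (fun x => max (-B) (min (f x) B)) (by fun_prop) B (fun x => by
        rw [Real.norm_eq_abs, abs_le]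
        exact ⟨le_max_left _ _, max_le (by linarith) (min_le_right _ _)⟩)
    have hf'B : ∀ x, |f' x| ≤ B := fun x => by
      change |max (-B) (min (f x) B)| ≤ B
      rw [abs_le]
      exact ⟨le_max_left _ _, max_le (by linarith) (min_le_right _ _)⟩
    have hle : ∀ x, |g x - f' x| ≤ ‖g x - f x‖ := by
      intro x
      change |g x - max (-B) (min (f x) B)| ≤ |g x - f x|
      have := abs_le.1 (hB x)
      have h1 : g x = max (-B) (min (g x) B) := by
        rw [min_eq_left this.2, max_eq_right this.1]
      conv_lhs => rw [h1]
      refine (abs_max_sub_max_le_max _ _ _ _).trans ?_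
      simp only [sub_self, abs_zero]
      refine max_le (abs_nonneg _) ((abs_min_sub_min_le_max _ _ _ _).trans ?_)
      simp
    have hdi : Integrable (fun x => |g x - f' x|) η :=
      (hgη.sub (f'.integrable η)).abs
    have hdint : ∫ x, |g x - f' x| ∂η ≤ δ :=
      (integral_mono hdi (hgη.sub hfi).norm hle).trans hf
    have hdμ : Integrable (fun x => |g x - f' x|) (μ : Measure X) :=
      hdi.mono_measure (Measure.le_add_right le_rfl)
    have hdm : Integrable (fun x => |g x - f' x|) (m.restrict C) :=
      hdi.mono_measure (Measure.le_add_left le_rfl)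
    rw [hη, integral_add_measure hdμ hdm] at hdint
    have hd1 : 0 ≤ ∫ x, |g x - f' x| ∂(μ : Measure X) := integral_nonneg fun _ => abs_nonneg _
    have hd2 : 0 ≤ ∫ x in C, |g x - f' x| ∂m := integral_nonneg fun _ => abs_nonneg _
    have h1 : ∫ x, g x ∂(μ : Measure X) ≤ ∫ x, f' x ∂(μ : Measure X)
        + ∫ x, |g x - f' x| ∂(μ : Measure X) := by
      rw [← integral_add (f'.integrable _) hdμ]
      refine integral_mono (Integrable.of_bound hg.aestronglyMeasurable B
        (Filter.Eventually.of_forall hB)) ((f'.integrable _).add hdμ) fun x => ?_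
      simp only
      linarith [le_abs_self (g x - f' x)]
    have h2 : ∫ x in C, Real.exp (f' x - 1) ∂m ≤ ∫ x in C, Real.exp (g x - 1) ∂m
        + Real.exp B * ∫ x in C, |g x - f' x| ∂m := by
      rw [← integral_const_mul, ← integral_add (hexpi hg hB) (hdm.const_mul _)]
      refine integral_mono (hexpi f'.continuous.measurable hf'B)
        ((hexpi hg hB).add (hdm.const_mul _)) fun x => ?_
      simp only
      have h3 := Real.add_one_le_exp (g x - f' x)
      have h4 : Real.exp (g x - 1) = Real.exp (f' x - 1) * Real.exp (g x - f' x) := by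
        rw [← Real.exp_add]; ring_nf
      have h5 : Real.exp (f' x - 1) ≤ Real.exp B :=
        Real.exp_le_exp.2 (by linarith [le_abs_self (f' x), hf'B x])
      have h6 : Real.exp (f' x - 1) * |g x - f' x| ≤ Real.exp B * |g x - f' x| :=
        mul_le_mul_of_nonneg_right h5 (abs_nonneg _)
      have h7 : Real.exp (f' x - 1) * (-(|g x - f' x|) + 1)
          ≤ Real.exp (f' x - 1) * Real.exp (g x - f' x) :=
        mul_le_mul_of_nonneg_left
          (le_trans (by linarith [neg_abs_le (g x - f' x)]) h3) (Real.exp_pos _).le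
      rw [h4]
      linarith
    have h3 := hcont f'
    have h4 : (1 + Real.exp B) * δ = ε := by rw [hδ]; field_simp
    have h5 := Real.exp_pos B
    nlinarith
  obtain ⟨hac, hint, hle⟩ := integrable_llr_of_variational hC.measurableSet hμC hmC hV
  rw [relEntropy_of_integrable_llr hac hint]
  exact_mod_cast hle

end EntropyLimits

section EntropyCond

variable {X : Type*} [MeasurableSpace X] {m μ : Measure X}

lemma llr_cond [SigmaFinite m] [SigmaFinite μ] (hac : μ ≪ m) {K : Set X} (hK : MeasurableSet K)
    (h0 : μ K ≠ 0) (ht : μ K ≠ ⊤) :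
    llr (ProbabilityTheory.cond μ K) m =ᵐ[μ.restrict K]
      fun x => llr μ m x - Real.log (μ.real K) := by
  have : IsFiniteMeasure (μ.restrict K) := ⟨by simpa using ht.lt_top⟩
  have hacr : μ.restrict K ≪ m := Measure.absolutelyContinuous_restrict.trans hac
  have h1 := llr_smul_left hacr (μ K)⁻¹ (ENNReal.inv_ne_zero.2 ht) (ENNReal.inv_ne_top.2 h0)
  have h2 := hacr.ae_le (Measure.rnDeriv_restrict μ m hK)
  filter_upwards [h1, h2, ae_restrict_mem hK] with x hx1 hx2 hxK
  rw [ProbabilityTheory.cond, hx1]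
  simp only [llr, hx2, indicator_of_mem hxK, ENNReal.toReal_inv, Real.log_inv, measureReal_def]
  ring

lemma inEntropyDomain_cond [SigmaFinite m] [SigmaFinite μ] (hac : μ ≪ m) {K : Set X}
    (hK : MeasurableSet K) (h0 : μ K ≠ 0) (ht : μ K ≠ ⊤) (hint : IntegrableOn (llr μ m) K μ) :
    InEntropyDomain (ProbabilityTheory.cond μ K) m ∧
      relEntropy (ProbabilityTheory.cond μ K) m
        = (((μ.real K)⁻¹ * ∫ x in K, llr μ m x ∂μ - Real.log (μ.real K) : ℝ) : EReal) := by
  have : IsFiniteMeasure (μ.restrict K) := ⟨by simpa using ht.lt_top⟩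
  have hprob : IsProbabilityMeasure (ProbabilityTheory.cond μ K) :=
    ProbabilityTheory.cond_isProbabilityMeasure_of_finite h0 ht
  have hacr : μ.restrict K ≪ m := Measure.absolutelyContinuous_restrict.trans hac
  have hacc : ProbabilityTheory.cond μ K ≪ m :=
    (Measure.smul_absolutelyContinuous).trans hacr
  have h := llr_cond hac hK h0 ht
  have hi : Integrable (llr (ProbabilityTheory.cond μ K) m) (μ.restrict K) :=
    (hint.sub (integrable_const (Real.log (μ.real K)))).congr h.symm
  have hi' : Integrable (llr (ProbabilityTheory.cond μ K) m) (ProbabilityTheory.cond μ K) :=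
    hi.smul_measure (ENNReal.inv_ne_top.2 h0)
  refine ⟨inEntropyDomain_of_integrable_llr hacc hi', ?_⟩
  rw [relEntropy_of_integrable_llr hacc hi']
  congr 1
  have hpos : μ.real K ≠ 0 := by
    rw [measureReal_def]; exact (ENNReal.toReal_pos h0 ht).ne'
  conv_lhs => rw [show ProbabilityTheory.cond μ K = (μ K)⁻¹ • μ.restrict K from rfl]
  rw [integral_smul_measure]
  have h' : ∫ x in K, llr ((μ K)⁻¹ • μ.restrict K) m x ∂μ
      = ∫ x in K, (llr μ m x - Real.log (μ.real K)) ∂μ := integral_congr_ae h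
  rw [h', integral_sub hint (integrable_const _)]
  simp only [integral_const, ENNReal.toReal_inv, smul_eq_mul, measureReal_restrict_apply_univ,
    ← measureReal_def]
  field_simp

lemma inEntropyDomain_cond_self [SigmaFinite m] {B : Set X} (hB : MeasurableSet B) (h0 : m B ≠ 0)
    (ht : m B ≠ ⊤) : InEntropyDomain (ProbabilityTheory.cond m B) m := by
  refine (inEntropyDomain_cond (Measure.AbsolutelyContinuous.refl m) hB h0 ht ?_).1
  refine (integrable_zero X ℝ (m.restrict B)).congr ?_
  filter_upwards [ae_restrict_of_ae (llr_self m)] with x hx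
  rw [hx]

end EntropyCond

/-! ### Kantorovich duality on compact sets -/

section Duality

variable {X : Type*} [MeasurableSpace X]

/-- `(φ, ψ)` is an admissible pair of bounded potentials for `f` in the dual transport problem:
`f ≤ φ ⊕ ψ` on `S ⊆ X × X`. -/
structure IsDualPair (S : Set (X × X)) (f : X × X → ℝ) (φ ψ : X → ℝ) : Prop where
  meas_left : Measurable φ
  meas_right : Measurable ψ
  bdd_left : ∃ B, ∀ x, |φ x| ≤ B
  bdd_right : ∃ B, ∀ x, |ψ x| ≤ B
  le_add : ∀ z ∈ S, f z ≤ φ z.1 + ψ z.2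

namespace IsDualPair

variable {S : Set (X × X)} {f g : X × X → ℝ} {φ ψ φ' ψ' : X → ℝ}

lemma integrable_left (h : IsDualPair S f φ ψ) (μ : Measure X) [IsFiniteMeasure μ] :
    Integrable φ μ :=
  let ⟨B, hB⟩ := h.bdd_left
  Integrable.of_bound h.meas_left.aestronglyMeasurable B (Filter.Eventually.of_forall hB)

lemma integrable_right (h : IsDualPair S f φ ψ) (μ : Measure X) [IsFiniteMeasure μ] :
    Integrable ψ μ :=
  let ⟨B, hB⟩ := h.bdd_right
  Integrable.of_bound h.meas_right.aestronglyMeasurable B (Filter.Eventually.of_forall hB)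

lemma add (h : IsDualPair S f φ ψ) (h' : IsDualPair S g φ' ψ') :
    IsDualPair S (f + g) (φ + φ') (ψ + ψ') where
  meas_left := h.meas_left.add h'.meas_left
  meas_right := h.meas_right.add h'.meas_right
  bdd_left := by
    obtain ⟨B, hB⟩ := h.bdd_left
    obtain ⟨B', hB'⟩ := h'.bdd_left
    exact ⟨B + B', fun x => (abs_add_le _ _).trans (add_le_add (hB x) (hB' x))⟩
  bdd_right := by
    obtain ⟨B, hB⟩ := h.bdd_right
    obtain ⟨B', hB'⟩ := h'.bdd_right
    exact ⟨B + B', fun x => (abs_add_le _ _).trans (add_le_add (hB x) (hB' x))⟩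
  le_add := fun z hz => by
    have h1 := h.le_add z hz
    have h2 := h'.le_add z hz
    simp only [Pi.add_apply]
    linarith

lemma smul (h : IsDualPair S f φ ψ) {c : ℝ} (hc : 0 ≤ c) :
    IsDualPair S (c • f) (c • φ) (c • ψ) where
  meas_left := h.meas_left.const_smul c
  meas_right := h.meas_right.const_smul c
  bdd_left := by
    obtain ⟨B, hB⟩ := h.bdd_left
    exact ⟨|c| * B, fun x => by
      simp only [Pi.smul_apply, smul_eq_mul, abs_mul]; gcongr; exact hB x⟩
  bdd_right := by
    obtain ⟨B, hB⟩ := h.bdd_right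
    exact ⟨|c| * B, fun x => by
      simp only [Pi.smul_apply, smul_eq_mul, abs_mul]; gcongr; exact hB x⟩
  le_add := fun z hz => by
    have h1 := h.le_add z hz
    simp only [Pi.smul_apply, smul_eq_mul]
    nlinarith

end IsDualPair

lemma integral_add_integral_eq_integral_coupling {μ ν : Measure X} [IsProbabilityMeasure μ]
    [IsProbabilityMeasure ν] {π : Measure (X × X)} (h1 : π.map Prod.fst = μ)
    (h2 : π.map Prod.snd = ν) {φ ψ : X → ℝ} (hφ : Integrable φ μ) (hψ : Integrable ψ ν) :
    Integrable (fun z : X × X => φ z.1 + ψ z.2) π ∧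
      ∫ z, (φ z.1 + ψ z.2) ∂π = ∫ x, φ x ∂μ + ∫ y, ψ y ∂ν := by
  subst h1 h2
  have i1 : Integrable (fun z : X × X => φ z.1) π := hφ.comp_measurable measurable_fst
  have i2 : Integrable (fun z : X × X => ψ z.2) π := hψ.comp_measurable measurable_snd
  refine ⟨i1.add i2, ?_⟩
  rw [integral_add i1 i2, integral_map measurable_fst.aemeasurable hφ.aestronglyMeasurable,
    integral_map measurable_snd.aemeasurable hψ.aestronglyMeasurable]

lemma measure_compl_prod_eq_zero {μ ν : Measure X} {π : Measure (X × X)}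
    (h1 : π.map Prod.fst = μ) (h2 : π.map Prod.snd = ν) {K₀ K₁ : Set X} (hK₀ : MeasurableSet K₀)
    (hK₁ : MeasurableSet K₁) (hμ : μ K₀ᶜ = 0) (hν : ν K₁ᶜ = 0) : π (K₀ ×ˢ K₁)ᶜ = 0 := by
  rw [compl_prod_eq_union, measure_union_null_iff]
  rw [← h1, Measure.map_apply measurable_fst hK₀.compl] at hμ
  rw [← h2, Measure.map_apply measurable_snd hK₁.compl] at hν
  refine ⟨?_, ?_⟩
  · convert hμ using 2; ext; simp
  · convert hν using 2; ext; simp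

variable [MetricSpace X] [ProperSpace X] [BorelSpace X]

/-- Kantorovich duality without gap. The dual value is a sublinear functional of the cost; a linear
functional below it which agrees with it at `c` (Hahn–Banach) is positive, and the measure
representing it (Riesz–Markov–Kakutani) is a coupling with cost equal to the dual value. -/
theorem exists_coupling_dual {μ ν : Measure X} [IsProbabilityMeasure μ] [IsProbabilityMeasure ν]
    {K₀ K₁ : Set X} (hK₀ : IsCompact K₀) (hK₁ : IsCompact K₁) (hμ : μ K₀ᶜ = 0) (hν : ν K₁ᶜ = 0)
    {c : X × X → ℝ} (hc : Continuous c) :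
    ∃ π : Measure (X × X), IsProbabilityMeasure π ∧ π.map Prod.fst = μ ∧ π.map Prod.snd = ν ∧
      ∀ ε > 0, ∃ φ ψ, IsDualPair (K₀ ×ˢ K₁) c φ ψ ∧
        ∫ x, φ x ∂μ + ∫ y, ψ y ∂ν ≤ ∫ z, c z ∂π + ε := by
  set S := K₀ ×ˢ K₁ with hS
  have hSc : IsCompact S := hK₀.prod hK₁
  have : CompactSpace S := isCompact_iff_compactSpace.1 hSc
  -- `ext` extends functions on `S` by zero, `V f` is the set of dual values for the cost `f`, and
  -- `sInf (V f)` is shown to be sublinear in `f`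
  let ext : C(S, ℝ) → X × X → ℝ := fun f => Function.extend Subtype.val f 0
  have hext : ∀ (f : C(S, ℝ)) (s : S), ext f s.1 = f s := fun f s =>
    Subtype.val_injective.extend_apply _ _ _
  let V : C(S, ℝ) → Set ℝ := fun f =>
    {r | ∃ φ ψ, IsDualPair S (ext f) φ ψ ∧ ∫ x, φ x ∂μ + ∫ y, ψ y ∂ν = r}
  have hVlb : ∀ f : C(S, ℝ), ∀ b : ℝ, (∀ s, b ≤ f s) → ∀ r ∈ V f, b ≤ r := by
    rintro f b hb r ⟨φ, ψ, h, rfl⟩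
    obtain ⟨hi, he⟩ := integral_add_integral_eq_integral_coupling (π := μ.prod ν)
      (by simp) (by simp) (h.integrable_left μ) (h.integrable_right ν)
    rw [← he]
    have : b = ∫ _, b ∂(μ.prod ν) := by simp
    rw [this]
    refine integral_mono_ae (integrable_const _) hi ?_
    have h0 : (μ.prod ν) Sᶜ = 0 := measure_compl_prod_eq_zero (by simp) (by simp)
      hK₀.measurableSet hK₁.measurableSet hμ hν
    have h0' : ∀ᵐ z ∂(μ.prod ν), z ∈ S := h0
    filter_upwards [h0'] with z hz
    exact (hb ⟨z, hz⟩).trans ((hext f ⟨z, hz⟩).symm.le.trans (h.le_add z hz))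
  have hVbdd : ∀ f, BddBelow (V f) := fun f =>
    ⟨-‖f‖, hVlb f _ fun s => neg_le_of_abs_le (f.norm_coe_le_norm s)⟩
  have hVmem : ∀ (f : C(S, ℝ)) (φ ψ : X → ℝ), IsDualPair S (ext f) φ ψ →
      sInf (V f) ≤ ∫ x, φ x ∂μ + ∫ y, ψ y ∂ν := fun f φ ψ h =>
    csInf_le (hVbdd f) ⟨φ, ψ, h, rfl⟩
  have hconst : ∀ (f : C(S, ℝ)) (b : ℝ), (∀ s, f s ≤ b) →
      IsDualPair S (ext f) (fun _ => b) (fun _ => 0) := fun f b hb =>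
    { meas_left := measurable_const
      meas_right := measurable_const
      bdd_left := ⟨|b|, fun _ => le_rfl⟩
      bdd_right := ⟨0, fun _ => by simp⟩
      le_add := fun z hz => by
        rw [hext f ⟨z, hz⟩, add_zero]; exact hb _ }
  have hVne : ∀ f, (V f).Nonempty := fun f =>
    ⟨_, _, _, hconst f ‖f‖ (fun s => le_of_abs_le (f.norm_coe_le_norm s)), rfl⟩
  have hVle : ∀ (f : C(S, ℝ)) (b : ℝ), (∀ s, f s ≤ b) → sInf (V f) ≤ b := fun f b hb => by
    simpa using hVmem f _ _ (hconst f b hb)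
  have hcongr : ∀ {f g : X × X → ℝ} {φ ψ : X → ℝ}, IsDualPair S f φ ψ → (∀ z ∈ S, g z = f z) →
      IsDualPair S g φ ψ := fun h hfg =>
    { h with
      le_add := fun z hz => by
        rw [hfg z hz]; exact h.le_add z hz }
  have hadd : ∀ f g : C(S, ℝ), sInf (V (f + g)) ≤ sInf (V f) + sInf (V g) := by
    intro f g
    refine le_of_forall_pos_le_add fun ε hε => ?_
    obtain ⟨_, ⟨φ, ψ, h, rfl⟩, hr⟩ := exists_lt_of_csInf_lt (hVne f)
      (lt_add_of_pos_right _ (half_pos hε))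
    obtain ⟨_, ⟨φ', ψ', h', rfl⟩, hr'⟩ := exists_lt_of_csInf_lt (hVne g)
      (lt_add_of_pos_right _ (half_pos hε))
    have := hVmem (f + g) (φ + φ') (ψ + ψ') (hcongr (h.add h') fun z hz => by
      rw [hext _ ⟨z, hz⟩, Pi.add_apply, hext f ⟨z, hz⟩, hext g ⟨z, hz⟩]; rfl)
    have e1 := integral_add (h.integrable_left μ) (h'.integrable_left μ)
    have e2 := integral_add (h.integrable_right ν) (h'.integrable_right ν)
    simp only [Pi.add_apply] at this
    linarith
  have hsmul_le : ∀ r : ℝ, 0 < r → ∀ f : C(S, ℝ), sInf (V (r • f)) ≤ r * sInf (V f) := by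
    intro r hr f
    refine le_of_forall_pos_le_add fun ε hε => ?_
    obtain ⟨_, ⟨φ, ψ, h, rfl⟩, hlt⟩ := exists_lt_of_csInf_lt (hVne f)
      (lt_add_of_pos_right _ (div_pos hε hr))
    have := hVmem (r • f) (r • φ) (r • ψ) (hcongr (h.smul hr.le) fun z hz => by
      rw [hext _ ⟨z, hz⟩, Pi.smul_apply, hext f ⟨z, hz⟩]; rfl)
    simp only [Pi.smul_apply, smul_eq_mul, integral_const_mul] at this
    have h3 := mul_lt_mul_of_pos_left hlt hr
    have h4 : r * (ε / r) = ε := by field_simp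
    rw [mul_add, mul_add, h4] at h3
    linarith
  have hsmul : ∀ r : ℝ, 0 < r → ∀ f : C(S, ℝ), sInf (V (r • f)) = r * sInf (V f) := by
    intro r hr f
    refine le_antisymm (hsmul_le r hr f) ?_
    have := hsmul_le r⁻¹ (inv_pos.2 hr) (r • f)
    rw [smul_smul, inv_mul_cancel₀ hr.ne', one_smul] at this
    calc r * sInf (V f) ≤ r * (r⁻¹ * sInf (V (r • f))) := by gcongr
      _ = sInf (V (r • f)) := by rw [← mul_assoc, mul_inv_cancel₀ hr.ne', one_mul]
  have hzero : sInf (V 0) = 0 := by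
    have := hsmul 2 (by norm_num) 0
    rw [smul_zero] at this
    linarith
  let cS : C(S, ℝ) := ⟨fun s => c s.1, hc.comp continuous_subtype_val⟩
  -- Hahn–Banach extension of `r • c ↦ r * sInf (V c)`
  obtain ⟨Λ, hΛ1, hΛ2⟩ := exists_extension_of_le_sublinear
    (LinearPMap.mkSpanSingleton' cS (sInf (V cS)) (fun r hr => by
      rcases smul_eq_zero.1 hr with h | h
      · simp [h]
      · rw [h, hzero, smul_zero])) (fun f => sInf (V f)) hsmul hadd (by
      rintro ⟨x, hx⟩
      obtain ⟨r, rfl⟩ := Submodule.mem_span_singleton.1 hx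
      rw [LinearPMap.mkSpanSingleton'_apply]
      simp only [RingHom.id_apply, smul_eq_mul]
      rcases lt_trichotomy r 0 with h | h | h
      · have h1 := hsmul (-r) (neg_pos.2 h) cS
        have h2 := hadd (r • cS) ((-r) • cS)
        rw [← add_smul, add_neg_cancel, zero_smul, hzero, h1] at h2
        linarith
      · simp [h, hzero]
      · rw [hsmul r h])
  have hΛc : Λ cS = sInf (V cS) := by
    have := hΛ1 ⟨cS, Submodule.mem_span_singleton_self _⟩
    exact this.trans (LinearPMap.mkSpanSingleton'_apply_self _ _ _ _)
  have hΛmono : ∀ f g : C(S, ℝ), (∀ s, f s ≤ g s) → Λ f ≤ Λ g := by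
    intro f g hfg
    have h1 := (hΛ2 (f - g)).trans (hVle (f - g) 0 fun s => by simpa using hfg s)
    rw [map_sub] at h1
    linarith
  let Λ' : CompactlySupportedContinuousMap S ℝ →ₚ[ℝ] ℝ :=
    { toFun := fun f => Λ f.toContinuousMap
      map_add' := fun f g => Λ.map_add f.toContinuousMap g.toContinuousMap
      map_smul' := fun r f => Λ.map_smul r f.toContinuousMap
      monotone' := fun f g hfg => hΛmono _ _ hfg }
  set πS := RealRMK.rieszMeasure Λ' with hπS
  have hint : ∀ f : C(S, ℝ), ∫ s, f s ∂πS = Λ f := fun f =>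
    RealRMK.integral_rieszMeasure Λ' ⟨f, HasCompactSupport.of_compactSpace _⟩
  -- functions of the form `φ ⊕ ψ` are their own dual potentials, with both signs, which determines
  -- `Λ` on them and hence the marginals of the representing measure
  have hmarg : ∀ (F : C(S, ℝ)) (v : ℝ),
      (∃ φ ψ, IsDualPair S (ext F) φ ψ ∧ ∫ x, φ x ∂μ + ∫ y, ψ y ∂ν ≤ v) →
      (∃ φ ψ, IsDualPair S (ext (-F)) φ ψ ∧ ∫ x, φ x ∂μ + ∫ y, ψ y ∂ν ≤ -v) →
      Λ F = v := by
    rintro F v ⟨φ, ψ, h, hv⟩ ⟨φ', ψ', h', hv'⟩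
    have h1 := (hΛ2 F).trans ((hVmem F φ ψ h).trans hv)
    have h2 := (hΛ2 (-F)).trans ((hVmem (-F) φ' ψ' h').trans hv')
    rw [map_neg] at h2
    linarith
  have hone : Λ 1 = 1 := by
    refine hmarg 1 1 ⟨fun _ => 1, fun _ => 0, hconst 1 1 fun s => by simp, by simp⟩
      ⟨fun _ => -1, fun _ => 0, hconst (-1) (-1) fun s => by simp, by simp⟩
  have hprobS : IsProbabilityMeasure πS := by
    have := hint 1
    rw [hone] at this
    simp only [ContinuousMap.one_apply, integral_const, smul_eq_mul, mul_one, measureReal_def] at this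
    constructor
    have h2 := (ENNReal.toReal_eq_one_iff _).1 this
    exact h2
  have hvm : Measurable (Subtype.val : S → X × X) := measurable_subtype_coe
  have hprob : IsProbabilityMeasure (πS.map Subtype.val) :=
    Measure.isProbabilityMeasure_map hvm.aemeasurable
  have hbd : ∀ g : BoundedContinuousFunction X ℝ, ∃ B, ∀ x, |g x| ≤ B := fun g =>
    ⟨‖g‖, g.norm_coe_le_norm⟩
  refine ⟨πS.map Subtype.val, hprob, ?_, ?_, ?_⟩
  · have := Measure.isProbabilityMeasure_map (μ := πS.map Subtype.val)
      (measurable_fst (α := X) (β := X)).aemeasurable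
    refine ext_of_forall_integral_eq_of_IsFiniteMeasure fun g => ?_
    rw [integral_map measurable_fst.aemeasurable g.continuous.measurable.aestronglyMeasurable,
      integral_map (f := fun z : X × X => g z.1) hvm.aemeasurable
        (g.continuous.comp continuous_fst).aestronglyMeasurable]
    let F : C(S, ℝ) := ⟨fun s => g s.1.1,
      g.continuous.comp (continuous_fst.comp continuous_subtype_val)⟩
    refine (hint F).trans (hmarg F _ ⟨g, fun _ => 0, ?_, by simp⟩
      ⟨-g, fun _ => 0, ?_, by simp [integral_neg]⟩)
    · exact ⟨g.continuous.measurable, measurable_const, hbd g, ⟨0, by simp⟩, fun z hz => by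
        rw [hext F ⟨z, hz⟩]; simp [F]⟩
    · exact ⟨(-g).continuous.measurable, measurable_const, hbd (-g), ⟨0, by simp⟩, fun z hz => by
        rw [hext (-F) ⟨z, hz⟩]; simp [F]⟩
  · have := Measure.isProbabilityMeasure_map (μ := πS.map Subtype.val)
      (measurable_snd (α := X) (β := X)).aemeasurable
    refine ext_of_forall_integral_eq_of_IsFiniteMeasure fun g => ?_
    rw [integral_map measurable_snd.aemeasurable g.continuous.measurable.aestronglyMeasurable,
      integral_map (f := fun z : X × X => g z.2) hvm.aemeasurable
        (g.continuous.comp continuous_snd).aestronglyMeasurable]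
    let F : C(S, ℝ) := ⟨fun s => g s.1.2,
      g.continuous.comp (continuous_snd.comp continuous_subtype_val)⟩
    refine (hint F).trans (hmarg F _ ⟨fun _ => 0, g, ?_, by simp⟩
      ⟨fun _ => 0, -g, ?_, by simp [integral_neg]⟩)
    · exact ⟨measurable_const, g.continuous.measurable, ⟨0, by simp⟩, hbd g, fun z hz => by
        rw [hext F ⟨z, hz⟩]; simp [F]⟩
    · exact ⟨measurable_const, (-g).continuous.measurable, ⟨0, by simp⟩, hbd (-g), fun z hz => by
        rw [hext (-F) ⟨z, hz⟩]; simp [F]⟩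
  · intro ε hε
    rw [integral_map hvm.aemeasurable hc.aestronglyMeasurable]
    have h1 : ∫ s : S, c s.1 ∂πS = sInf (V cS) := (hint cS).trans hΛc
    rw [h1]
    obtain ⟨_, ⟨φ, ψ, h, rfl⟩, hr⟩ := exists_lt_of_csInf_lt (hVne cS)
      (lt_add_of_pos_right _ hε)
    exact ⟨φ, ψ, hcongr h fun z hz => (hext cS ⟨z, hz⟩).symm, hr.le⟩

end Duality

section Slackness

variable {X : Type*} [MeasurableSpace X]

/-- For a cost between `0` and `M`, admissible potentials may be shifted so that both are
nonnegative, and then truncated at `M`, which does not increase the dual value. -/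
lemma IsDualPair.exists_mem_Icc {μ ν : Measure X} [IsProbabilityMeasure μ]
    [IsProbabilityMeasure ν] {K₀ K₁ : Set X} (hne : K₀.Nonempty) (hμ : μ K₀ᶜ = 0)
    (hν : ν K₁ᶜ = 0) {c : X × X → ℝ} {M : ℝ} (hM : 0 ≤ M)
    (hc : ∀ z ∈ K₀ ×ˢ K₁, 0 ≤ c z ∧ c z ≤ M) {φ ψ : X → ℝ}
    (h : IsDualPair (K₀ ×ˢ K₁) c φ ψ) :
    ∃ φ' ψ', IsDualPair (K₀ ×ˢ K₁) c φ' ψ' ∧ (∀ x, φ' x ∈ Icc 0 M) ∧ (∀ x, ψ' x ∈ Icc 0 M) ∧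
      ∫ x, φ' x ∂μ + ∫ y, ψ' y ∂ν ≤ ∫ x, φ x ∂μ + ∫ y, ψ y ∂ν := by
  set a := sInf (φ '' K₀) with ha
  have hbdd : BddBelow (φ '' K₀) := by
    obtain ⟨B, hB⟩ := h.bdd_left
    refine ⟨-B, ?_⟩
    rintro _ ⟨x, -, rfl⟩
    exact neg_le_of_abs_le (hB x)
  have hφ : ∀ x ∈ K₀, 0 ≤ φ x - a := fun x hx =>
    sub_nonneg.2 (csInf_le hbdd (mem_image_of_mem φ hx))
  have hψ : ∀ y ∈ K₁, 0 ≤ ψ y + a := by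
    intro y hy
    have : -ψ y ≤ a := by
      refine le_csInf (hne.image φ) ?_
      rintro _ ⟨x, hx, rfl⟩
      have h1 := h.le_add (x, y) ⟨hx, hy⟩
      have h2 := (hc (x, y) ⟨hx, hy⟩).1
      simp only at h1
      linarith
    linarith
  have hcl : ∀ r : ℝ, max 0 (min r M) ∈ Icc 0 M := fun r =>
    ⟨le_max_left _ _, max_le hM (min_le_right _ _)⟩
  have hclb : ∀ r : ℝ, |max 0 (min r M)| ≤ M := fun r => by
    rw [abs_of_nonneg (hcl r).1]; exact (hcl r).2
  have hcl' : ∀ r : ℝ, 0 ≤ r → max 0 (min r M) = min r M := fun r hr =>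
    max_eq_right (le_min hr hM)
  have hpair : IsDualPair (K₀ ×ˢ K₁) c (fun x => max 0 (min (φ x - a) M))
      (fun y => max 0 (min (ψ y + a) M)) :=
    { meas_left := measurable_const.max ((h.meas_left.sub_const a).min measurable_const)
      meas_right := measurable_const.max ((h.meas_right.add_const a).min measurable_const)
      bdd_left := ⟨M, fun x => hclb _⟩
      bdd_right := ⟨M, fun x => hclb _⟩
      le_add := fun z hz => by
        have h1 := hφ z.1 hz.1
        have h2 := hψ z.2 hz.2
        have h3 := h.le_add z hz
        have h4 := (hc z hz).2
        simp only [hcl' _ h1, hcl' _ h2]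
        rcases min_cases (φ z.1 - a) M with h5 | h5 <;>
          rcases min_cases (ψ z.2 + a) M with h6 | h6 <;> rw [h5.1, h6.1] <;> linarith }
  refine ⟨_, _, hpair, fun x => hcl _, fun y => hcl _, ?_⟩
  have h1 : ∫ x, max 0 (min (φ x - a) M) ∂μ ≤ ∫ x, (φ x - a) ∂μ := by
    refine integral_mono_ae (hpair.integrable_left μ)
      ((h.integrable_left μ).sub (integrable_const _)) ?_
    have h0 : ∀ᵐ x ∂μ, x ∈ K₀ := hμ
    filter_upwards [h0] with x hx
    rw [hcl' _ (hφ x hx)]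
    exact min_le_left _ _
  have h2 : ∫ y, max 0 (min (ψ y + a) M) ∂ν ≤ ∫ y, (ψ y + a) ∂ν := by
    refine integral_mono_ae (hpair.integrable_right ν)
      ((h.integrable_right ν).add (integrable_const _)) ?_
    have h0 : ∀ᵐ y ∂ν, y ∈ K₁ := hν
    filter_upwards [h0] with y hy
    rw [hcl' _ (hψ y hy)]
    exact min_le_left _ _
  rw [integral_sub (h.integrable_left μ) (integrable_const _)] at h1
  rw [integral_add (h.integrable_right ν) (integrable_const _)] at h2
  simp only [integral_const, probReal_univ, one_smul] at h1 h2
  linarith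

variable [MetricSpace X] [ProperSpace X] [BorelSpace X]

/-- An optimal coupling, and a cyclically monotone Borel set that carries exactly the optimal
couplings. The set consists of the points where `φ n ⊕ ψ n - c → 0` for a sequence of potentials
whose dual values converge to the optimum with summable errors. -/
theorem exists_optimal_coupling_cyclicallyMonotone {μ ν : Measure X} [IsProbabilityMeasure μ]
    [IsProbabilityMeasure ν] {K₀ K₁ : Set X} (hK₀ : IsCompact K₀) (hK₁ : IsCompact K₁)
    (hμ : μ K₀ᶜ = 0) (hν : ν K₁ᶜ = 0) {c : X × X → ℝ} (hcc : Continuous c) {M : ℝ} (hM : 0 ≤ M)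
    (hc : ∀ z ∈ K₀ ×ˢ K₁, 0 ≤ c z ∧ c z ≤ M) :
    ∃ (π : Measure (X × X)) (Γ : Set (X × X)),
      IsProbabilityMeasure π ∧ π.map Prod.fst = μ ∧ π.map Prod.snd = ν ∧
      MeasurableSet Γ ∧ Γ ⊆ K₀ ×ˢ K₁ ∧
      (∀ (n : ℕ) (z : Fin n → X × X), (∀ i, z i ∈ Γ) →
        ∑ i, c ((z (finRotate n i)).1, (z i).2) ≤ ∑ i, c (z i)) ∧
      (∀ π' : Measure (X × X), IsProbabilityMeasure π' → π'.map Prod.fst = μ →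
        π'.map Prod.snd = ν → ∫ z, c z ∂π' ≤ ∫ z, c z ∂π) ∧
      ∀ π' : Measure (X × X), IsProbabilityMeasure π' → π'.map Prod.fst = μ →
        π'.map Prod.snd = ν → (∫ z, c z ∂π ≤ ∫ z, c z ∂π' ↔ π' Γ = 1) := by
  have hne : K₀.Nonempty := by
    rw [nonempty_iff_ne_empty]
    rintro rfl
    simp at hμ
  obtain ⟨π, hπ, hπ1, hπ2, hdual⟩ := exists_coupling_dual hK₀ hK₁ hμ hν hcc
  have hex : ∀ n : ℕ, ∃ φ ψ, IsDualPair (K₀ ×ˢ K₁) c φ ψ ∧ (∀ x, φ x ∈ Icc 0 M) ∧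
      (∀ x, ψ x ∈ Icc 0 M) ∧
      ∫ x, φ x ∂μ + ∫ y, ψ y ∂ν ≤ ∫ z, c z ∂π + (1 / 2) ^ n := by
    intro n
    obtain ⟨φ, ψ, h, hle⟩ := hdual ((1 / 2) ^ n) (by positivity)
    obtain ⟨φ', ψ', h', h1, h2, h3⟩ := h.exists_mem_Icc hne hμ hν hM hc
    exact ⟨φ', ψ', h', h1, h2, h3.trans hle⟩
  choose φ ψ hpair hφ hψ hval using hex
  let gap : ℕ → X × X → ℝ := fun n z => φ n z.1 + ψ n z.2 - c z
  have hgm : ∀ n, Measurable (gap n) := fun n =>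
    (((hpair n).meas_left.comp measurable_fst).add
      ((hpair n).meas_right.comp measurable_snd)).sub hcc.measurable
  have hSm : MeasurableSet (K₀ ×ˢ K₁) := hK₀.measurableSet.prod hK₁.measurableSet
  have hg0 : ∀ n, ∀ z ∈ K₀ ×ˢ K₁, 0 ≤ gap n z := fun n z hz =>
    sub_nonneg.2 ((hpair n).le_add z hz)
  have hgb : ∀ n, ∀ z ∈ K₀ ×ˢ K₁, gap n z ≤ 2 * M := fun n z hz => by
    have := (hφ n z.1).2
    have := (hψ n z.2).2
    have := (hc z hz).1
    simp only [gap]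
    linarith
  have hcoup : ∀ π' : Measure (X × X), IsProbabilityMeasure π' → π'.map Prod.fst = μ →
      π'.map Prod.snd = ν → (∀ᵐ z ∂π', z ∈ K₀ ×ˢ K₁) ∧ Integrable c π' ∧
      ∀ n, Integrable (gap n) π' ∧
        ∫ z, gap n z ∂π' = ∫ x, φ n x ∂μ + ∫ y, ψ n y ∂ν - ∫ z, c z ∂π' := by
    intro π' hp' h1 h2
    have hS : ∀ᵐ z ∂π', z ∈ K₀ ×ˢ K₁ :=
      measure_compl_prod_eq_zero h1 h2 hK₀.measurableSet hK₁.measurableSet hμ hν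
    have hci : Integrable c π' := by
      refine Integrable.of_bound hcc.aestronglyMeasurable M ?_
      filter_upwards [hS] with z hz
      rw [Real.norm_of_nonneg (hc z hz).1]
      exact (hc z hz).2
    refine ⟨hS, hci, fun n => ?_⟩
    obtain ⟨hi, he⟩ := integral_add_integral_eq_integral_coupling h1 h2
      ((hpair n).integrable_left μ) ((hpair n).integrable_right ν)
    exact ⟨hi.sub hci, by rw [integral_sub hi hci, he]⟩
  have hopt : ∀ π' : Measure (X × X), IsProbabilityMeasure π' → π'.map Prod.fst = μ →
      π'.map Prod.snd = ν → ∫ z, c z ∂π' ≤ ∫ z, c z ∂π := by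
    intro π' hp' h1 h2
    obtain ⟨hS, hci, hg⟩ := hcoup π' hp' h1 h2
    have hlim : Filter.Tendsto (fun n : ℕ => ∫ z, c z ∂π + (1 / 2 : ℝ) ^ n) Filter.atTop
        (𝓝 (∫ z, c z ∂π + 0)) :=
      (tendsto_pow_atTop_nhds_zero_of_lt_one (by norm_num) (by norm_num)).const_add _
    rw [add_zero] at hlim
    refine ge_of_tendsto' hlim fun n => ?_
    have h3 : 0 ≤ ∫ z, gap n z ∂π' := integral_nonneg_of_ae (by
      filter_upwards [hS] with z hz using hg0 n z hz)
    rw [(hg n).2] at h3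
    linarith [hval n]
  refine ⟨π, {z | z ∈ K₀ ×ˢ K₁ ∧ Filter.Tendsto (fun n => gap n z) Filter.atTop (𝓝 0)}, hπ, hπ1,
    hπ2, hSm.inter (measurableSet_tendsto _ hgm), fun z hz => hz.1, ?_, hopt, ?_⟩
  · intro n z hz
    have hle : ∀ k, ∑ i, c ((z (finRotate n i)).1, (z i).2)
        ≤ ∑ i, (gap k (z i)) + ∑ i, c (z i) := by
      intro k
      calc ∑ i, c ((z (finRotate n i)).1, (z i).2)
          ≤ ∑ i, (φ k (z (finRotate n i)).1 + ψ k (z i).2) :=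
            Finset.sum_le_sum fun i _ => (hpair k).le_add ((z (finRotate n i)).1, (z i).2)
              ⟨(hz _).1.1, (hz _).1.2⟩
        _ = ∑ i, (φ k (z i).1 + ψ k (z i).2) := by
            rw [Finset.sum_add_distrib, Finset.sum_add_distrib]
            congr 1
            exact Equiv.sum_comp (finRotate n) fun i => φ k (z i).1
        _ = ∑ i, (gap k (z i)) + ∑ i, c (z i) := by
            rw [← Finset.sum_add_distrib]
            refine Finset.sum_congr rfl fun i _ => ?_
            simp [gap]
    have hlim : Filter.Tendsto (fun k => ∑ i, (gap k (z i)) + ∑ i, c (z i)) Filter.atTop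
        (𝓝 (∑ _i : Fin n, (0 : ℝ) + ∑ i, c (z i))) :=
      (tendsto_finsetSum _ fun i _ => (hz i).2).add_const _
    rw [Finset.sum_const_zero, zero_add] at hlim
    exact ge_of_tendsto' hlim hle
  · intro π' hp' h1 h2
    obtain ⟨hS, hci, hg⟩ := hcoup π' hp' h1 h2
    have hgle : ∀ n, ∫ z, gap n z ∂π' ≤ ∫ z, c z ∂π + (1 / 2) ^ n - ∫ z, c z ∂π' := fun n => by
      rw [(hg n).2]; linarith [hval n]
    have hΓm : MeasurableSet
        {z | z ∈ K₀ ×ˢ K₁ ∧ Filter.Tendsto (fun n => gap n z) Filter.atTop (𝓝 0)} :=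
      hSm.inter (measurableSet_tendsto _ hgm)
    rw [← prob_compl_eq_zero_iff hΓm]
    constructor
    · intro hle
      have hsum : ∑' n, ∫⁻ z, ENNReal.ofReal (gap n z) ∂π' ≠ ⊤ := by
        have hterm : ∀ n, ∫⁻ z, ENNReal.ofReal (gap n z) ∂π' ≤ ENNReal.ofReal ((1 / 2) ^ n) := by
          intro n
          rw [← ofReal_integral_eq_lintegral_ofReal (hg n).1 (by
            filter_upwards [hS] with z hz using hg0 n z hz)]
          refine ENNReal.ofReal_le_ofReal ?_
          linarith [hgle n]
        refine ne_top_of_le_ne_top ?_ (ENNReal.tsum_le_tsum hterm)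
        rw [← ENNReal.ofReal_tsum_of_nonneg (fun n => by positivity) summable_geometric_two]
        exact ENNReal.ofReal_ne_top
      rw [← lintegral_tsum fun n => (hgm n).ennreal_ofReal.aemeasurable] at hsum
      have hae := ae_lt_top (Measurable.tsum fun n => (hgm n).ennreal_ofReal) hsum
      change ∀ᵐ z ∂π', z ∈ {z | z ∈ K₀ ×ˢ K₁ ∧ Filter.Tendsto (fun n => gap n z) Filter.atTop (𝓝 0)}
      filter_upwards [hS, hae] with z hz hz'
      refine ⟨hz, ?_⟩
      have h3 := ENNReal.tendsto_atTop_zero_of_tsum_ne_top hz'.ne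
      have h4 := (ENNReal.tendsto_toReal ENNReal.zero_ne_top).comp h3
      refine h4.congr fun n => ?_
      simp [ENNReal.toReal_ofReal (hg0 n z hz)]
    · intro h0
      have h0' : ∀ᵐ z ∂π', z ∈ K₀ ×ˢ K₁ ∧ Filter.Tendsto (fun n => gap n z) Filter.atTop (𝓝 0) :=
        h0
      have hlim : Filter.Tendsto (fun n => ∫ z, gap n z ∂π') Filter.atTop
          (𝓝 (∫ _, (0 : ℝ) ∂π')) := by
        refine tendsto_integral_of_dominated_convergence (fun _ => 2 * M)
          (fun n => (hgm n).aestronglyMeasurable) (integrable_const _) (fun n => ?_) ?_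
        · filter_upwards [hS] with z hz
          rw [Real.norm_of_nonneg (hg0 n z hz)]
          exact hgb n z hz
        · filter_upwards [h0'] with z hz using hz.2
      rw [integral_zero] at hlim
      have hlim2 := hlim.add_const (∫ z, c z ∂π')
      rw [zero_add] at hlim2
      refine ge_of_tendsto' hlim2 fun n => ?_
      obtain ⟨hSπ, hciπ, hgπ⟩ := hcoup π hπ hπ1 hπ2
      have h3 : 0 ≤ ∫ z, gap n z ∂π := integral_nonneg_of_ae (by
        filter_upwards [hSπ] with z hz using hg0 n z hz)
      rw [(hgπ n).2] at h3
      rw [(hg n).2]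
      linarith

end Slackness

namespace LorentzianPreLengthSpace

section Dualisability

variable {X : Type*} [MetricSpace X] [ProperSpace X] (L : LorentzianPreLengthSpace X)

/-- The real-valued cost `τ^p`. It is meant for finite `τ`; where `τ = ∞` it has the junk value
`0 ^ p`. -/
noncomputable def powCost (p : ℝ) (z : X × X) : ℝ := (L.τ z.1 z.2).toReal ^ p

variable {L}

lemma powCost_nonneg (p : ℝ) (z : X × X) : 0 ≤ L.powCost p z :=
  Real.rpow_nonneg ENNReal.toReal_nonneg _

lemma ofReal_powCost (hτ_fin : ∀ x y, L.τ x y ≠ ⊤) {p : ℝ} (hp : 0 ≤ p) (z : X × X) :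
    ENNReal.ofReal (L.powCost p z) = L.τ z.1 z.2 ^ p := by
  rw [powCost, ← ENNReal.ofReal_rpow_of_nonneg ENNReal.toReal_nonneg hp,
    ENNReal.ofReal_toReal (hτ_fin _ _)]

lemma continuous_toReal_τ (hτ_fin : ∀ x y, L.τ x y ≠ ⊤)
    (hτ_cont : Continuous (fun z : X × X => L.τ z.1 z.2)) :
    Continuous (fun z : X × X => (L.τ z.1 z.2).toReal) :=
  ENNReal.continuousOn_toReal.comp_continuous hτ_cont fun z => hτ_fin z.1 z.2

lemma continuous_powCost (hτ_fin : ∀ x y, L.τ x y ≠ ⊤)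
    (hτ_cont : Continuous (fun z : X × X => L.τ z.1 z.2)) {p : ℝ} (hp : 0 ≤ p) :
    Continuous (L.powCost p) :=
  (continuous_toReal_τ hτ_fin hτ_cont).rpow_const fun _ => Or.inr hp

lemma ellPow_eq_coe (hτ_fin : ∀ x y, L.τ x y ≠ ⊤) {p : ℝ} (hp : 0 ≤ p) {x y : X}
    (h : L.causal x y) : L.ellPow p x y = (L.powCost p (x, y) : EReal) := by
  rw [ellPow, if_pos h, ← ofReal_powCost hτ_fin hp (x, y), EReal.coe_ennreal_ofReal,
    max_eq_left (powCost_nonneg _ _)]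

variable [MeasurableSpace X]

lemma cost_eq_ofReal (hτ_fin : ∀ x y, L.τ x y ≠ ⊤) {p : ℝ} (hp : 0 ≤ p) {π : Measure (X × X)}
    (hi : Integrable (L.powCost p) π) :
    L.cost p π = ENNReal.ofReal (∫ z, L.powCost p z ∂π) := by
  rw [ofReal_integral_eq_lintegral_ofReal hi (Filter.Eventually.of_forall fun z =>
    powCost_nonneg p z), cost]
  exact lintegral_congr fun z => (ofReal_powCost hτ_fin hp z).symm

lemma le_ell {p : ℝ} {μ ν : Measure X} {π : Measure (X × X)} (hπ : π ∈ L.causalPlans μ ν) :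
    ((L.cost p π ^ (1 / p) : ℝ≥0∞) : EReal) ≤ L.ell p μ ν :=
  le_iSup₂ (f := fun π (_ : π ∈ L.causalPlans μ ν) =>
    ((L.cost p π ^ (1 / p) : ℝ≥0∞) : EReal)) π hπ

lemma ell_le {p : ℝ} {μ ν : Measure X} {a : EReal} (h : ∀ π ∈ L.causalPlans μ ν,
    ((L.cost p π ^ (1 / p) : ℝ≥0∞) : EReal) ≤ a) : L.ell p μ ν ≤ a :=
  iSup₂_le h

variable [BorelSpace X]

/-- Measures whose compact supports are related by `≪` are strongly timelike dualisable: all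
couplings are causal, so this is transport with a continuous bounded cost. -/
theorem exists_stronglyDualisableBy (hτ_fin : ∀ x y, L.τ x y ≠ ⊤)
    (hτ_cont : Continuous (fun z : X × X => L.τ z.1 z.2)) {p : ℝ} (hp : 0 < p) {μ ν : Measure X}
    [IsProbabilityMeasure μ] [IsProbabilityMeasure ν] (hμ : IsCompact μ.support)
    (hν : IsCompact ν.support) (hch : ∀ x ∈ μ.support, ∀ y ∈ ν.support, L.chron x y) :
    ∃ π, L.StronglyDualisableBy p μ ν π := by
  have hcc := continuous_powCost hτ_fin hτ_cont hp.le
  have hμ0 : μ μ.supportᶜ = 0 := Measure.measure_compl_support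
  have hν0 : ν ν.supportᶜ = 0 := Measure.measure_compl_support
  obtain ⟨M, hM⟩ := (hμ.prod hν).exists_bound_of_continuousOn hcc.continuousOn
  have hM' : ∀ z ∈ μ.support ×ˢ ν.support, 0 ≤ L.powCost p z ∧ L.powCost p z ≤ max M 0 :=
    fun z hz => ⟨powCost_nonneg p z, (le_abs_self _).trans ((hM z hz).trans (le_max_left _ _))⟩
  obtain ⟨π, Γ, hπ, hπ1, hπ2, hΓm, hΓs, hcyc, hopt, hchar⟩ :=
    exists_optimal_coupling_cyclicallyMonotone hμ hν hμ0 hν0 hcc (le_max_right M 0) hM'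
  have hS : ∀ π' : Measure (X × X), π'.map Prod.fst = μ → π'.map Prod.snd = ν →
      ∀ᵐ z ∂π', z ∈ μ.support ×ˢ ν.support := fun π' h1 h2 =>
    measure_compl_prod_eq_zero h1 h2 hμ.measurableSet hν.measurableSet hμ0 hν0
  have hint : ∀ π' ∈ L.causalPlans μ ν, Integrable (L.powCost p) π' := by
    rintro π' ⟨hp', h1, h2, -⟩
    refine Integrable.of_bound hcc.aestronglyMeasurable (max M 0) ?_
    filter_upwards [hS π' h1 h2] with z hz
    rw [Real.norm_of_nonneg (hM' z hz).1]
    exact (hM' z hz).2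
  have hchron : ∀ᵐ z ∂π, L.chron z.1 z.2 := by
    filter_upwards [hS π hπ1 hπ2] with z hz using hch _ hz.1 _ hz.2
  have hπmem : π ∈ L.causalPlans μ ν :=
    ⟨hπ, hπ1, hπ2, hchron.mono fun z hz => L.causal_of_chron _ _ hz⟩
  have hcost : ∀ π' ∈ L.causalPlans μ ν, L.cost p π' = ENNReal.ofReal (∫ z, L.powCost p z ∂π') :=
    fun π' h => cost_eq_ofReal hτ_fin hp.le (hint π' h)
  have hnn : ∀ π' : Measure (X × X), 0 ≤ ∫ z, L.powCost p z ∂π' := fun π' =>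
    integral_nonneg fun z => powCost_nonneg p z
  have hpos : L.cost p π ≠ 0 := by
    have hmeas : Measurable fun z : X × X => L.τ z.1 z.2 ^ p := hτ_cont.measurable.pow_const p
    rw [cost, Ne, lintegral_eq_zero_iff hmeas]
    intro h0
    have : ∀ᵐ z ∂π, False := by
      filter_upwards [h0, hchron] with z hz hz'
      have h1 := (L.τ_pos_iff _ _).2 hz'
      simp only [Pi.zero_apply] at hz
      rw [ENNReal.rpow_eq_zero_iff] at hz
      rcases hz with ⟨h, -⟩ | ⟨h, -⟩
      · exact h1.ne' h
      · exact hτ_fin _ _ h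
    simp only [Filter.eventually_false_iff_eq_bot, ae_eq_bot] at this
    exact IsProbabilityMeasure.ne_zero π this
  refine ⟨π, ⟨⟨?_, ?_⟩, ⟨⟨hπmem, ?_⟩, hchron⟩, fun _ => max M 0, fun _ => 0, measurable_const,
    measurable_const, integrable_const _, ?_⟩, Γ, hΓm, ?_, ?_, ?_⟩
  · refine lt_of_lt_of_le ?_ (le_ell hπmem)
    rw [EReal.coe_ennreal_pos]
    refine ENNReal.rpow_pos (pos_iff_ne_zero.2 hpos) ?_
    rw [hcost π hπmem]
    exact ENNReal.ofReal_ne_top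
  · refine lt_of_le_of_lt (ell_le (a := ((ENNReal.ofReal (∫ z, L.powCost p z ∂π) ^ (1 / p) :
      ℝ≥0∞) : EReal)) fun π' hπ' => ?_) ?_
    · rw [EReal.coe_ennreal_le_coe_ennreal_iff, hcost π' hπ']
      exact ENNReal.rpow_le_rpow
        (ENNReal.ofReal_le_ofReal (hopt π' hπ'.1 hπ'.2.1 hπ'.2.2.1)) (by positivity)
    · rw [lt_top_iff_ne_top, Ne, EReal.coe_ennreal_eq_top_iff]
      exact ENNReal.rpow_ne_top_of_nonneg (by positivity) ENNReal.ofReal_ne_top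
  · intro π' hπ'
    rw [hcost π' hπ', hcost π hπmem]
    exact ENNReal.ofReal_le_ofReal (hopt π' hπ'.1 hπ'.2.1 hπ'.2.2.1)
  · intro x hx y hy
    rw [ellPow_eq_coe hτ_fin hp.le (L.causal_of_chron _ _ (hch x hx y hy)), add_zero]
    exact_mod_cast (hM' (x, y) ⟨hx, hy⟩).2
  · intro n z hz
    have h1 : ∀ i j, L.ellPow p (z i).1 (z j).2
        = (L.powCost p ((z i).1, (z j).2) : EReal) := fun i j =>
      ellPow_eq_coe hτ_fin hp.le
        (L.causal_of_chron _ _ (hch _ (hΓs (hz i)).1 _ (hΓs (hz j)).2))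
    have hsum : ∀ f : Fin n → ℝ, ∑ i, (f i : EReal) = ((∑ i, f i : ℝ) : EReal) := fun f =>
      (map_sum (⟨⟨Real.toEReal, EReal.coe_zero⟩, EReal.coe_add⟩ : ℝ →+ EReal) f _).symm
    simp only [h1, hsum]
    exact_mod_cast hcyc n z hz
  · exact fun z hz => ⟨hch _ (hΓs hz).1 _ (hΓs hz).2, (hΓs hz).1, (hΓs hz).2⟩
  · intro π' hπ'
    rw [← hchar π' hπ'.1 hπ'.2.1 hπ'.2.2.1]
    constructor
    · intro h
      have := h.2 π hπmem
      rw [hcost π' hπ', hcost π hπmem] at this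
      exact (ENNReal.ofReal_le_ofReal_iff (hnn _)).1 this
    · intro h
      refine ⟨hπ', fun π'' hπ'' => ?_⟩
      rw [hcost π' hπ', hcost π'' hπ'']
      exact ENNReal.ofReal_le_ofReal ((hopt π'' hπ''.1 hπ''.2.1 hπ''.2.2.1).trans h)

end Dualisability

end LorentzianPreLengthSpace

/-! ### Limits of causal plans -/

section Limits

variable {Y : Type*} [MetricSpace Y] [MeasurableSpace Y] [BorelSpace Y]

/-- Probability measures on a common compact set converge along every ultrafilter. -/
lemma exists_tendsto_ultrafilter {ι : Type*} (𝒰 : Ultrafilter ι) (ν : ι → ProbabilityMeasure Y)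
    {C : Set Y} (hC : IsCompact C) (hν : ∀ i, (ν i : Measure Y) Cᶜ = 0) :
    ∃ μ : ProbabilityMeasure Y, Filter.Tendsto ν 𝒰 (𝓝 μ) := by
  have hcomp := isCompact_setOfPred_probabilityMeasure_mass_eq_compl_isCompact_le
    (E := Y) (u := fun _ => 0) (K := fun _ => C) tendsto_const_nhds (fun _ => hC)
    (Or.inr monotone_const)
  obtain ⟨μ, -, hμ⟩ := hcomp.ultrafilter_le_nhds' (𝒰.map ν)
    (Filter.mem_map.2 (Filter.univ_mem' fun i n => by
      simp only [nonpos_iff_eq_zero]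
      rw [ProbabilityMeasure.null_iff_toMeasure_null]
      exact hν i))
  exact ⟨μ, hμ⟩

/-- On a common compact set, weak convergence may be tested against unbounded continuous
functions. -/
lemma tendsto_integral_of_continuous {ι : Type*} {l : Filter ι} [l.NeBot]
    {ν : ι → ProbabilityMeasure Y} {μ : ProbabilityMeasure Y} (hlim : Filter.Tendsto ν l (𝓝 μ))
    {C : Set Y} (hC : IsCompact C) (hν : ∀ i, (ν i : Measure Y) Cᶜ = 0) {f : Y → ℝ}
    (hf : Continuous f) :
    Filter.Tendsto (fun i => ∫ y, f y ∂(ν i : Measure Y)) l (𝓝 (∫ y, f y ∂(μ : Measure Y))) := by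
  obtain ⟨B, hB⟩ := hC.exists_bound_of_continuousOn hf.continuousOn
  set M := max B 0
  let g : BoundedContinuousFunction Y ℝ := BoundedContinuousFunction.ofNormedAddCommGroup
    (fun x => max (-M) (min (f x) M)) (by fun_prop) M (fun x => by
      have : 0 ≤ M := le_max_right _ _
      rw [Real.norm_eq_abs, abs_le]
      exact ⟨le_max_left _ _, max_le (by linarith) (min_le_right _ _)⟩)
  have hfg : ∀ x ∈ C, g x = f x := by
    intro x hx
    have := abs_le.1 ((hB x hx).trans (le_max_left B 0))
    change max (-M) (min (f x) M) = f x
    rw [min_eq_left this.2, max_eq_right this.1]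
  have hcongr : ∀ η : Measure Y, η Cᶜ = 0 → ∫ y, g y ∂η = ∫ y, f y ∂η := by
    intro η hη
    have h0 : ∀ᵐ y ∂η, y ∈ C := hη
    exact integral_congr_ae (by filter_upwards [h0] with y hy using hfg y hy)
  have h := (ProbabilityMeasure.tendsto_iff_forall_integral_tendsto.1 hlim) g
  rw [hcongr _ (measure_compl_eq_zero_of_tendsto hlim hC.isClosed hν)] at h
  exact h.congr fun i => hcongr _ (hν i)

end Limits

namespace LorentzianPreLengthSpace

variable {X : Type*} [MetricSpace X] [ProperSpace X] {L : LorentzianPreLengthSpace X}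

/-- Compactness of causal diamonds makes the causal relation closed: if `xₙ ≤ yₙ`, `xₙ → x` and
`yₙ → y`, compactness of `J⁺({xₙ} ∪ {x}) ∩ J⁻({yₙ} ∪ {y})` yields `xₙ ≤ y` frequently or `x ≤ y`,
and in the first case compactness of `J⁺({xₙ} ∪ {x}) ∩ J⁻({y})` yields `x ≤ y`. -/
lemma isClosed_causal (hcomp : ∀ C₁ C₂ : Set X, IsCompact C₁ → IsCompact C₂ →
    IsCompact (L.causalFuture C₁ ∩ L.causalPast C₂)) :
    IsClosed {z : X × X | L.causal z.1 z.2} := by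
  refine IsSeqClosed.isClosed fun u z hu hz => ?_
  obtain ⟨x, y⟩ := z
  have hx : Filter.Tendsto (fun n => (u n).1) Filter.atTop (𝓝 x) :=
    (continuous_fst.tendsto _).comp hz
  have hy : Filter.Tendsto (fun n => (u n).2) Filter.atTop (𝓝 y) :=
    (continuous_snd.tendsto _).comp hz
  by_contra hxy
  simp only [mem_ofPred_eq] at hxy hu
  have hC₂ : IsCompact (insert y (range fun n => (u n).2)) := hy.isCompact_insert_range
  have hC₁ : ∀ k, IsCompact (insert x (range fun n => (u (n + k)).1)) := fun k =>
    ((Filter.tendsto_add_atTop_iff_nat k).2 hx).isCompact_insert_range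
  have hfreq : ∃ᶠ n in Filter.atTop, L.causal (u n).1 y := by
    rw [Filter.frequently_atTop]
    intro k
    have hmem : y ∈ L.causalFuture (insert x (range fun n => (u (n + k)).1)) ∩
        L.causalPast (insert y (range fun n => (u n).2)) := by
      refine (hcomp _ _ (hC₁ k) hC₂).isClosed.mem_of_tendsto
        ((Filter.tendsto_add_atTop_iff_nat k).2 hy) (Filter.Eventually.of_forall fun n => ?_)
      exact ⟨⟨_, mem_insert_of_mem _ ⟨n, rfl⟩, hu (n + k)⟩,
        ⟨_, mem_insert_of_mem _ ⟨n + k, rfl⟩, L.causal_refl _⟩⟩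
    obtain ⟨⟨a, ha, hay⟩, -⟩ := hmem
    rcases ha with rfl | ⟨n, rfl⟩
    · exact absurd hay hxy
    · exact ⟨n + k, Nat.le_add_left _ _, hay⟩
  have hclosed := (hcomp _ _ (hC₁ 0) (isCompact_singleton (x := y))).isClosed
  have hxmem : x ∈ closure (L.causalFuture (insert x (range fun n => (u (n + 0)).1)) ∩
      L.causalPast {y}) := by
    refine mem_closure_of_frequently_of_tendsto (hfreq.mono fun n hn => ?_) hx
    exact ⟨⟨_, mem_insert_of_mem _ ⟨n, rfl⟩, L.causal_refl _⟩, ⟨y, rfl, hn⟩⟩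
  rw [hclosed.closure_eq] at hxmem
  obtain ⟨-, ⟨b, hb, hxb⟩⟩ := hxmem
  rw [mem_singleton_iff] at hb
  exact hxy (hb ▸ hxb)

variable [MeasurableSpace X] [BorelSpace X]

/-- Stability of causal plans under weak convergence of the marginals on a compact set. -/
lemma exists_limit_plan (hcl : IsClosed {z : X × X | L.causal z.1 z.2}) {ι : Type*}
    (𝒰 : Ultrafilter ι) {μ ν : ι → ProbabilityMeasure X} {μ' ν' : ProbabilityMeasure X}
    (hμ : Filter.Tendsto μ 𝒰 (𝓝 μ')) (hν : Filter.Tendsto ν 𝒰 (𝓝 ν')) {C : Set X}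
    (hC : IsCompact C) (hμC : ∀ i, (μ i : Measure X) Cᶜ = 0) (hνC : ∀ i, (ν i : Measure X) Cᶜ = 0)
    {π : ι → Measure (X × X)} (hπ : ∀ i, π i ∈ L.causalPlans (μ i : Measure X) (ν i)) :
    ∃ π' ∈ L.causalPlans (μ' : Measure X) ν', ∀ f : X × X → ℝ, Continuous f →
      Filter.Tendsto (fun i => ∫ z, f z ∂(π i)) 𝒰 (𝓝 (∫ z, f z ∂π')) := by
  let P : ι → ProbabilityMeasure (X × X) := fun i => ⟨π i, (hπ i).1⟩
  have hPC : ∀ i, (P i : Measure (X × X)) (C ×ˢ C)ᶜ = 0 := fun i =>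
    measure_compl_prod_eq_zero (hπ i).2.1 (hπ i).2.2.1 hC.measurableSet hC.measurableSet
      (hμC i) (hνC i)
  obtain ⟨P', hP'⟩ := exists_tendsto_ultrafilter 𝒰 P (hC.prod hC) hPC
  refine ⟨P', ⟨P'.2, ?_, ?_, ?_⟩, fun f hf =>
    tendsto_integral_of_continuous hP' (hC.prod hC) hPC hf⟩
  · have h1 := ProbabilityMeasure.tendsto_map_of_tendsto_of_continuous P P' hP' continuous_fst
    have h2 : (fun i => (P i).map (continuous_fst (X := X) (Y := X)).measurable.aemeasurable)
        = μ := by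
      funext i
      exact Subtype.ext (hπ i).2.1
    rw [h2] at h1
    have h3 := tendsto_nhds_unique h1 hμ
    exact congrArg Subtype.val h3
  · have h1 := ProbabilityMeasure.tendsto_map_of_tendsto_of_continuous P P' hP' continuous_snd
    have h2 : (fun i => (P i).map (continuous_snd (X := X) (Y := X)).measurable.aemeasurable)
        = ν := by
      funext i
      exact Subtype.ext (hπ i).2.2.1
    rw [h2] at h1
    have h3 := tendsto_nhds_unique h1 hν
    exact congrArg Subtype.val h3
  · exact measure_compl_eq_zero_of_tendsto hP' hcl fun i => (hπ i).2.2.2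

end LorentzianPreLengthSpace

/-! ### Equality in the reverse Minkowski inequality -/

section ReverseMinkowski

/-- Concavity of `x ↦ x^p` with weights `a, b`; it becomes the reverse Minkowski inequality after
integration and optimization over `a`. -/
lemma weighted_rpow_le {p a b f g h : ℝ} (hp : p ∈ Ioo (0 : ℝ) 1) (ha : 0 < a) (hb : 0 < b)
    (hab : a + b = 1) (hf : 0 ≤ f) (hg : 0 ≤ g) (hfg : f + g ≤ h) :
    a * (f / a) ^ p + b * (g / b) ^ p ≤ h ^ p := by
  have h1 := (Real.strictConcaveOn_rpow hp.1 hp.2).concaveOn.2 (x := f / a) (y := g / b)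
    (div_nonneg hf ha.le) (div_nonneg hg hb.le) ha.le hb.le hab
  simp only [smul_eq_mul, mul_div_cancel₀ _ ha.ne', mul_div_cancel₀ _ hb.ne'] at h1
  exact h1.trans (Real.rpow_le_rpow (add_nonneg hf hg) hfg hp.1.le)

lemma eq_mul_of_weighted_rpow_eq {p a b f g h : ℝ} (hp : p ∈ Ioo (0 : ℝ) 1) (ha : 0 < a)
    (hb : 0 < b) (hab : a + b = 1) (hf : 0 ≤ f) (hg : 0 ≤ g) (hfg : f + g ≤ h)
    (heq : a * (f / a) ^ p + b * (g / b) ^ p = h ^ p) : f = a * h ∧ g = b * h := by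
  have hsum : f + g = h := by
    by_contra hne
    have hlt := lt_of_le_of_ne hfg hne
    have h1 := weighted_rpow_le hp ha hb hab hf hg le_rfl
    have h2 := Real.rpow_lt_rpow (add_nonneg hf hg) hlt hp.1
    linarith
  have hq : f / a = g / b := by
    by_contra hne
    have h1 := (Real.strictConcaveOn_rpow hp.1 hp.2).2 (x := f / a) (y := g / b)
      (div_nonneg hf ha.le) (div_nonneg hg hb.le) hne ha hb hab
    simp only [smul_eq_mul, mul_div_cancel₀ _ ha.ne', mul_div_cancel₀ _ hb.ne'] at h1
    rw [hsum, heq] at h1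
    exact lt_irrefl _ h1
  rw [div_eq_div_iff ha.ne' hb.ne'] at hq
  subst hsum
  have hb' : b = 1 - a := by linarith
  subst hb'
  constructor <;> linarith

variable {Ω : Type*} [MeasurableSpace Ω] {π : Measure Ω} {p a b : ℝ} {f g h : Ω → ℝ}

lemma integral_weighted_rpow (ha : 0 < a) (hb : 0 < b) (hf : ∀ z, 0 ≤ f z) (hg : ∀ z, 0 ≤ g z)
    (hfi : Integrable (fun z => f z ^ p) π) (hgi : Integrable (fun z => g z ^ p) π) :
    Integrable (fun z => a * (f z / a) ^ p + b * (g z / b) ^ p) π ∧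
    ∫ z, (a * (f z / a) ^ p + b * (g z / b) ^ p) ∂π
      = a * ((∫ z, f z ^ p ∂π) / a ^ p) + b * ((∫ z, g z ^ p ∂π) / b ^ p) := by
  have h1 : ∀ z, a * (f z / a) ^ p + b * (g z / b) ^ p
      = a * (f z ^ p / a ^ p) + b * (g z ^ p / b ^ p) := fun z => by
    rw [Real.div_rpow (hf z) ha.le, Real.div_rpow (hg z) hb.le]
  simp only [h1]
  have i1 := (hfi.div_const (a ^ p)).const_mul a
  have i2 := (hgi.div_const (b ^ p)).const_mul b
  refine ⟨i1.add i2, ?_⟩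
  rw [integral_add i1 i2, integral_const_mul, integral_const_mul, integral_div, integral_div]

lemma integral_rpow_le_of_add_le (hp : p ∈ Ioo (0 : ℝ) 1) (ha : 0 < a) (hb : 0 < b)
    (hab : a + b = 1) (hf : ∀ z, 0 ≤ f z) (hg : ∀ z, 0 ≤ g z)
    (hfi : Integrable (fun z => f z ^ p) π) (hgi : Integrable (fun z => g z ^ p) π)
    (hhi : Integrable (fun z => h z ^ p) π) (hfg : ∀ᵐ z ∂π, f z + g z ≤ h z)
    (hgb : b ^ p * ∫ z, h z ^ p ∂π ≤ ∫ z, g z ^ p ∂π) :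
    ∫ z, f z ^ p ∂π ≤ a ^ p * ∫ z, h z ^ p ∂π := by
  obtain ⟨hi, he⟩ := integral_weighted_rpow (π := π) (p := p) ha hb hf hg hfi hgi
  have h1 : ∫ z, (a * (f z / a) ^ p + b * (g z / b) ^ p) ∂π ≤ ∫ z, h z ^ p ∂π :=
    integral_mono_ae hi hhi (by
      filter_upwards [hfg] with z hz using weighted_rpow_le hp ha hb hab (hf z) (hg z) hz)
  rw [he] at h1
  have hap := Real.rpow_pos_of_pos ha p
  have hbp := Real.rpow_pos_of_pos hb p
  have h2 : b * ∫ z, h z ^ p ∂π ≤ b * ((∫ z, g z ^ p ∂π) / b ^ p) := by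
    gcongr
    rw [le_div_iff₀ hbp]
    linarith
  have h3 : a * ((∫ z, f z ^ p ∂π) / a ^ p) ≤ a * ∫ z, h z ^ p ∂π := by
    have hH : a * ∫ z, h z ^ p ∂π + b * ∫ z, h z ^ p ∂π = ∫ z, h z ^ p ∂π := by
      rw [← add_mul, hab, one_mul]
    linarith
  have h4 := le_of_mul_le_mul_left h3 ha
  rw [div_le_iff₀ hap] at h4
  linarith

/-- The equality case of the reverse Minkowski inequality for `0 < p < 1`. -/
lemma ae_eq_mul_of_le_integral_rpow (hp : p ∈ Ioo (0 : ℝ) 1) (ha : 0 < a) (hb : 0 < b)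
    (hab : a + b = 1) (hf : ∀ z, 0 ≤ f z) (hg : ∀ z, 0 ≤ g z)
    (hfi : Integrable (fun z => f z ^ p) π) (hgi : Integrable (fun z => g z ^ p) π)
    (hhi : Integrable (fun z => h z ^ p) π) (hfg : ∀ᵐ z ∂π, f z + g z ≤ h z)
    (hfa : a ^ p * ∫ z, h z ^ p ∂π ≤ ∫ z, f z ^ p ∂π)
    (hgb : b ^ p * ∫ z, h z ^ p ∂π ≤ ∫ z, g z ^ p ∂π) :
    ∀ᵐ z ∂π, f z = a * h z ∧ g z = b * h z := by
  obtain ⟨hi, he⟩ := integral_weighted_rpow (π := π) (p := p) ha hb hf hg hfi hgi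
  have hap := Real.rpow_pos_of_pos ha p
  have hbp := Real.rpow_pos_of_pos hb p
  have hnn : 0 ≤ᵐ[π] fun z => h z ^ p - (a * (f z / a) ^ p + b * (g z / b) ^ p) := by
    filter_upwards [hfg] with z hz
    exact sub_nonneg.2 (weighted_rpow_le hp ha hb hab (hf z) (hg z) hz)
  have hzero : ∫ z, (h z ^ p - (a * (f z / a) ^ p + b * (g z / b) ^ p)) ∂π = 0 := by
    refine le_antisymm ?_ (integral_nonneg_of_ae hnn)
    rw [integral_sub hhi hi, he]
    have h1 : a * ∫ z, h z ^ p ∂π ≤ a * ((∫ z, f z ^ p ∂π) / a ^ p) := by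
      gcongr
      rw [le_div_iff₀ hap]
      linarith
    have h2 : b * ∫ z, h z ^ p ∂π ≤ b * ((∫ z, g z ^ p ∂π) / b ^ p) := by
      gcongr
      rw [le_div_iff₀ hbp]
      linarith
    have hH : a * ∫ z, h z ^ p ∂π + b * ∫ z, h z ^ p ∂π = ∫ z, h z ^ p ∂π := by
      rw [← add_mul, hab, one_mul]
    linarith
  rw [integral_eq_zero_iff_of_nonneg_ae hnn (hhi.sub hi)] at hzero
  filter_upwards [hzero, hfg] with z hz hz'
  exact eq_mul_of_weighted_rpow_eq hp ha hb hab (hf z) (hg z) hz' (sub_eq_zero.1 hz).symm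

end ReverseMinkowski

/-! ### Geodesics ending in a Dirac mass do not depend on the exponent -/

namespace LorentzianPreLengthSpace

section Exponent

variable {X : Type*} [MetricSpace X] [ProperSpace X] {L : LorentzianPreLengthSpace X}

lemma toReal_τ_add_le (hτ_fin : ∀ x y, L.τ x y ≠ ⊤) {x y z : X} (hxy : L.causal x y)
    (hyz : L.causal y z) : (L.τ x y).toReal + (L.τ y z).toReal ≤ (L.τ x z).toReal := by
  rw [← ENNReal.toReal_add (hτ_fin _ _) (hτ_fin _ _)]
  exact ENNReal.toReal_mono (hτ_fin _ _) (L.reverse_triangle x y z hxy hyz)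

variable [MeasurableSpace X]

lemma ell_eq_coe (hτ_fin : ∀ x y, L.τ x y ≠ ⊤) {q : ℝ} (hq : 0 < q) {μ ν : Measure X}
    (hi : ∀ π ∈ L.causalPlans μ ν, Integrable (L.powCost q) π) {U : ℝ}
    (hle : ∀ π ∈ L.causalPlans μ ν, ∫ z, L.powCost q z ∂π ≤ U)
    (hge : ∃ π ∈ L.causalPlans μ ν, U ≤ ∫ z, L.powCost q z ∂π) :
    L.ell q μ ν = ((U ^ (1 / q) : ℝ) : EReal) := by
  have hq' : 0 ≤ 1 / q := by positivity
  obtain ⟨π₀, hπ₀, hU⟩ := hge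
  have hU' : U = ∫ z, L.powCost q z ∂π₀ := le_antisymm hU (hle _ hπ₀)
  have hU0 : 0 ≤ U := hU' ▸ integral_nonneg fun z => powCost_nonneg q z
  have key : ∀ π ∈ L.causalPlans μ ν, ((L.cost q π ^ (1 / q) : ℝ≥0∞) : EReal)
      = (((∫ z, L.powCost q z ∂π) ^ (1 / q) : ℝ) : EReal) := by
    intro π hπ
    have h0 : 0 ≤ ∫ z, L.powCost q z ∂π := integral_nonneg fun z => powCost_nonneg q z
    rw [cost_eq_ofReal hτ_fin hq.le (hi π hπ), ENNReal.ofReal_rpow_of_nonneg h0 hq',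
      EReal.coe_ennreal_ofReal, max_eq_left (Real.rpow_nonneg h0 _)]
  apply le_antisymm
  · refine ell_le fun π hπ => ?_
    rw [key π hπ]
    have h0 : 0 ≤ ∫ z, L.powCost q z ∂π := integral_nonneg fun z => powCost_nonneg q z
    exact_mod_cast Real.rpow_le_rpow h0 (hle π hπ) hq'
  · refine le_trans (le_of_eq ?_) (le_ell hπ₀)
    rw [key π₀ hπ₀, ← hU']

lemma exists_plan_of_lt_ell (hτ_fin : ∀ x y, L.τ x y ≠ ⊤) {p : ℝ} (hp : 0 < p) {μ ν : Measure X}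
    (hi : ∀ π ∈ L.causalPlans μ ν, Integrable (L.powCost p) π) {v : ℝ}
    (hv : (v : EReal) < L.ell p μ ν) :
    ∃ π ∈ L.causalPlans μ ν, v < (∫ z, L.powCost p z ∂π) ^ (1 / p) := by
  rw [ell] at hv
  obtain ⟨π, hπ⟩ := lt_iSup_iff.1 hv
  obtain ⟨hπ', hlt⟩ := lt_iSup_iff.1 hπ
  refine ⟨π, hπ', ?_⟩
  have h0 : 0 ≤ ∫ z, L.powCost p z ∂π := integral_nonneg fun z => powCost_nonneg p z
  rw [cost_eq_ofReal hτ_fin hp.le (hi π hπ'), ENNReal.ofReal_rpow_of_nonneg h0 (by positivity),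
    EReal.coe_ennreal_ofReal, max_eq_left (Real.rpow_nonneg h0 _)] at hlt
  exact_mod_cast hlt

variable [BorelSpace X]

/-- A family ending in `δ_{x₁}` with plans that realize at least the distances of an `ℓ_p`-geodesic
is an `ℓ_q`-geodesic for every `q ∈ (0,1)`. With `r = τ(·, x₁)`, a plan between times `s` and `t`
satisfies `τ(x,y) + r(y) ≤ r(x)`, and the assumption forces equality in the reverse Minkowski
inequality for these functions; hence `τ(x,y)` and `r(y)` are proportional to `r(x)`, a property
that does not involve the exponent. -/
theorem isEllGeodesic_of_plans (hτ_fin : ∀ x y, L.τ x y ≠ ⊤)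
    (hτ_cont : Continuous (fun z : X × X => L.τ z.1 z.2))
    (hcl : IsClosed {z : X × X | L.causal z.1 z.2}) {p q : ℝ} (hp : p ∈ Ioo (0 : ℝ) 1)
    (hq : q ∈ Ioo (0 : ℝ) 1) {μ : ℝ → Measure X} {x₁ : X}
    (hμ : ∀ t ∈ Icc (0 : ℝ) 1, IsProbabilityMeasure (μ t)) (hμ1 : μ 1 = Measure.dirac x₁)
    {C : Set X} (hC : IsCompact C) (hμC : ∀ t ∈ Icc (0 : ℝ) 1, μ t Cᶜ = 0)
    (hplan : ∀ s ∈ Icc (0 : ℝ) 1, ∀ t ∈ Icc (0 : ℝ) 1, s ≤ t → ∃ π ∈ L.causalPlans (μ s) (μ t),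
      (t - s) ^ p * ∫ x, (L.τ x x₁).toReal ^ p ∂(μ 0) ≤ ∫ z, L.powCost p z ∂π) :
    L.IsEllGeodesic q μ := by
  have h0mem : (0 : ℝ) ∈ Icc (0 : ℝ) 1 := ⟨le_rfl, zero_le_one⟩
  have h1mem : (1 : ℝ) ∈ Icc (0 : ℝ) 1 := ⟨zero_le_one, le_rfl⟩
  set r : X → ℝ := fun x => (L.τ x x₁).toReal with hr
  have hrc : Continuous r := (continuous_toReal_τ hτ_fin hτ_cont).comp
    (continuous_id.prodMk continuous_const)
  have hr0 : ∀ x, 0 ≤ r x := fun x => ENNReal.toReal_nonneg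
  have hT0 : ∀ z : X × X, 0 ≤ (L.τ z.1 z.2).toReal := fun z => ENNReal.toReal_nonneg
  have hpow : ∀ o : ℝ, ∀ z : X × X, L.powCost o z = (L.τ z.1 z.2).toReal ^ o := fun o z => rfl
  have hint1 : ∀ {s t : ℝ}, s ∈ Icc (0 : ℝ) 1 → t ∈ Icc (0 : ℝ) 1 →
      ∀ π ∈ L.causalPlans (μ s) (μ t), ∀ f : X × X → ℝ, Continuous f → Integrable f π := by
    intro s t hs ht π hπ f hf
    have hS := measure_compl_prod_eq_zero hπ.2.1 hπ.2.2.1 hC.measurableSet hC.measurableSet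
      (hμC s hs) (hμC t ht)
    have hS' : ∀ᵐ z ∂π, z ∈ C ×ˢ C := hS
    obtain ⟨B, hB⟩ := (hC.prod hC).exists_bound_of_continuousOn hf.continuousOn
    have := hπ.1
    exact Integrable.of_bound hf.aestronglyMeasurable B (by
      filter_upwards [hS'] with z hz using hB z hz)
  have hTc : ∀ {o : ℝ}, 0 < o → Continuous fun z : X × X => (L.τ z.1 z.2).toReal ^ o :=
    fun ho => continuous_powCost hτ_fin hτ_cont ho.le
  have hfc : ∀ {o : ℝ}, 0 < o → Continuous fun z : X × X => r z.1 ^ o :=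
    fun ho => (hrc.comp continuous_fst).rpow_const fun _ => Or.inr ho.le
  have hsc : ∀ {o : ℝ}, 0 < o → Continuous fun z : X × X => r z.2 ^ o :=
    fun ho => (hrc.comp continuous_snd).rpow_const fun _ => Or.inr ho.le
  have hfst : ∀ {s t : ℝ}, ∀ π ∈ L.causalPlans (μ s) (μ t), ∀ {o : ℝ}, 0 < o →
      ∫ z, r z.1 ^ o ∂π = ∫ x, r x ^ o ∂(μ s) := by
    intro s t π hπ o ho
    rw [← hπ.2.1, integral_map measurable_fst.aemeasurable]
    exact (hrc.rpow_const fun _ => Or.inr ho.le).aestronglyMeasurable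
  have hsnd : ∀ {s t : ℝ}, ∀ π ∈ L.causalPlans (μ s) (μ t), ∀ {o : ℝ}, 0 < o →
      ∫ z, r z.2 ^ o ∂π = ∫ x, r x ^ o ∂(μ t) := by
    intro s t π hπ o ho
    rw [← hπ.2.2.1, integral_map measurable_snd.aemeasurable]
    exact (hrc.rpow_const fun _ => Or.inr ho.le).aestronglyMeasurable
  have hdirac : ∀ {s : ℝ}, ∀ π ∈ L.causalPlans (μ s) (μ 1), ∀ᵐ z ∂π, z.2 = x₁ := by
    intro s π hπ
    have h1 : ∀ᵐ y ∂(π.map Prod.snd), y = x₁ := by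
      rw [hπ.2.2.1, hμ1]
      exact (ae_dirac_iff (measurableSet_singleton x₁)).2 rfl
    exact ae_of_ae_map measurable_snd.aemeasurable h1
  have hcost1 : ∀ {s : ℝ}, ∀ π ∈ L.causalPlans (μ s) (μ 1), ∀ {o : ℝ}, 0 < o →
      ∫ z, (L.τ z.1 z.2).toReal ^ o ∂π = ∫ x, r x ^ o ∂(μ s) := by
    intro s π hπ o ho
    rw [← hfst π hπ ho]
    refine integral_congr_ae ?_
    filter_upwards [hdirac π hπ] with z hz
    simp only [hr, hz]
  have hcausal1 : ∀ s ∈ Icc (0 : ℝ) 1, ∀ᵐ x ∂(μ s), L.causal x x₁ := by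
    intro s hs
    obtain ⟨π, hπ, -⟩ := hplan s hs 1 h1mem hs.2
    have h1 : ∀ᵐ z ∂π, L.causal z.1 x₁ := by
      filter_upwards [hdirac π hπ, hπ.2.2.2] with z hz hz'
      rwa [hz] at hz'
    have hm : MeasurableSet {x | L.causal x x₁} :=
      (hcl.preimage (f := fun x => (x, x₁)) (by fun_prop)).measurableSet
    have h2 := (ae_map_iff measurable_fst.aemeasurable hm).2 h1
    rwa [hπ.2.1] at h2
  have htri : ∀ {s t : ℝ}, t ∈ Icc (0 : ℝ) 1 → ∀ π ∈ L.causalPlans (μ s) (μ t),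
      ∀ᵐ z ∂π, (L.τ z.1 z.2).toReal + r z.2 ≤ r z.1 := by
    intro s t ht π hπ
    have h1 := hcausal1 t ht
    rw [← hπ.2.2.1] at h1
    filter_upwards [hπ.2.2.2, ae_of_ae_map measurable_snd.aemeasurable h1] with z hz hz'
    exact toReal_τ_add_le hτ_fin hz hz'
  -- a plan into the Dirac mass has cost `∫ r ^ p`, so `hplan` with `t = 1` bounds this from below
  have hR : ∀ s ∈ Icc (0 : ℝ) 1, (1 - s) ^ p * ∫ x, r x ^ p ∂(μ 0) ≤ ∫ x, r x ^ p ∂(μ s) := by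
    intro s hs
    obtain ⟨π, hπ, hle⟩ := hplan s hs 1 h1mem hs.2
    rw [← hcost1 π hπ hp.1]
    exact hle
  -- the law of `r` under `μ t` is the law under `μ 0` scaled by `1 - t`
  have hscale : ∀ t ∈ Ico (0 : ℝ) 1, ∀ o : ℝ, 0 < o →
      ∫ x, r x ^ o ∂(μ t) = (1 - t) ^ o * ∫ x, r x ^ o ∂(μ 0) := by
    intro t ht o ho
    have htm := Ico_subset_Icc_self ht
    rcases eq_or_lt_of_le ht.1 with h | h
    · subst h; simp
    obtain ⟨π, hπ, hle⟩ := hplan 0 h0mem t htm ht.1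
    have hRt := hR t htm
    rw [← hfst π hπ hp.1] at hle hRt
    rw [← hsnd π hπ hp.1] at hRt
    rw [sub_zero] at hle
    have hae := ae_eq_mul_of_le_integral_rpow (π := π) (f := fun z => (L.τ z.1 z.2).toReal)
      (g := fun z => r z.2) (h := fun z => r z.1) hp h (by linarith [ht.2] : (0 : ℝ) < 1 - t)
      (by ring) hT0 (fun z => hr0 _) (hint1 h0mem htm π hπ _ (hTc hp.1))
      (hint1 h0mem htm π hπ _ (hsc hp.1)) (hint1 h0mem htm π hπ _ (hfc hp.1))
      (htri htm π hπ) hle hRt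
    rw [← hsnd π hπ ho, ← hfst π hπ ho, ← integral_const_mul]
    refine integral_congr_ae ?_
    filter_upwards [hae] with z hz
    rw [hz.2, Real.mul_rpow (by linarith [ht.2]) (hr0 _)]
  -- equality in the reverse Minkowski inequality between the times `s` and `t`
  have hprop : ∀ s t : ℝ, 0 ≤ s → s < t → t < 1 → ∃ π ∈ L.causalPlans (μ s) (μ t),
      ∀ᵐ z ∂π, (L.τ z.1 z.2).toReal = (t - s) / (1 - s) * r z.1 := by
    intro s t h0s hst ht1
    have hsm : s ∈ Icc (0 : ℝ) 1 := ⟨h0s, (hst.trans ht1).le⟩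
    have htm : t ∈ Icc (0 : ℝ) 1 := ⟨h0s.trans hst.le, ht1.le⟩
    have h1s : 0 < 1 - s := by linarith
    have h1t : 0 < 1 - t := by linarith
    have hts : 0 < t - s := by linarith
    obtain ⟨π, hπ, hle⟩ := hplan s hsm t htm hst.le
    have hsc' := hscale s ⟨h0s, hst.trans ht1⟩ p hp.1
    refine ⟨π, hπ, ?_⟩
    have hae := ae_eq_mul_of_le_integral_rpow (π := π) (f := fun z => (L.τ z.1 z.2).toReal)
      (g := fun z => r z.2) (h := fun z => r z.1) hp (a := (t - s) / (1 - s))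
      (b := (1 - t) / (1 - s)) (by positivity) (by positivity)
      (by field_simp; ring) hT0 (fun z => hr0 _) (hint1 hsm htm π hπ _ (hTc hp.1))
      (hint1 hsm htm π hπ _ (hsc hp.1)) (hint1 hsm htm π hπ _ (hfc hp.1))
      (htri htm π hπ) (by
        rw [hfst π hπ hp.1, hsc', ← mul_assoc, ← Real.mul_rpow (by positivity) h1s.le,
          div_mul_cancel₀ _ h1s.ne']
        exact hle) (by
        rw [hfst π hπ hp.1, hsnd π hπ hp.1, hsc', ← mul_assoc,
          ← Real.mul_rpow (by positivity) h1s.le, div_mul_cancel₀ _ h1s.ne']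
        exact hR t htm)
    filter_upwards [hae] with z hz using hz.1
  set Rq := ∫ x, r x ^ q ∂(μ 0) with hRq
  have hRq0 : 0 ≤ Rq := integral_nonneg fun x => Real.rpow_nonneg (hr0 x) _
  -- `hprop` provides a plan of cost `(t - s)^q * Rq`, and the reverse Minkowski inequality for the
  -- exponent `q` shows that no plan does better
  have hell : ∀ s ∈ Icc (0 : ℝ) 1, ∀ t ∈ Icc (0 : ℝ) 1, s ≤ t →
      L.ell q (μ s) (μ t) = (((t - s) * Rq ^ (1 / q) : ℝ) : EReal) := by
    intro s hs t ht hst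
    have hval : ((t - s) ^ q * Rq) ^ (1 / q) = (t - s) * Rq ^ (1 / q) := by
      have hts : 0 ≤ t - s := by linarith
      rw [Real.mul_rpow (Real.rpow_nonneg hts _) hRq0, ← Real.rpow_mul hts,
        mul_one_div_cancel hq.1.ne', Real.rpow_one]
    rw [← hval]
    have hi : ∀ π ∈ L.causalPlans (μ s) (μ t), Integrable (L.powCost q) π := fun π hπ =>
      hint1 hs ht π hπ _ (hTc hq.1)
    rcases eq_or_lt_of_le ht.2 with h1 | h1
    · subst h1
      have hs1 : ∫ x, r x ^ q ∂(μ s) = (1 - s) ^ q * Rq := by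
        rcases eq_or_lt_of_le hs.2 with h | h
        · subst h
          have hz : r x₁ = 0 := by
            have h1 := toReal_τ_add_le hτ_fin (L.causal_refl x₁) (L.causal_refl x₁)
            exact le_antisymm (by simp only [hr]; linarith) (hr0 _)
          rw [hμ1, integral_dirac, hz, sub_self, Real.zero_rpow hq.1.ne', zero_mul]
        · exact hscale s ⟨hs.1, h⟩ q hq.1
      refine ell_eq_coe hτ_fin hq.1 hi (fun π hπ => ?_) ?_
      · rw [← hs1, ← hcost1 π hπ hq.1]
        exact le_rfl
      · obtain ⟨π, hπ, -⟩ := hplan s hs 1 ht hst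
        refine ⟨π, hπ, ?_⟩
        rw [← hs1, ← hcost1 π hπ hq.1]
        exact le_rfl
    · have hs1 := hst.trans_lt h1
      have h1s : 0 < 1 - s := by linarith
      have h1t : 0 < 1 - t := by linarith
      have hscs := hscale s ⟨hs.1, hs1⟩ q hq.1
      have hsct := hscale t ⟨ht.1, h1⟩ q hq.1
      rcases eq_or_lt_of_le hst with h2 | h2
      · subst h2
        rw [sub_self, Real.zero_rpow hq.1.ne', zero_mul]
        refine ell_eq_coe hτ_fin hq.1 hi (fun π hπ => ?_) ?_
        · have e1 : ∫ z, (r z.1 ^ q - r z.2 ^ q) ∂π = 0 := by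
            rw [integral_sub (hint1 hs hs π hπ _ (hfc hq.1)) (hint1 hs hs π hπ _ (hsc hq.1)),
              hfst π hπ hq.1, hsnd π hπ hq.1, sub_self]
          have hnn : 0 ≤ᵐ[π] fun z => r z.1 ^ q - r z.2 ^ q := by
            filter_upwards [htri hs π hπ] with z hz
            exact sub_nonneg.2 (Real.rpow_le_rpow (hr0 _) (by linarith [hT0 z]) hq.1.le)
          rw [integral_eq_zero_iff_of_nonneg_ae hnn ((hint1 hs hs π hπ _ (hfc hq.1)).sub
            (hint1 hs hs π hπ _ (hsc hq.1)))] at e1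
          refine le_of_eq (integral_eq_zero_of_ae ?_)
          filter_upwards [e1, htri hs π hπ] with z hz hz'
          have h3 : r z.1 = r z.2 :=
            (Real.rpow_left_inj (hr0 _) (hr0 _) hq.1.ne').1 (sub_eq_zero.1 hz)
          have h4 : (L.τ z.1 z.2).toReal = 0 := le_antisymm (by linarith) (hT0 z)
          rw [hpow, h4, Real.zero_rpow hq.1.ne', Pi.zero_apply]
        · obtain ⟨π, hπ, -⟩ := hplan s hs s hs le_rfl
          exact ⟨π, hπ, integral_nonneg fun z => powCost_nonneg q z⟩
      · have hts : 0 < t - s := by linarith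
        have hab : (t - s) ^ q * Rq = ((t - s) / (1 - s)) ^ q * ∫ x, r x ^ q ∂(μ s) := by
          rw [hscs, ← mul_assoc, ← Real.mul_rpow (by positivity) h1s.le,
            div_mul_cancel₀ _ h1s.ne']
        rw [hab]
        refine ell_eq_coe hτ_fin hq.1 hi (fun π hπ => ?_) ?_
        · have := integral_rpow_le_of_add_le (π := π) (f := fun z => (L.τ z.1 z.2).toReal)
            (g := fun z => r z.2) (h := fun z => r z.1) hq (a := (t - s) / (1 - s))
            (b := (1 - t) / (1 - s)) (by positivity) (by positivity)
            (by field_simp; ring) hT0 (fun z => hr0 _) (hint1 hs ht π hπ _ (hTc hq.1))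
            (hint1 hs ht π hπ _ (hsc hq.1)) (hint1 hs ht π hπ _ (hfc hq.1))
            (htri ht π hπ) (by
              rw [hfst π hπ hq.1, hsnd π hπ hq.1, hscs, hsct, ← mul_assoc,
                ← Real.mul_rpow (by positivity) h1s.le, div_mul_cancel₀ _ h1s.ne'])
          rw [hfst π hπ hq.1] at this
          exact this
        · obtain ⟨π, hπ, hae⟩ := hprop s t hs.1 h2 h1
          refine ⟨π, hπ, le_of_eq ?_⟩
          rw [← hfst π hπ hq.1, ← integral_const_mul]
          refine integral_congr_ae ?_
          filter_upwards [hae] with z hz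
          rw [hpow, hz, Real.mul_rpow (by positivity) (hr0 _)]
  refine ⟨hμ, fun s hs t ht hst => ?_⟩
  rw [hell s hs t ht hst, hell 0 h0mem 1 h1mem zero_le_one, sub_zero, one_mul, EReal.coe_mul]

end Exponent

end LorentzianPreLengthSpace

/-! ### Distortion coefficients -/

lemma tendsto_genSin_left {κ₀ : ℝ} (h0 : κ₀ ≠ 0) (ϑ : ℝ) :
    Filter.Tendsto (fun κ => genSin κ ϑ) (𝓝 κ₀) (𝓝 (genSin κ₀ ϑ)) := by
  rcases lt_or_gt_of_ne h0 with h | h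
  · have hne : √(-κ₀) ≠ 0 := (Real.sqrt_pos.2 (by linarith)).ne'
    have hc : ContinuousAt (fun κ => Real.sinh (√(-κ) * ϑ) / √(-κ)) κ₀ := by
      refine ContinuousAt.div ?_ (by fun_prop) hne
      exact Real.continuous_sinh.continuousAt.comp (by fun_prop)
    have hev : (fun κ => genSin κ ϑ) =ᶠ[𝓝 κ₀] fun κ => Real.sinh (√(-κ) * ϑ) / √(-κ) := by
      filter_upwards [Iio_mem_nhds h] with κ hκ
      rw [genSin, if_neg (not_lt.2 (le_of_lt hκ)), if_neg (ne_of_lt hκ)]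
    exact hc.congr_of_eventuallyEq hev
  · have hne : √κ₀ ≠ 0 := (Real.sqrt_pos.2 h).ne'
    have hc : ContinuousAt (fun κ => Real.sin (√κ * ϑ) / √κ) κ₀ := by
      refine ContinuousAt.div ?_ (by fun_prop) hne
      exact Real.continuous_sin.continuousAt.comp (by fun_prop)
    have hev : (fun κ => genSin κ ϑ) =ᶠ[𝓝 κ₀] fun κ => Real.sin (√κ * ϑ) / √κ := by
      filter_upwards [Ioi_mem_nhds h] with κ hκ
      have hκ' : 0 < κ := hκ
      rw [genSin, if_pos hκ']
    exact hc.congr_of_eventuallyEq hev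

lemma genSin_mul {κ ϑ : ℝ} (hϑ : 0 < ϑ) (t : ℝ) :
    genSin κ (t * ϑ) = ϑ * genSin (κ * ϑ ^ 2) t := by
  have h2 : 0 < ϑ ^ 2 := by positivity
  unfold genSin
  rcases lt_trichotomy κ 0 with h | h | h
  · have h' : κ * ϑ ^ 2 < 0 := mul_neg_of_neg_of_pos h h2
    have hs : √(-κ) ≠ 0 := (Real.sqrt_pos.2 (by linarith)).ne'
    rw [if_neg h.le.not_gt, if_neg h.ne, if_neg h'.le.not_gt, if_neg h'.ne, ← neg_mul,
      Real.sqrt_mul (by linarith), Real.sqrt_sq hϑ.le]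
    field_simp
  · subst h; simp [mul_comm]
  · have h' : 0 < κ * ϑ ^ 2 := mul_pos h h2
    have hs : √κ ≠ 0 := (Real.sqrt_pos.2 h).ne'
    rw [if_pos h, if_pos h', Real.sqrt_mul h.le, Real.sqrt_sq hϑ.le]
    field_simp

lemma genSin_pi_sq_one : genSin (Real.pi ^ 2) 1 = 0 := by
  rw [genSin, if_pos (by positivity), Real.sqrt_sq Real.pi_pos.le]
  simp

lemma genSin_pi_sq_pos {t : ℝ} (ht : t ∈ Ioo (0 : ℝ) 1) : 0 < genSin (Real.pi ^ 2) t := by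
  rw [genSin, if_pos (by positivity), Real.sqrt_sq Real.pi_pos.le]
  refine div_pos (Real.sin_pos_of_pos_of_lt_pi (mul_pos Real.pi_pos ht.1) ?_) Real.pi_pos
  nlinarith [ht.2, Real.pi_pos]

/-- The comparison inequality for all parameters below `κ` forces `κ < π²`: at `π²` its right-hand
side vanishes while its left-hand side is positive. -/
lemma lt_pi_sq_of_comparison {κ u v t : ℝ} (ht : t ∈ Ioo (0 : ℝ) 1) (hu : 0 < u)
    (h : ∀ κ' < κ, κ' < Real.pi ^ 2 → u * genSin κ' (1 - t) ≤ v * genSin κ' 1) :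
    κ < Real.pi ^ 2 := by
  by_contra hge
  rw [not_lt] at hge
  have hpi : Real.pi ^ 2 ≠ 0 := by positivity
  have l1 := ((tendsto_genSin_left hpi (1 - t)).const_mul u).mono_left
    (nhdsWithin_le_nhds (s := Iio (Real.pi ^ 2)))
  have l2 := ((tendsto_genSin_left hpi 1).const_mul v).mono_left
    (nhdsWithin_le_nhds (s := Iio (Real.pi ^ 2)))
  have h1 := le_of_tendsto_of_tendsto l1 l2 (by
    filter_upwards [self_mem_nhdsWithin] with κ' hκ'
    exact h κ' (lt_of_lt_of_le hκ' hge) hκ')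
  rw [genSin_pi_sq_one, mul_zero] at h1
  have h2 := genSin_pi_sq_pos (t := 1 - t) ⟨by linarith [ht.2], by linarith [ht.1]⟩
  have := mul_pos hu h2
  linarith

/-- The comparison inequality persists in the limit of the parameters `κ' ↑ κ`. -/
lemma comparison_of_forall_lt {κ u v t : ℝ} (h0 : κ ≠ 0) (hκ : κ < Real.pi ^ 2)
    (h : ∀ κ' < κ, κ' < Real.pi ^ 2 → u * genSin κ' (1 - t) ≤ v * genSin κ' 1) :
    u * genSin κ (1 - t) ≤ v * genSin κ 1 := by
  have l1 := ((tendsto_genSin_left h0 (1 - t)).const_mul u).mono_left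
    (nhdsWithin_le_nhds (s := Iio κ))
  have l2 := ((tendsto_genSin_left h0 1).const_mul v).mono_left
    (nhdsWithin_le_nhds (s := Iio κ))
  refine le_of_tendsto_of_tendsto l1 l2 ?_
  filter_upwards [self_mem_nhdsWithin] with κ' hκ'
  exact h κ' hκ' (lt_trans hκ' hκ)

/-- The distortion coefficient depends on `κ` and `ϑ` only through `κ * ϑ ^ 2`. -/
lemma distortion_eq {κ t ϑ : ℝ} (hϑ : 0 < ϑ) (hκ : κ * ϑ ^ 2 < Real.pi ^ 2) :
    distortion κ t ϑ = ENNReal.ofReal (genSin (κ * ϑ ^ 2) t / genSin (κ * ϑ ^ 2) 1) := by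
  rw [distortion, if_neg (not_le.2 hκ)]
  split_ifs with h
  · rw [h]; simp [genSin]
  · have e1 : genSin κ ϑ = ϑ * genSin (κ * ϑ ^ 2) 1 := by simpa using genSin_mul hϑ 1
    rw [genSin_mul hϑ, e1, mul_div_mul_left _ _ hϑ.ne']

lemma entropyPower_of_eq_coe {X : Type*} [MeasurableSpace X] {μ m : Measure X} {N e : ℝ}
    (h : relEntropy μ m = (e : EReal)) :
    entropyPower N μ m = ENNReal.ofReal (Real.exp (-e / N)) := by
  rw [entropyPower, h, ← EReal.coe_neg, ← EReal.coe_div, EReal.exp_coe]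

/-! ### Approximation of the end points -/

section Approximation

variable {X : Type*} [MeasurableSpace X]

/-- Averages over an exhausting sequence of sets converge to the full integral. -/
lemma tendsto_cond_of_monotone {μ : Measure X} [IsProbabilityMeasure μ] {K : ℕ → Set X}
    (hK : ∀ n, MeasurableSet (K n)) (hmono : Monotone K) (hU : μ (⋃ n, K n)ᶜ = 0) {f : X → ℝ}
    (hf : Integrable f μ) :
    Filter.Tendsto (fun n => (μ.real (K n))⁻¹ * ∫ x in K n, f x ∂μ) Filter.atTop
      (𝓝 (∫ x, f x ∂μ)) ∧
    Filter.Tendsto (fun n => μ.real (K n)) Filter.atTop (𝓝 1) := by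
  have hcongr : μ.restrict (⋃ n, K n) = μ := by
    apply Measure.restrict_eq_self_of_ae_mem
    exact hU
  have h1 : Filter.Tendsto (fun n => ∫ x in K n, f x ∂μ) Filter.atTop (𝓝 (∫ x, f x ∂μ)) := by
    have := tendsto_setIntegral_of_monotone hK hmono hf.integrableOn
    rwa [hcongr] at this
  have h2 : Filter.Tendsto (fun n => μ.real (K n)) Filter.atTop (𝓝 1) := by
    have := tendsto_measure_iUnion_atTop (μ := μ) hmono
    rw [(prob_compl_eq_zero_iff (MeasurableSet.iUnion hK)).1 hU] at this
    have h3 := (ENNReal.tendsto_toReal ENNReal.one_ne_top).comp this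
    simpa [measureReal_def] using! h3
  refine ⟨?_, h2⟩
  simpa using (h2.inv₀ one_ne_zero).mul h1

lemma integral_cond (μ : Measure X) (K : Set X) (f : X → ℝ) :
    ∫ x, f x ∂(ProbabilityTheory.cond μ K) = (μ.real K)⁻¹ * ∫ x in K, f x ∂μ := by
  rw [ProbabilityTheory.cond, integral_smul_measure, ENNReal.toReal_inv, smul_eq_mul,
    measureReal_def]

lemma cond_compl_eq_zero (μ : Measure X) {K : Set X} (hK : MeasurableSet K) :
    ProbabilityTheory.cond μ K Kᶜ = 0 := by
  rw [ProbabilityTheory.cond_apply hK]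
  simp

variable [MetricSpace X] [BorelSpace X]

lemma support_cond_subset (μ : Measure X) {K : Set X} (hK : IsClosed K) :
    (ProbabilityTheory.cond μ K).support ⊆ K :=
  Measure.support_subset_of_isClosed hK (mem_ae_iff.2 (cond_compl_eq_zero μ hK.measurableSet))

/-- Probability measures on shrinking balls converge to the Dirac mass at the centre. -/
lemma tendsto_dirac_of_closedBall {P : ℕ → ProbabilityMeasure X} {x₁ : X} {δ : ℕ → ℝ}
    (hδ : Filter.Tendsto δ Filter.atTop (𝓝 0))
    (hP : ∀ n, (P n : Measure X) (Metric.closedBall x₁ (δ n))ᶜ = 0) {D : ProbabilityMeasure X}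
    (hD : (D : Measure X) = Measure.dirac x₁) : Filter.Tendsto P Filter.atTop (𝓝 D) := by
  rw [ProbabilityMeasure.tendsto_iff_forall_integral_tendsto]
  intro f
  rw [hD, integral_dirac, Metric.tendsto_atTop]
  intro ε hε
  obtain ⟨η, hη, hf⟩ := Metric.continuousAt_iff.1 (f.continuous.continuousAt (x := x₁)) (ε / 2)
    (half_pos hε)
  obtain ⟨n₀, hn₀⟩ := Metric.tendsto_atTop.1 hδ η hη
  refine ⟨n₀, fun n hn => ?_⟩
  have h1 : ∀ᵐ x ∂(P n : Measure X), ‖f x - f x₁‖ ≤ ε / 2 := by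
    have h0 : ∀ᵐ x ∂(P n : Measure X), x ∈ Metric.closedBall x₁ (δ n) := hP n
    filter_upwards [h0] with x hx
    rw [← dist_eq_norm]
    refine (hf ?_).le
    have h2 := hn₀ n hn
    rw [Real.dist_eq, sub_zero] at h2
    exact lt_of_le_of_lt (Metric.mem_closedBall.1 hx) (lt_of_le_of_lt (le_abs_self _) h2)
  have h2 := norm_integral_le_of_norm_le_const h1
  rw [integral_sub (f.integrable _) (integrable_const _)] at h2
  simp only [integral_const, probReal_univ, one_smul, mul_one] at h2
  rw [dist_eq_norm]
  linarith

end Approximation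

/-! ### Causal diamonds -/

namespace LorentzianPreLengthSpace

variable {X : Type*} [MetricSpace X] [ProperSpace X] {L : LorentzianPreLengthSpace X}

/-- The future of a compact set is closed when the causal relation is. -/
lemma isClosed_causalFuture (hcl : IsClosed {z : X × X | L.causal z.1 z.2}) {K : Set X}
    (hK : IsCompact K) : IsClosed (L.causalFuture K) := by
  have := isCompact_iff_compactSpace.1 hK
  have h1 : L.causalFuture K = Prod.snd '' {z : K × X | L.causal z.1 z.2} := by
    ext y
    constructor
    · rintro ⟨x, hx, hxy⟩
      exact ⟨(⟨x, hx⟩, y), hxy, rfl⟩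
    · rintro ⟨⟨x, y'⟩, hxy, rfl⟩
      exact ⟨x, x.2, hxy⟩
  rw [h1]
  refine isClosedMap_snd_of_compactSpace _ ?_
  exact hcl.preimage ((continuous_subtype_val.comp continuous_fst).prodMk continuous_snd)

/-- The past of a compact set is closed when the causal relation is. -/
lemma isClosed_causalPast (hcl : IsClosed {z : X × X | L.causal z.1 z.2}) {K : Set X}
    (hK : IsCompact K) : IsClosed (L.causalPast K) := by
  have := isCompact_iff_compactSpace.1 hK
  have h1 : L.causalPast K = Prod.snd '' {z : K × X | L.causal z.2 z.1} := by
    ext y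
    constructor
    · rintro ⟨x, hx, hxy⟩
      exact ⟨(⟨x, hx⟩, y), hxy, rfl⟩
    · rintro ⟨⟨x, y'⟩, hxy, rfl⟩
      exact ⟨x, x.2, hxy⟩
  rw [h1]
  refine isClosedMap_snd_of_compactSpace _ ?_
  exact hcl.preimage (continuous_snd.prodMk (continuous_subtype_val.comp continuous_fst))

variable [MeasurableSpace X]

lemma causalPlans_nonempty_of_ell_ne_bot {p : ℝ} {μ ν : Measure X} (h : L.ell p μ ν ≠ ⊥) :
    (L.causalPlans μ ν).Nonempty := by
  rw [nonempty_iff_ne_empty]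
  intro he
  apply h
  rw [ell, he]
  simp

/-- The members of an `ℓ_p`-geodesic live in the causal diamond spanned by its end points. -/
lemma IsEllGeodesic.measure_compl_diamond {p : ℝ} {μ : ℝ → Measure X} (hμ : L.IsEllGeodesic p μ)
    (h0 : 0 < L.ell p (μ 0) (μ 1)) (ht : L.ell p (μ 0) (μ 1) < ⊤) {K₀ K₁ : Set X}
    (hμ0 : μ 0 K₀ᶜ = 0) (hμ1 : μ 1 K₁ᶜ = 0)
    (hF : MeasurableSet (L.causalFuture K₀)) (hP : MeasurableSet (L.causalPast K₁))
    {t : ℝ} (htm : t ∈ Icc (0 : ℝ) 1) :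
    μ t (L.causalFuture K₀ ∩ L.causalPast K₁)ᶜ = 0 := by
  have hne : ∀ s ∈ Icc (0 : ℝ) 1, ∀ u ∈ Icc (0 : ℝ) 1, s ≤ u → L.ell p (μ s) (μ u) ≠ ⊥ := by
    intro s hs u hu hsu
    rw [hμ.2 s hs u hu hsu]
    lift L.ell p (μ 0) (μ 1) to ℝ using ⟨ht.ne, (EReal.bot_lt_zero.trans h0).ne'⟩ with ℓ
    rw [← EReal.coe_mul]
    exact EReal.coe_ne_bot _
  have h0m : (0 : ℝ) ∈ Icc (0 : ℝ) 1 := ⟨le_rfl, zero_le_one⟩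
  have h1m : (1 : ℝ) ∈ Icc (0 : ℝ) 1 := ⟨zero_le_one, le_rfl⟩
  obtain ⟨π, hπ⟩ := causalPlans_nonempty_of_ell_ne_bot (hne 0 h0m t htm htm.1)
  obtain ⟨π', hπ'⟩ := causalPlans_nonempty_of_ell_ne_bot (hne t htm 1 h1m htm.2)
  have a1 : ∀ᵐ y ∂(μ t), y ∈ L.causalFuture K₀ := by
    rw [← hπ.2.2.1]
    refine (ae_map_iff measurable_snd.aemeasurable hF).2 ?_
    have h2 : ∀ᵐ x ∂(π.map Prod.fst), x ∈ K₀ := by rw [hπ.2.1]; exact hμ0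
    filter_upwards [hπ.2.2.2, ae_of_ae_map measurable_fst.aemeasurable h2] with z hz hz'
    exact ⟨z.1, hz', hz⟩
  have a2 : ∀ᵐ y ∂(μ t), y ∈ L.causalPast K₁ := by
    rw [← hπ'.2.1]
    refine (ae_map_iff measurable_fst.aemeasurable hP).2 ?_
    have h2 : ∀ᵐ x ∂(π'.map Prod.snd), x ∈ K₁ := by rw [hπ'.2.2.1]; exact hμ1
    filter_upwards [hπ'.2.2.2, ae_of_ae_map measurable_snd.aemeasurable h2] with z hz hz'
    exact ⟨z.2, hz', hz⟩
  have : ∀ᵐ y ∂(μ t), y ∈ L.causalFuture K₀ ∩ L.causalPast K₁ := by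
    filter_upwards [a1, a2] with y h1 h2 using ⟨h1, h2⟩
  exact this

end LorentzianPreLengthSpace

/-! ### The approximating problems -/

namespace LorentzianPreLengthSpace

section Approximating

variable {X : Type*} [MetricSpace X] [ProperSpace X] {L : LorentzianPreLengthSpace X}
  [MeasurableSpace X] [BorelSpace X]

/-- Exhaustion of a measure on `{x ≪ x₁}` by compact sets `K n`, together with shrinking balls
around `x₁` that lie in the chronological future of every point of `K n`. -/
lemma exists_compact_exhaustion (hτ_fin : ∀ x y, L.τ x y ≠ ⊤)
    (hτ_cont : Continuous (fun z : X × X => L.τ z.1 z.2)) {μ₀ : Measure X}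
    [IsProbabilityMeasure μ₀] (hc : IsCompact μ₀.support) {x₁ : X}
    (hch : ∀ᵐ x ∂μ₀, L.chron x x₁) :
    ∃ (K : ℕ → Set X) (δ : ℕ → ℝ), (∀ n, IsCompact (K n)) ∧ Monotone K ∧
      (∀ n, K n ⊆ μ₀.support) ∧ μ₀ (⋃ n, K n)ᶜ = 0 ∧ (∀ n, μ₀ (K n) ≠ 0) ∧
      (∀ n, 0 < δ n ∧ δ n ≤ 1) ∧ Filter.Tendsto δ Filter.atTop (𝓝 0) ∧
      ∀ n, ∀ x ∈ K n, ∀ y ∈ Metric.closedBall x₁ (δ n), L.chron x y := by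
  have hr : Continuous fun x => (L.τ x x₁).toReal :=
    (continuous_toReal_τ hτ_fin hτ_cont).comp (continuous_id.prodMk continuous_const)
  have hpos : ∀ {x y : X}, 0 < (L.τ x y).toReal ↔ L.chron x y := fun {x y} => by
    rw [← L.τ_pos_iff, ENNReal.toReal_pos_iff]
    exact ⟨fun h => h.1, fun h => ⟨h, (hτ_fin x y).lt_top⟩⟩
  let K' : ℕ → Set X := fun n => μ₀.support ∩ {x | 1 / ((n : ℝ) + 1) ≤ (L.τ x x₁).toReal}
  have hK'c : ∀ n, IsCompact (K' n) := fun n =>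
    hc.inter_right (isClosed_le continuous_const hr)
  have hK'm : Monotone K' := fun n k hnk x hx =>
    ⟨hx.1, show 1 / ((k : ℝ) + 1) ≤ (L.τ x x₁).toReal from
      (Nat.one_div_le_one_div hnk).trans hx.2⟩
  have hK'0 : μ₀ (⋃ n, K' n)ᶜ = 0 := by
    have h1 : ∀ᵐ x ∂μ₀, x ∈ μ₀.support := Measure.measure_compl_support
    have h2 : ∀ᵐ x ∂μ₀, x ∈ ⋃ n, K' n := by
      filter_upwards [h1, hch] with x hx hx'
      obtain ⟨n, hn⟩ := exists_nat_one_div_lt (hpos.2 hx')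
      exact mem_iUnion.2 ⟨n, hx, hn.le⟩
    exact h2
  obtain ⟨n₀, hn₀⟩ : ∃ n, μ₀ (K' n) ≠ 0 := by
    by_contra! h
    have h1 : μ₀ (⋃ n, K' n) = 0 := measure_iUnion_null h
    have h2 := prob_add_prob_compl (μ := μ₀)
      (MeasurableSet.iUnion fun n => (hK'c n).measurableSet)
    rw [h1, hK'0] at h2
    simp at h2
  have hδ : ∀ n : ℕ, ∃ δ : ℝ, 0 < δ ∧ δ ≤ 1 / ((n : ℝ) + 1) ∧
      ∀ x ∈ K' (n + n₀), ∀ y ∈ Metric.closedBall x₁ δ, L.chron x y := by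
    intro n
    have hopen : IsOpen {z : X × X | 0 < (L.τ z.1 z.2).toReal} :=
      isOpen_lt continuous_const (continuous_toReal_τ hτ_fin hτ_cont)
    obtain ⟨U, V, -, hV, hKU, hxV, hUV⟩ := generalized_tube_lemma (hK'c (n + n₀))
      (isCompact_singleton (x := x₁)) hopen (by
        rintro ⟨x, y⟩ ⟨hx, rfl⟩
        have h1 : 1 / (((n + n₀ : ℕ) : ℝ) + 1) ≤ (L.τ x y).toReal := hx.2
        exact lt_of_lt_of_le Nat.one_div_pos_of_nat h1)
    obtain ⟨ε, hε, hεV⟩ := Metric.nhds_basis_closedBall.mem_iff.1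
      (hV.mem_nhds (hxV rfl))
    refine ⟨min ε (1 / ((n : ℝ) + 1)), lt_min hε Nat.one_div_pos_of_nat, min_le_right _ _,
      fun x hx y hy => hpos.1 ?_⟩
    exact hUV (mk_mem_prod (hKU hx) (hεV (Metric.closedBall_subset_closedBall (min_le_left _ _) hy)))
  choose δ hδ0 hδ1 hδ2 using hδ
  refine ⟨fun n => K' (n + n₀), δ, fun n => hK'c _, fun n k hnk => hK'm (by omega),
    fun n => inter_subset_left, ?_, ?_, ?_, ?_, hδ2⟩
  · refine measure_mono_null (compl_subset_compl.2 (iUnion_subset fun n => ?_)) hK'0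
    exact (hK'm (Nat.le_add_right n n₀)).trans (subset_iUnion (fun n => K' (n + n₀)) n)
  · intro n h
    exact hn₀ (measure_mono_null (hK'm (Nat.le_add_left n₀ n)) h)
  · refine fun n => ⟨hδ0 n, (hδ1 n).trans ?_⟩
    rw [div_le_one (by positivity)]
    linarith [(Nat.cast_nonneg n : (0 : ℝ) ≤ n)]
  · exact squeeze_zero (fun n => (hδ0 n).le) hδ1 tendsto_one_div_add_atTop_nhds_zero_nat

/-- What the curvature-dimension condition provides for end points with chronologically related
compact supports: the distributional inequality has been integrated to a comparison inequality. -/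
lemma exists_ellGeodesic_comparison {m : Measure X} [SigmaFinite m]
    (hτ_fin : ∀ x y, L.τ x y ≠ ⊤) (hτ_cont : Continuous (fun z : X × X => L.τ z.1 z.2))
    (hcl : IsClosed {z : X × X | L.causal z.1 z.2}) {p K N : ℝ} (hp : p ∈ Ioo (0 : ℝ) 1)
    (hN : 0 < N) (hTCD : L.WTCD m p K N) {μ₀ μ₁ : Measure X} (h₀ : InEntropyDomain μ₀ m)
    (h₁ : InEntropyDomain μ₁ m) {K₀ K₁ : Set X} (hK₀ : IsCompact K₀) (hK₁ : IsCompact K₁)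
    (hμ₀ : μ₀.support ⊆ K₀) (hμ₁ : μ₁.support ⊆ K₁)
    (hch : ∀ x ∈ K₀, ∀ y ∈ K₁, L.chron x y) :
    ∃ (P : ℝ → ProbabilityMeasure X) (π : Measure (X × X)), (P 0 : Measure X) = μ₀ ∧
      (P 1 : Measure X) = μ₁ ∧ (∀ t, InEntropyDomain (P t : Measure X) m) ∧
      (∀ t, (P t : Measure X) (L.causalFuture K₀ ∩ L.causalPast K₁)ᶜ = 0) ∧
      L.IsEllGeodesic p (fun t => P t) ∧ π ∈ L.causalPlans (P 0) (P 1) ∧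
      L.ell p (P 0) (P 1) = (((∫ z, L.powCost p z ∂π) ^ (1 / p) : ℝ) : EReal) ∧
      ∀ κ < Real.pi ^ 2, κ ≤ K * (∫ z, (L.τ z.1 z.2).toReal ^ 2 ∂π) / N → ∀ t ∈ Ioo (0 : ℝ) 1,
        Real.exp (-(relEntropy (P 0 : Measure X) m).toReal / N) * genSin κ (1 - t)
          ≤ Real.exp (-(relEntropy (P t : Measure X) m).toReal / N) * genSin κ 1 := by
  have := h₀.1
  have := h₁.1
  have hs₀ : IsCompact μ₀.support := hK₀.of_isClosed_subset Measure.isClosed_support hμ₀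
  have hs₁ : IsCompact μ₁.support := hK₁.of_isClosed_subset Measure.isClosed_support hμ₁
  have hz₀ : μ₀ K₀ᶜ = 0 :=
    measure_mono_null (compl_subset_compl.2 hμ₀) Measure.measure_compl_support
  have hz₁ : μ₁ K₁ᶜ = 0 :=
    measure_mono_null (compl_subset_compl.2 hμ₁) Measure.measure_compl_support
  obtain ⟨π, hπ⟩ := exists_stronglyDualisableBy hτ_fin hτ_cont hp.1 hs₀ hs₁
    fun x hx y hy => hch x (hμ₀ hx) y (hμ₁ hy)
  obtain ⟨μ, hμ0, hμ1, hgeo, hdom, hsc, hdist⟩ := hTCD μ₀ μ₁ π h₀ hs₀ h₁ hs₁ hπ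
  obtain ⟨⟨⟨hℓ0, hℓt⟩, ⟨hopt, -⟩, -⟩, -⟩ := hπ
  have hint : ∀ f : X × X → ℝ, Continuous f → ∀ π' ∈ L.causalPlans μ₀ μ₁, Integrable f π' := by
    intro f hf π' hπ'
    have := hπ'.1
    obtain ⟨B, hB⟩ := (hK₀.prod hK₁).exists_bound_of_continuousOn hf.continuousOn
    have h1 : ∀ᵐ z ∂π', z ∈ K₀ ×ˢ K₁ := measure_compl_prod_eq_zero hπ'.2.1 hπ'.2.2.1
      hK₀.measurableSet hK₁.measurableSet hz₀ hz₁
    exact Integrable.of_bound hf.aestronglyMeasurable B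
      (by filter_upwards [h1] with z hz using hB z hz)
  have hpc := hint _ (continuous_powCost hτ_fin hτ_cont hp.1.le)
  have hproj : ∀ t ∈ Icc (0 : ℝ) 1, ((projIcc 0 1 zero_le_one t : I) : ℝ) = t := fun t ht => by
    rw [projIcc_of_mem zero_le_one ht]
  let P : ℝ → ProbabilityMeasure X := fun t =>
    ⟨μ (projIcc 0 1 zero_le_one t : I), hgeo.1 _ (projIcc 0 1 zero_le_one t).2⟩
  have hP : ∀ t ∈ Icc (0 : ℝ) 1, (P t : Measure X) = μ t := fun t ht => by
    change μ _ = _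
    rw [hproj t ht]
  have h0m : (0 : ℝ) ∈ Icc (0 : ℝ) 1 := ⟨le_rfl, zero_le_one⟩
  have h1m : (1 : ℝ) ∈ Icc (0 : ℝ) 1 := ⟨zero_le_one, le_rfl⟩
  have hP0 := hP 0 h0m
  have hP1 := hP 1 h1m
  refine ⟨P, π, hP0.trans hμ0, hP1.trans hμ1, fun t => hdom _ (projIcc 0 1 zero_le_one t).2,
    fun t => ?_, ⟨fun t _ => inferInstance, fun s hs t ht hst => ?_⟩, ?_, ?_, ?_⟩
  · exact hgeo.measure_compl_diamond (by rwa [hμ0, hμ1]) (by rwa [hμ0, hμ1]) (by rwa [hμ0])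
      (by rwa [hμ1]) (isClosed_causalFuture hcl hK₀).measurableSet
      (isClosed_causalPast hcl hK₁).measurableSet (projIcc 0 1 zero_le_one t).2
  · change L.ell p (P s) (P t) = _ * L.ell p (P 0) (P 1)
    rw [hP s hs, hP t ht, hP0, hP1]
    exact hgeo.2 s hs t ht hst
  · rw [hP0, hP1, hμ0, hμ1]
    exact hopt.1
  · rw [hP0, hP1, hμ0, hμ1]
    refine ell_eq_coe hτ_fin hp.1 hpc (fun π' hπ' => ?_) ⟨π, hopt.1, le_rfl⟩
    have h1 := hopt.2 π' hπ'
    rwa [cost_eq_ofReal hτ_fin hp.1.le (hpc _ hπ'), cost_eq_ofReal hτ_fin hp.1.le (hpc _ hopt.1),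
      ENNReal.ofReal_le_ofReal_iff (integral_nonneg fun z => powCost_nonneg p z)] at h1
  · intro κ hκ hκA t ht
    rw [hP0, hP t ⟨ht.1.le, ht.2.le⟩]
    have hsq : ∫⁻ z, L.τ z.1 z.2 ^ 2 ∂π
        = ENNReal.ofReal (∫ z, (L.τ z.1 z.2).toReal ^ 2 ∂π) := by
      have hi : Integrable (fun z : X × X => (L.τ z.1 z.2).toReal ^ 2) π :=
        hint _ ((continuous_toReal_τ hτ_fin hτ_cont).pow 2) _ hopt.1
      rw [ofReal_integral_eq_lintegral_ofReal hi (Filter.Eventually.of_forall fun z => sq_nonneg _)]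
      refine lintegral_congr fun z => ?_
      rw [ENNReal.ofReal_pow ENNReal.toReal_nonneg, ENNReal.ofReal_toReal (hτ_fin _ _)]
    rw [hsq, EReal.coe_ennreal_ofReal, max_eq_left (integral_nonneg fun z => sq_nonneg _),
      ← EReal.coe_mul] at hdist
    exact hdist.comparison hN hsc hκA hκ ht

/-- The approximating geodesics: `μ₀` is conditioned on compact sets that exhaust it, and `δ_{x₁}`
is replaced by normalized restrictions of `m` to small balls. All measures live in one causal
diamond, the end points converge weakly, and so do the initial entropies. -/
lemma exists_approximating_geodesics {m : Measure X}
    (hm_bdd : ∀ B : Set X, Bornology.IsBounded B → m B < ⊤) (hm_supp : m.support = univ)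
    (hcomp : ∀ C₁ C₂ : Set X, IsCompact C₁ → IsCompact C₂ →
      IsCompact (L.causalFuture C₁ ∩ L.causalPast C₂))
    (hτ_fin : ∀ x y, L.τ x y ≠ ⊤) (hτ_cont : Continuous (fun z : X × X => L.τ z.1 z.2))
    {p K N : ℝ} (hp : p ∈ Ioo (0 : ℝ) 1) (hN : 0 < N) (hTCD : L.WTCD m p K N)
    {μ₀ : ProbabilityMeasure X} {x₁ : X} (hdom : InEntropyDomain (μ₀ : Measure X) m)
    (hc : IsCompact (μ₀ : Measure X).support) (hch : ∀ᵐ x ∂(μ₀ : Measure X), L.chron x x₁)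
    {D : ProbabilityMeasure X} (hD : (D : Measure X) = Measure.dirac x₁) :
    ∃ (P : ℕ → ℝ → ProbabilityMeasure X) (π : ℕ → Measure (X × X)) (C : Set X), IsCompact C ∧
      (∀ n t, InEntropyDomain (P n t : Measure X) m) ∧ (∀ n t, (P n t : Measure X) Cᶜ = 0) ∧
      (∀ n, L.IsEllGeodesic p (fun t => P n t)) ∧
      (∀ n, π n ∈ L.causalPlans (P n 0) (P n 1)) ∧
      (∀ n, L.ell p (P n 0) (P n 1)
        = (((∫ z, L.powCost p z ∂(π n)) ^ (1 / p) : ℝ) : EReal)) ∧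
      (∀ n, ∀ κ < Real.pi ^ 2, κ ≤ K * (∫ z, (L.τ z.1 z.2).toReal ^ 2 ∂(π n)) / N →
        ∀ t ∈ Ioo (0 : ℝ) 1,
          Real.exp (-(relEntropy (P n 0 : Measure X) m).toReal / N) * genSin κ (1 - t)
            ≤ Real.exp (-(relEntropy (P n t : Measure X) m).toReal / N) * genSin κ 1) ∧
      Filter.Tendsto (fun n => P n 0) Filter.atTop (𝓝 μ₀) ∧
      Filter.Tendsto (fun n => P n 1) Filter.atTop (𝓝 D) ∧
      Filter.Tendsto (fun n => (relEntropy (P n 0 : Measure X) m).toReal) Filter.atTop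
        (𝓝 (relEntropy (μ₀ : Measure X) m).toReal) := by
  have : IsLocallyFiniteMeasure m :=
    ⟨fun x => ⟨Metric.ball x 1, Metric.ball_mem_nhds x one_pos, hm_bdd _ Metric.isBounded_ball⟩⟩
  have hcl := isClosed_causal hcomp
  obtain ⟨S, δ, hSc, hSm, hSs, hSU, hS0, hδ, hδ0, hSδ⟩ :=
    exists_compact_exhaustion hτ_fin hτ_cont hc hch
  have hac := hdom.absolutelyContinuous
  have hllr := hdom.integrable_llr
  have hd₀ := fun n => inEntropyDomain_cond hac (hSc n).measurableSet (hS0 n)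
    (measure_ne_top _ _) hllr.integrableOn
  have hball : ∀ n, m (Metric.closedBall x₁ (δ n)) ≠ 0 := fun n => by
    have h1 : x₁ ∈ m.support := hm_supp ▸ mem_univ x₁
    exact ((Measure.mem_support_iff_forall x₁).1 h1 _
      (Metric.closedBall_mem_nhds x₁ (hδ n).1)).ne'
  have hd₁ := fun n => inEntropyDomain_cond_self (m := m) Metric.isClosed_closedBall.measurableSet
    (hball n) (hm_bdd _ Metric.isBounded_closedBall).ne
  choose P π hP0 hP1 hPd hPC hPg hπ hℓ hcmp using fun n =>
    exists_ellGeodesic_comparison hτ_fin hτ_cont hcl hp hN hTCD (hd₀ n).1 (hd₁ n) (hSc n)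
      (isCompact_closedBall x₁ (δ n)) (support_cond_subset _ (hSc n).isClosed)
      (support_cond_subset _ Metric.isClosed_closedBall) (hSδ n)
  refine ⟨P, π, _, hcomp _ _ hc (isCompact_closedBall x₁ 1), hPd, fun n t => ?_, hPg, hπ, hℓ, hcmp,
    ?_, ?_, ?_⟩
  · refine measure_mono_null (compl_subset_compl.2 (inter_subset_inter ?_ ?_)) (hPC n t)
    · rintro y ⟨x, hx, hxy⟩
      exact ⟨x, hSs n hx, hxy⟩
    · rintro y ⟨x, hx, hxy⟩
      exact ⟨x, Metric.closedBall_subset_closedBall (hδ n).2 hx, hxy⟩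
  · rw [ProbabilityMeasure.tendsto_iff_forall_integral_tendsto]
    intro f
    refine (tendsto_cond_of_monotone (fun n => (hSc n).measurableSet) hSm hSU
      (f.integrable (μ₀ : Measure X))).1.congr fun n => ?_
    rw [hP0, integral_cond]
  · refine tendsto_dirac_of_closedBall hδ0 (fun n => ?_) hD
    rw [hP1]
    exact cond_compl_eq_zero m Metric.isClosed_closedBall.measurableSet
  · obtain ⟨h1, h2⟩ := tendsto_cond_of_monotone (fun n => (hSc n).measurableSet) hSm hSU hllr
    have h3 := h1.sub (h2.log one_ne_zero)
    rw [Real.log_one, sub_zero] at h3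
    rw [relEntropy_of_integrable_llr hac hllr, EReal.toReal_coe]
    refine h3.congr fun n => ?_
    rw [hP0, (hd₀ n).2, EReal.toReal_coe]

/-! ### Passage to the limit -/

/-- Ultralimits of the approximating geodesics: the limit curve is a geodesic for every exponent
and inherits the comparison inequality for the parameters below the limiting one. -/
theorem exists_ellGeodesic_dirac {m : Measure X}
    (hm_bdd : ∀ B : Set X, Bornology.IsBounded B → m B < ⊤) (hm_supp : m.support = univ)
    (hcomp : ∀ C₁ C₂ : Set X, IsCompact C₁ → IsCompact C₂ →
      IsCompact (L.causalFuture C₁ ∩ L.causalPast C₂))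
    (hτ_fin : ∀ x y, L.τ x y ≠ ⊤) (hτ_cont : Continuous (fun z : X × X => L.τ z.1 z.2))
    {p K N : ℝ} (hp : p ∈ Ioo (0 : ℝ) 1) (hN : 0 < N) (hTCD : L.WTCD m p K N) {q : ℝ}
    (hq : q ∈ Ioo (0 : ℝ) 1) {μ₀ : Measure X} {x₁ : X} (hdom : InEntropyDomain μ₀ m)
    (hc : IsCompact μ₀.support) (hch : ∀ᵐ x ∂μ₀, L.chron x x₁) :
    ∃ μ : ℝ → Measure X, μ 0 = μ₀ ∧ μ 1 = Measure.dirac x₁ ∧ L.IsEllGeodesic q μ ∧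
      ∀ t ∈ Ioo (0 : ℝ) 1, ∃ e : ℝ, relEntropy (μ t) m = e ∧ ∀ κ < Real.pi ^ 2,
        (κ < K * (∫ x, (L.τ x x₁).toReal ^ 2 ∂μ₀) / N ∨ (K = 0 ∧ κ = 0)) →
          Real.exp (-(relEntropy μ₀ m).toReal / N) * genSin κ (1 - t)
            ≤ Real.exp (-e / N) * genSin κ 1 := by
  have : IsLocallyFiniteMeasure m :=
    ⟨fun x => ⟨Metric.ball x 1, Metric.ball_mem_nhds x one_pos, hm_bdd _ Metric.isBounded_ball⟩⟩
  have hcl := isClosed_causal hcomp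
  obtain ⟨M, hM⟩ : ∃ M : ProbabilityMeasure X, (M : Measure X) = μ₀ := ⟨⟨μ₀, hdom.1⟩, rfl⟩
  obtain ⟨D, hD⟩ : ∃ D : ProbabilityMeasure X, (D : Measure X) = Measure.dirac x₁ :=
    ⟨⟨Measure.dirac x₁, inferInstance⟩, rfl⟩
  subst hM
  obtain ⟨P, π, C, hC, hPd, hPC, hPg, hπ, hℓ, hcmp, hlim0, hlim1, hent⟩ :=
    exists_approximating_geodesics hm_bdd hm_supp hcomp hτ_fin hτ_cont hp hN hTCD hdom hc hch hD
  let 𝒰 : Ultrafilter ℕ := Ultrafilter.of Filter.atTop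
  have h𝒰 : (𝒰 : Filter ℕ) ≤ Filter.atTop := Ultrafilter.of_le Filter.atTop
  choose Q hQ using fun t => exists_tendsto_ultrafilter 𝒰 (fun n => P n t) hC fun n => hPC n t
  have hQC := fun t => measure_compl_eq_zero_of_tendsto (hQ t) hC.isClosed fun n => hPC n t
  have hQ0 : Q 0 = M := tendsto_nhds_unique (hQ 0) (hlim0.mono_left h𝒰)
  have hQ1 : Q 1 = D := tendsto_nhds_unique (hQ 1) (hlim1.mono_left h𝒰)
  have hτc := continuous_toReal_τ hτ_fin hτ_cont
  have hpc := continuous_powCost hτ_fin hτ_cont hp.1.le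
  -- the plans between the end points converge to the only coupling with a Dirac mass.
  have hdirac : ∀ f : X × X → ℝ, Continuous f → Filter.Tendsto (fun n => ∫ z, f z ∂(π n)) 𝒰
      (𝓝 (∫ x, f (x, x₁) ∂(M : Measure X))) := by
    obtain ⟨π', hπ', hlim⟩ := exists_limit_plan hcl 𝒰 (hQ 0) (hQ 1) hC (fun n => hPC n 0)
      (fun n => hPC n 1) hπ
    intro f hf
    have h1 : ∫ z, f z ∂π' = ∫ x, f (x, x₁) ∂(M : Measure X) := by
      have h2 : ∀ᵐ z ∂π', z.2 = x₁ := by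
        have h3 : ∀ᵐ y ∂(π'.map Prod.snd), y = x₁ := by
          rw [hπ'.2.2.1, hQ1, hD]
          exact (ae_dirac_iff (measurableSet_singleton x₁)).2 rfl
        exact ae_of_ae_map measurable_snd.aemeasurable h3
      have hf' : Continuous fun x => f (x, x₁) := hf.comp (continuous_id.prodMk continuous_const)
      rw [← hQ0, ← hπ'.2.1, integral_map measurable_fst.aemeasurable hf'.aestronglyMeasurable]
      refine integral_congr_ae ?_
      filter_upwards [h2] with z hz
      rw [← hz]
    exact h1 ▸ hlim f hf
  have hcost := hdirac _ hpc
  have hΘ := hdirac _ (hτc.pow 2)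
  have hplan : ∀ s ∈ Icc (0 : ℝ) 1, ∀ t ∈ Icc (0 : ℝ) 1, s ≤ t →
      ∃ π ∈ L.causalPlans (Q s) (Q t),
        (t - s) ^ p * ∫ x, (L.τ x x₁).toReal ^ p ∂(Q 0 : Measure X) ≤ ∫ z, L.powCost p z ∂π := by
    intro s hs t ht hst
    -- almost optimal plans for the approximating geodesics; the slack disappears in the limit
    have hex : ∀ n, ∃ ρ ∈ L.causalPlans (P n s) (P n t),
        (t - s) * (∫ z, L.powCost p z ∂(π n)) ^ (1 / p) - 1 / ((n : ℝ) + 1)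
          < (∫ z, L.powCost p z ∂ρ) ^ (1 / p) := by
      intro n
      refine exists_plan_of_lt_ell hτ_fin hp.1 (fun ρ hρ => ?_) ?_
      · have := hρ.1
        obtain ⟨B, hB⟩ := (hC.prod hC).exists_bound_of_continuousOn hpc.continuousOn
        have h1 : ∀ᵐ z ∂ρ, z ∈ C ×ˢ C := measure_compl_prod_eq_zero hρ.2.1 hρ.2.2.1
          hC.measurableSet hC.measurableSet (hPC n s) (hPC n t)
        exact Integrable.of_bound hpc.aestronglyMeasurable B
          (by filter_upwards [h1] with z hz using hB z hz)
      · rw [(hPg n).2 s hs t ht hst, hℓ n, ← EReal.coe_mul, EReal.coe_lt_coe_iff]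
        linarith [(Nat.one_div_pos_of_nat : 0 < 1 / ((n : ℝ) + 1))]
    choose ρ hρ hρlt using hex
    obtain ⟨ρ', hρ', hlim⟩ := exists_limit_plan hcl 𝒰 (hQ s) (hQ t) hC (fun n => hPC n s)
      (fun n => hPC n t) hρ
    refine ⟨ρ', hρ', ?_⟩
    have hp' : 0 < 1 / p := one_div_pos.2 hp.1
    have hR : 0 ≤ ∫ x, (L.τ x x₁).toReal ^ p ∂(M : Measure X) :=
      integral_nonneg fun x => Real.rpow_nonneg ENNReal.toReal_nonneg _
    have hle : (t - s) * (∫ x, (L.τ x x₁).toReal ^ p ∂(M : Measure X)) ^ (1 / p)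
        ≤ (∫ z, L.powCost p z ∂ρ') ^ (1 / p) := by
      have l1 := ((hcost.rpow_const (Or.inr hp'.le)).const_mul (t - s)).sub
        (tendsto_one_div_add_atTop_nhds_zero_nat.mono_left h𝒰)
      rw [sub_zero] at l1
      exact le_of_tendsto_of_tendsto l1 ((hlim _ hpc).rpow_const (Or.inr hp'.le))
        (Filter.Eventually.of_forall fun n => (hρlt n).le)
    have h0 : 0 ≤ ∫ z, L.powCost p z ∂ρ' := integral_nonneg fun z => powCost_nonneg p z
    have h1 := Real.rpow_le_rpow (mul_nonneg (sub_nonneg.2 hst) (Real.rpow_nonneg hR _)) hle hp.1.le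
    rwa [Real.mul_rpow (sub_nonneg.2 hst) (Real.rpow_nonneg hR _), ← Real.rpow_mul hR,
      ← Real.rpow_mul h0, one_div_mul_cancel hp.1.ne', Real.rpow_one, Real.rpow_one, ← hQ0] at h1
  refine ⟨fun t => Q t, congrArg _ hQ0, (congrArg _ hQ1).trans hD, isEllGeodesic_of_plans hτ_fin hτ_cont hcl hp
    hq (fun t _ => inferInstance) ((congrArg _ hQ1).trans hD) hC (fun t _ => hQC t) hplan, fun t ht => ?_⟩
  -- an upper bound on the entropy of `Q t` for each admissible parameter.
  have hle : ∀ κ < Real.pi ^ 2,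
      (κ < K * (∫ x, (L.τ x x₁).toReal ^ 2 ∂(M : Measure X)) / N ∨ (K = 0 ∧ κ = 0)) →
      relEntropy (Q t : Measure X) m ≤ (((relEntropy (M : Measure X) m).toReal
        - N * Real.log (genSin κ (1 - t) / genSin κ 1) : ℝ) : EReal) := by
    intro κ hκ hκΘ
    have ht' : 0 < 1 - t := sub_pos.2 ht.2
    have hs1 : 0 < genSin κ 1 := genSin_pos_of_mem ⟨one_pos, le_rfl⟩ hκ
    have hst : 0 < genSin κ (1 - t) := genSin_pos_of_mem ⟨ht', by linarith [ht.1]⟩ hκ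
    have hev : ∀ᶠ n in (𝒰 : Filter ℕ),
        κ ≤ K * (∫ z, (L.τ z.1 z.2).toReal ^ 2 ∂(π n)) / N := by
      rcases hκΘ with h | ⟨rfl, rfl⟩
      · have hl := (hΘ.const_mul K).div_const N
        filter_upwards [hl.eventually (lt_mem_nhds h)] with n hn using hn.le
      · simp
    refine EReal.le_of_forall_lt_iff_le.1 fun E hE => ?_
    refine relEntropy_le_of_tendsto (hQ t) hC.isClosed
      (hm_bdd C hC.isBounded).ne (fun n => hPC n t) (fun n => hPd n t) ?_
    rw [EReal.coe_lt_coe_iff] at hE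
    have hl := (hent.mono_left h𝒰).sub_const (N * Real.log (genSin κ (1 - t) / genSin κ 1))
    filter_upwards [hev, hl.eventually (gt_mem_nhds hE)] with n hn hn'
    have h1 := Real.log_le_log (by positivity) (hcmp n κ hκ hn t ht)
    rw [Real.log_mul (Real.exp_pos _).ne' hst.ne', Real.log_mul (Real.exp_pos _).ne' hs1.ne',
      Real.log_exp, Real.log_exp] at h1
    rw [Real.log_div hst.ne' hs1.ne'] at hn'
    have h2 : (relEntropy (P n t : Measure X) m).toReal
        ≤ (relEntropy (P n 0 : Measure X) m).toReal
          - N * (Real.log (genSin κ (1 - t)) - Real.log (genSin κ 1)) := by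
      have h3 := mul_le_mul_of_nonneg_left h1 hN.le
      have e1 : ∀ a b : ℝ, N * (-a / N + b) = -a + N * b := fun a b => by field_simp
      rw [e1, e1] at h3
      linarith
    exact h2.trans hn'.le
  have hbot := relEntropy_ne_bot (m := m) hC.measurableSet (hQC t) (hm_bdd C hC.isBounded).ne
  -- finiteness follows from the bound for any one admissible parameter
  have htop : relEntropy (Q t : Measure X) m ≠ ⊤ := by
    have h1 : min 0 (K * (∫ x, (L.τ x x₁).toReal ^ 2 ∂(M : Measure X)) / N) - 1 < Real.pi ^ 2 := by
      have h2 : 0 < Real.pi ^ 2 := by positivity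
      have h3 := min_le_left 0 (K * (∫ x, (L.τ x x₁).toReal ^ 2 ∂(M : Measure X)) / N)
      linarith
    have h2 := hle _ h1 (Or.inl (by
      have h3 := min_le_right 0 (K * (∫ x, (L.τ x x₁).toReal ^ 2 ∂(M : Measure X)) / N)
      linarith))
    exact (h2.trans_lt (EReal.coe_lt_top _)).ne
  obtain ⟨e, he⟩ : ∃ e : ℝ, relEntropy (Q t : Measure X) m = e :=
    ⟨_, (EReal.coe_toReal htop hbot).symm⟩
  refine ⟨e, he, fun κ hκ hκΘ => ?_⟩
  have h1 := hle κ hκ hκΘ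
  rw [he, EReal.coe_le_coe_iff] at h1
  have hs1 : 0 < genSin κ 1 := genSin_pos_of_mem ⟨one_pos, le_rfl⟩ hκ
  have hst : 0 < genSin κ (1 - t) :=
    genSin_pos_of_mem ⟨sub_pos.2 ht.2, by linarith [ht.1]⟩ hκ
  rw [← div_le_iff₀ hs1, mul_div_assoc]
  calc _ = Real.exp (-((relEntropy (M : Measure X) m).toReal
        - N * Real.log (genSin κ (1 - t) / genSin κ 1)) / N) := by
        rw [neg_sub, sub_div, mul_div_cancel_left₀ _ hN.ne', sub_eq_add_neg (Real.log _),
          add_comm (Real.log _), ← neg_div, Real.exp_add, Real.exp_log (div_pos hst hs1)]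
    _ ≤ _ := by
        gcongr

end Approximating

end LorentzianPreLengthSpace

theorem mainTheorem8 {X : Type*} [MetricSpace X] [ProperSpace X] [MeasurableSpace X]
    [BorelSpace X] (L : LorentzianPreLengthSpace X) (m : Measure X)
    (hm_bdd : ∀ B : Set X, Bornology.IsBounded B → m B < ⊤)
    (hm_supp : m.support = univ)
    (hlcc : L.LocallyCausallyClosed) (hdc : L.DCompatible)
    (hgh : L.KGloballyHyperbolic) (hgeo : L.IsGeodesicSpace)
    (hτ_fin : ∀ x y, L.τ x y ≠ ⊤)
    (hτ_cont : Continuous (fun z : X × X => L.τ z.1 z.2))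
    (p K N : ℝ) (hp : p ∈ Ioo (0 : ℝ) 1) (hN : 0 < N)
    (hTCD : L.WTCD m p K N) :
    ∀ q ∈ Ioo (0 : ℝ) 1, L.TMCP m q K N := by
  intro q hq μ₀ x₁ hdom hcomp hch
  have := hdom.1
  obtain ⟨μ, hμ0, hμ1, hgeod, hμ⟩ := LorentzianPreLengthSpace.exists_ellGeodesic_dirac hm_bdd
    hm_supp hgh.2 hτ_fin hτ_cont hp hN hTCD hq hdom hcomp hch
  refine ⟨μ, hμ0, hμ1, hgeod, fun t ht => ?_⟩
  have hr : Continuous fun x => L.τ x x₁ := hτ_cont.comp (continuous_id.prodMk continuous_const)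
  have hr' : Continuous fun x => (L.τ x x₁).toReal ^ 2 :=
    (ENNReal.continuousOn_toReal.comp_continuous hr fun x => hτ_fin x x₁).pow 2
  have hΘ : (∫⁻ x, L.τ x x₁ ^ 2 ∂μ₀).toReal = ∫ x, (L.τ x x₁).toReal ^ 2 ∂μ₀ := by
    rw [← integral_toReal (hr.measurable.pow_const 2).aemeasurable (Filter.Eventually.of_forall fun x =>
      ENNReal.pow_lt_top (hτ_fin x x₁).lt_top)]
    simp only [ENNReal.toReal_pow]
  rw [hΘ]
  set Θ := ∫ x, (L.τ x x₁).toReal ^ 2 ∂μ₀ with hΘdef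
  have hΘpos : 0 < Θ := by
    obtain ⟨B, hB⟩ := hcomp.exists_bound_of_continuousOn hr'.continuousOn
    have h1 : ∀ᵐ x ∂μ₀, x ∈ μ₀.support := Measure.measure_compl_support
    have hi : Integrable (fun x => (L.τ x x₁).toReal ^ 2) μ₀ :=
      Integrable.of_bound hr'.aestronglyMeasurable B
        (by filter_upwards [h1] with x hx using hB x hx)
    refine lt_of_le_of_ne (integral_nonneg fun x => sq_nonneg _) fun h => ?_
    have h2 := (integral_eq_zero_iff_of_nonneg (fun x => sq_nonneg _) hi).1 h.symm
    obtain ⟨x, hx, hx'⟩ := (h2.and hch).exists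
    exact (ENNReal.toReal_pos ((L.τ_pos_iff x x₁).2 hx').ne' (hτ_fin x x₁)).ne'
      (pow_eq_zero_iff two_ne_zero |>.1 hx)
  have hϑ : 0 < √Θ := Real.sqrt_pos.2 hΘpos
  have hlam : K / N * √Θ ^ 2 = K * Θ / N := by
    rw [Real.sq_sqrt hΘpos.le]
    ring
  obtain ⟨E, hE⟩ : ∃ E : ℝ, relEntropy μ₀ m = E := ⟨_, (EReal.coe_toReal hdom.2.1 hdom.2.2).symm⟩
  rw [hE, EReal.toReal_coe] at hμ
  have hlt : K * Θ / N < Real.pi ^ 2 := by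
    have hhalf : (1 / 2 : ℝ) ∈ Ioo (0 : ℝ) 1 := by norm_num
    obtain ⟨e, -, he⟩ := hμ (1 / 2) hhalf
    exact lt_pi_sq_of_comparison hhalf (Real.exp_pos _) fun κ' h1 h2 => he κ' h2 (Or.inl h1)
  rw [distortion_eq hϑ (by rwa [hlam]), hlam, entropyPower_of_eq_coe hE]
  have hs1 := genSin_pos_of_mem (κ := K * Θ / N) ⟨one_pos, le_rfl⟩ hlt
  rcases ht.1.eq_or_lt with h0 | h0
  · rw [← h0, hμ0, entropyPower_of_eq_coe hE, sub_zero, div_self hs1.ne', ENNReal.ofReal_one,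
      one_mul]
  · obtain ⟨e, he, hcmp⟩ := hμ t ⟨h0, ht.2⟩
    have hst := genSin_pos_of_mem (κ := K * Θ / N) (s := 1 - t)
      ⟨sub_pos.2 ht.2, by linarith⟩ hlt
    rw [entropyPower_of_eq_coe he, ← ENNReal.ofReal_mul (div_pos hst hs1).le]
    refine ENNReal.ofReal_le_ofReal ?_
    rw [div_mul_eq_mul_div, div_le_iff₀ hs1, mul_comm]
    -- `genSin` is continuous in its parameter away from `0`; the parameter `0` only occurs for
    -- `K = 0`, where every approximating problem has this same parameter.
    rcases eq_or_ne K 0 with hK | hK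
    · exact hcmp _ hlt (Or.inr ⟨hK, by rw [hK]; simp⟩)
    · exact comparison_of_forall_lt (div_ne_zero (mul_ne_zero hK hΘpos.ne') hN.ne') hlt
        fun κ' h1 h2 => hcmp κ' h2 (Or.inl h1)
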